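/- **Setting.** Let $m,n\ge 1$, let $A\in\mathbb R^{m\times n}$ have at least one nonzero entry in every row and in every column, and let $\epsilon>0$. Let $\mathbb B^n$ be the Euclidean unit ball of $\mathbb R^n$, $\Delta^m$ the probability simplex of $\mathbb R^m$, $\mathcal Z=\mathbb B^n\times\Delta^m$, and for $z=(z^{x},z^{y})\in\mathcal Z$ put $$\mathrm{Gap}(z)=\max_{y'\in\Delta^m}(y')^\top A z^{x}-\min_{x'\in\mathbb B^n}(z^{y})^\top A x'.$$ Let $\mathrm{cs}_j$ be the number of nonzero entries of column $j$ and $\mathrm{rcs}$ the maximum number of nonzero entries in a row or a column. Put $$V_1=\|A\|_F^2,\qquad V_2=\mathrm{rcs}\cdot\max_i\|A_{i:}\|_2^2,\qquad V_3=\Big(\max_i\|A_{i:}\|_1\Big)\Big(\max_j\|A_{:j}\|_1\Big),$$ $$L=L_{\mathrm{co}}^{2,1}=\sqrt{\max_i\|A_{i:}\|_1^2+\min(V_1,V_2,V_3)}.$$ **Algorithm.** Let $r(z)=\frac12\|z^{x}\|_2^2+\sum_i [z^{y}]_i\log [z^{y}]_i$, with Bregman divergence $V_z(w)=r(w)-r(z)-\langle\nabla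 r(z),w-z\rangle$, let $\mathrm{clip}$ truncate each coordinate of the $y$-block to $[-1,1]$ and leave the $x$-block unchanged, and let $$\Theta=\tfrac12+\log m,\qquad \eta=\frac{\epsilon}{9L^2},\qquad T=\Big\lceil\frac{6\Theta}{\eta\epsilon}\Big\rceil .$$ For a scheme $k\in\{1,2,3\}$, draw $(i,j)$ from $p(z)$ and, independently, $(i',j')$ from $q^{(k)}(z)$, where $p_{ij}(z)=\frac{|A_{ij}|}{\|A_{i:}\|_1}[z^{y}]_i$ and $$q^{(1)}_{ij}(z)=\frac{A_{ij}^2}{\|A\|_F^2},\qquad q^{(2)}_{ij}(z)=\frac{[z^{x}]_j^2\mathbf 1_{\{A_{ij}\ne0\}}}{\sum_l \mathrm{cs}_l[z^{x}]_l^2},\qquad q^{(3)}_{ij}(z)=\frac{|A_{ij}|[z^{x}]_j^2}{\sum_l\|A_{:l}\|_1[z^{x}]_l^2},$$ and put $$\tilde g(z)=\Big(\frac{A_{ij}[z^{y}]_i}{p_{ij}(z)}e_j,\ -\frac{A_{i'j'}[z^{x}]_{j'}}{q^{(k)}_{i'j'}(z)}e_{i'}\Big),$$ where the second block is $0$ if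 $z^{x}=0$. Stochastic coordinate mirror descent with scheme $k$ starts at $z_0=\arg\min_{\mathcal Z}r$, sets $z_t=\arg\min_{z\in\mathcal Z}\{\langle\mathrm{clip}(\eta\tilde g(z_{t-1})),z\rangle+V_{z_{t-1}}(z)\}$ with fresh samples for $t=1,\dots,T$, and returns $\bar z=\frac1{T+1}\sum_{t=0}^Tz_t$. **Machine model.** Programs run on a randomized unit-cost RAM with exact real arithmetic. Arithmetic, $\exp$, $\log$, square roots, comparisons, memory accesses and biased coin flips take one unit of time. So does each of the following accesses to $A$: return $A_{ij}$; return $\|A_{i:}\|_p$, $\|A_{:j}\|_p$ ($p\in\{1,2\}$) or $\mathrm{cs}_j$; return $\max_i\|A_{i:}\|_p$, $\max_j\|A_{:j}\|_p$, $\mathrm{nnz}(A)$, $\mathrm{rcs}$ or $\|A\|_F$; draw $j$ with probability $|A_{ij}|^p/\|A_{i:}\|_p^p$, or $i$ with probability $|A_{ij}|^p/\|A_{:j}\|_p^p$ ($p\in\{1,2\}$); draw a uniformly random nonzero position of a column. **Theorem.** There are a single program $P$, whose text does not depend on the input, and an absolute constant $C$ such that for all $m,n,A$ as above there is a scheme $k$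 with $V_k=\min(V_1,V_2,V_3)$ for which, for every $\epsilon>0$: 1. on input $(m,n,\epsilon)$, with access to $A$, the program $P$ outputs a point distributed exactly as the output $\bar z$ of stochastic coordinate mirror descent with scheme $k$, and, whatever the random choices are, its running time is at most $$C\Big(\frac{L^2\log(2m)\log(2mn)}{\epsilon^2}+m+n\Big),$$ and, if $m\ge2$, at most $$C\Big(\frac{L^2\log m\,\log(mn)}{\epsilon^2}+m+n\Big);$$ 2. $\bar z\in\mathcal Z$ always, and $\mathbb E\,\mathrm{Gap}(\bar z)\le\epsilon$. -/

import Mathlib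

noncomputable section

namespace L2L1

/-! ### Norms and sparsity measures of a matrix -/

/-- `‖A_{i:}‖₁` -/
def rowL1 {m n : ℕ} (A : Matrix (Fin m) (Fin n) ℝ) (i : Fin m) : ℝ := ∑ j, |A i j|

/-- `‖A_{i:}‖₂` -/
def rowL2 {m n : ℕ} (A : Matrix (Fin m) (Fin n) ℝ) (i : Fin m) : ℝ := √(∑ j, A i j ^ 2)

/-- `‖A_{:j}‖₁` -/
def colL1 {m n : ℕ} (A : Matrix (Fin m) (Fin n) ℝ) (j : Fin n) : ℝ := ∑ i, |A i j|

/-- `‖A_{:j}‖₂` -/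
def colL2 {m n : ℕ} (A : Matrix (Fin m) (Fin n) ℝ) (j : Fin n) : ℝ := √(∑ i, A i j ^ 2)

/-- The Frobenius norm `‖A‖_F`. -/
def frob {m n : ℕ} (A : Matrix (Fin m) (Fin n) ℝ) : ℝ := √(∑ i, ∑ j, A i j ^ 2)

/-- The number of nonzero entries of row `i`. -/
def rowNnz {m n : ℕ} (A : Matrix (Fin m) (Fin n) ℝ) (i : Fin m) : ℕ :=
  Set.ncard {j : Fin n | A i j ≠ 0}

/-- `cs_j`, the number of nonzero entries of column `j`. -/
def colNnz {m n : ℕ} (A : Matrix (Fin m) (Fin n) ℝ) (j : Fin n) : ℕ :=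
  Set.ncard {i : Fin m | A i j ≠ 0}

/-- The number of nonzero entries of `A`. -/
def nnz {m n : ℕ} (A : Matrix (Fin m) (Fin n) ℝ) : ℕ :=
  Set.ncard {p : Fin m × Fin n | A p.1 p.2 ≠ 0}

/-- `rcs`, the maximum number of nonzero entries in any row or column. -/
def rcs {m n : ℕ} (A : Matrix (Fin m) (Fin n) ℝ) : ℕ :=
  max (Finset.univ.sup (rowNnz A)) (Finset.univ.sup (colNnz A))

/-! ### The bilinear saddle-point problem over (ball) × (simplex) -/

/-- A pair `z = (z^x, z^y)` in `ℝⁿ × ℝᵐ`. -/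
abbrev Point (n m : ℕ) : Type := (Fin n → ℝ) × (Fin m → ℝ)

/-- The unit Euclidean ball of `ℝⁿ`. -/
def unitBall (n : ℕ) : Set (Fin n → ℝ) := {x | ∑ j, x j ^ 2 ≤ 1}

/-- `𝒵 = 𝔹ⁿ × Δᵐ`. -/
def domain (n m : ℕ) : Set (Point n m) := unitBall n ×ˢ stdSimplex ℝ (Fin m)

/-- `f(x, y) = yᵀ A x`. -/
def objective {m n : ℕ} (A : Matrix (Fin m) (Fin n) ℝ) (x : Fin n → ℝ) (y : Fin m → ℝ) : ℝ :=
  ∑ i, ∑ j, y i * A i j * x j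

/-- The duality gap `max_{y' ∈ Δᵐ} f(z^x, y') - min_{x' ∈ 𝔹ⁿ} f(x', z^y)`. -/
def gap {m n : ℕ} (A : Matrix (Fin m) (Fin n) ℝ) (z : Point n m) : ℝ :=
  sSup ((fun y' => objective A z.1 y') '' stdSimplex ℝ (Fin m)) -
    sInf ((fun x' => objective A x' z.2) '' unitBall n)

/-! ### The `ℓ₂`-`ℓ₁` setup -/

/-- The distance generating function `½‖z^x‖₂² + ∑ᵢ [z^y]ᵢ log [z^y]ᵢ` (with `0 log 0 = 0`). -/
def distGen {n m : ℕ} (z : Point n m) : ℝ :=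
  (1 / 2) * ∑ j, z.1 j ^ 2 + ∑ i, z.2 i * Real.log (z.2 i)

/-- The Bregman divergence `V_z(w) = r(w) - r(z) - ⟨∇r(z), w - z⟩`. -/
def bregman {n m : ℕ} (z w : Point n m) : ℝ :=
  distGen w - distGen z - fderiv ℝ distGen z (w - z)

/-- The range `Θ = ½ + log m` of the distance generating function. -/
def setupRange (m : ℕ) : ℝ := 1 / 2 + Real.log m

/-- `clip(δ) = (δ^x, sign(δ^y) ∘ min{1, |δ^y|})`. -/
def clip {n m : ℕ} (d : Point n m) : Point n m :=
  (d.1, fun i => Real.sign (d.2 i) * min 1 |d.2 i|)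

/-- The inner product of `ℝⁿ × ℝᵐ`. -/
def pairing {n m : ℕ} (d z : Point n m) : ℝ := ∑ j, d.1 j * z.1 j + ∑ i, d.2 i * z.2 i

/-- A minimizer of `F` over `S` (it is unique in each use below). -/
def argminOn {n m : ℕ} (S : Set (Point n m)) (F : Point n m → ℝ) : Point n m :=
  Classical.epsilon fun z => z ∈ S ∧ IsMinOn F S z

/-! ### The three sampling schemes -/

inductive Scheme : Type
  | frobenius
  | support
  | columnAbs

/-- The scheme-dependent part of the squared Lipschitz constant. -/
def schemeConst {m n : ℕ} (A : Matrix (Fin m) (Fin n) ℝ) : Scheme → ℝ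
  | .frobenius => frob A ^ 2
  | .support => (rcs A : ℝ) * ⨆ i, rowL2 A i ^ 2
  | .columnAbs => (⨆ i, rowL1 A i) * ⨆ j, colL1 A j

/-- The constant `L_co^{2,1}`. -/
def Lco {m n : ℕ} (A : Matrix (Fin m) (Fin n) ℝ) : ℝ :=
  √((⨆ i, rowL1 A i ^ 2) +
    min (frob A ^ 2)
      (min ((rcs A : ℝ) * ⨆ i, rowL2 A i ^ 2) ((⨆ i, rowL1 A i) * ⨆ j, colL1 A j)))

/-- `k` is a best choice among the three schemes for the matrix `A`. -/
def IsBest {m n : ℕ} (A : Matrix (Fin m) (Fin n) ℝ) (k : Scheme) : Prop :=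
  ∀ k', schemeConst A k ≤ schemeConst A k'

/-- `p_{ij}(z) = |A_{ij}| / ‖A_{i:}‖₁ · [z^y]_i`, the same for the three schemes. -/
def pProb {m n : ℕ} (A : Matrix (Fin m) (Fin n) ℝ) (z : Point n m) (s : Fin m × Fin n) : ℝ :=
  |A s.1 s.2| / rowL1 A s.1 * z.2 s.1

/-- `q_{ij}(z)` for the three schemes. -/
def qProb {m n : ℕ} (A : Matrix (Fin m) (Fin n) ℝ) (k : Scheme) (z : Point n m)
    (s : Fin m × Fin n) : ℝ :=
  match k with
  | .frobenius => A s.1 s.2 ^ 2 / frob A ^ 2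
  | .support =>
      (z.1 s.2 ^ 2 * if A s.1 s.2 = 0 then 0 else 1) / ∑ l, (colNnz A l : ℝ) * z.1 l ^ 2
  | .columnAbs => |A s.1 s.2| * z.1 s.2 ^ 2 / ∑ l, colL1 A l * z.1 l ^ 2

open Classical in
/-- The law on a finite type proportional to the nonnegative weights `w`; if all weights vanish,
the uniform law, by convention. -/
def propTo {α : Type} [Fintype α] [Nonempty α] (w : α → ℝ) : PMF α :=
  if h : (∑ a, ENNReal.ofReal (w a)) ≠ 0 then
    PMF.normalize (fun a => ENNReal.ofReal (w a)) (by rwa [tsum_fintype])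
      (by rw [tsum_fintype]; exact ENNReal.sum_ne_top.2 fun _ _ => ENNReal.ofReal_ne_top)
  else PMF.uniformOfFintype α

/-- The coordinate gradient estimator at `z` for the sampled pairs `s = (i^x, j^x)` and
`s' = (i^y, j^y)`. If `z^x = 0` the second block is `0`, for each scheme (recall `0 / 0 = 0`). -/
def estimator {m n : ℕ} (A : Matrix (Fin m) (Fin n) ℝ) (k : Scheme) (z : Point n m)
    (s s' : Fin m × Fin n) : Point n m :=
  (Pi.single s.2 (A s.1 s.2 * z.2 s.1 / pProb A z s),
   Pi.single s'.1 (-(A s'.1 s'.2 * z.1 s'.2) / qProb A k z s'))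

/-- The law of the estimator: `(i^x, j^x) ∼ p(z)` and, independently, `(i^y, j^y) ∼ q(z)`. -/
def estimatorLaw {m n : ℕ} [NeZero m] [NeZero n] (A : Matrix (Fin m) (Fin n) ℝ) (k : Scheme)
    (z : Point n m) : PMF (Point n m) :=
  (propTo (pProb A z)).bind fun s => (propTo (qProb A k z)).map fun s' => estimator A k z s s'

/-! ### Stochastic mirror descent with clipping -/

/-- `z₀ = argmin_{z ∈ 𝒵} r(z)`. -/
def startPoint (n m : ℕ) : Point n m := argminOn (domain n m) distGen

/-- `argmin_{w ∈ 𝒵} { ⟨clip(η g), w⟩ + V_z(w) }`. -/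
def proxStep {n m : ℕ} (η : ℝ) (z g : Point n m) : Point n m :=
  argminOn (domain n m) fun w => pairing (clip (η • g)) w + bregman z w

/-- The joint law of `(z_t, z_0 + ⋯ + z_t)`. -/
def iterateLaw {m n : ℕ} [NeZero m] [NeZero n] (A : Matrix (Fin m) (Fin n) ℝ) (k : Scheme)
    (η : ℝ) : ℕ → PMF (Point n m × Point n m)
  | 0 => PMF.pure (startPoint n m, startPoint n m)
  | t + 1 => (iterateLaw A k η t).bind fun p =>
      (estimatorLaw A k p.1).map fun g => (proxStep η p.1 g, p.2 + proxStep η p.1 g)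

/-- The law of the output `(z_0 + ⋯ + z_T) / (T + 1)` of `T` iterations with step size `η`. -/
def mirrorDescent {m n : ℕ} [NeZero m] [NeZero n] (A : Matrix (Fin m) (Fin n) ℝ) (k : Scheme)
    (η : ℝ) (T : ℕ) : PMF (Point n m) :=
  (iterateLaw A k η T).map fun p => ((T : ℝ) + 1)⁻¹ • p.2

/-- `η = ε / (9 L²)`. -/
def stepSize {m n : ℕ} (A : Matrix (Fin m) (Fin n) ℝ) (ε : ℝ) : ℝ := ε / (9 * Lco A ^ 2)

/-- `T = ⌈6 Θ / (η ε)⌉`. -/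
def numIters {m n : ℕ} (A : Matrix (Fin m) (Fin n) ℝ) (ε : ℝ) : ℕ :=
  ⌈6 * setupRange m / (stepSize A ε * ε)⌉₊

/-! ### A randomized unit-cost RAM with oracle access to a matrix

A program is a finite piece of syntax that does not depend on the input. The memory consists of
variables and (statically named, dynamically indexed) arrays, for natural numbers and for real
numbers. Each arithmetic operation, memory access, comparison, biased coin flip and oracle call
costs one unit. Reals are exact; no operation turns a real into a natural number except comparison.
-/

/-- The exponents `p ∈ {1, 2}` of the matrix access model. -/
inductive Expo : Type
  | one
  | two

/-- Natural-number expressions. -/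
inductive NExp : Type
  | lit (c : ℕ)
  | var (x : ℕ)
  | arr (a : ℕ) (i : NExp)
  | add (e₁ e₂ : NExp)
  | sub (e₁ e₂ : NExp)
  | half (e : NExp)
  /-- oracle: the number of nonzero entries of column `j` -/
  | colNnz (j : NExp)
  /-- oracle: the number of nonzero entries of the matrix -/
  | nnz
  /-- oracle: the maximum number of nonzero entries in a row or column -/
  | rcs

/-- Real expressions. -/
inductive RExp : Type
  | ofNat (e : NExp)
  | var (x : ℕ)
  | arr (a : ℕ) (i : NExp)
  | add (e₁ e₂ : RExp)
  | sub (e₁ e₂ : RExp)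
  | mul (e₁ e₂ : RExp)
  | div (e₁ e₂ : RExp)
  | exp (e : RExp)
  | log (e : RExp)
  | sqrt (e : RExp)
  /-- oracle: `A_{ij}` -/
  | entry (i j : NExp)
  /-- oracle: `‖A_{i:}‖_p` -/
  | rowNorm (p : Expo) (i : NExp)
  /-- oracle: `‖A_{:j}‖_p` -/
  | colNorm (p : Expo) (j : NExp)
  /-- oracle: `max_i ‖A_{i:}‖_p` -/
  | maxRowNorm (p : Expo)
  /-- oracle: `max_j ‖A_{:j}‖_p` -/
  | maxColNorm (p : Expo)
  /-- oracle: `‖A‖_F` -/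
  | frob

/-- Boolean tests. -/
inductive Test : Type
  | natLt (e₁ e₂ : NExp)
  | realLt (e₁ e₂ : RExp)
  | not (b : Test)

/-- Programs. -/
inductive Prog : Type
  | skip
  | setNat (x : ℕ) (e : NExp)
  | setReal (x : ℕ) (e : RExp)
  | storeNat (a : ℕ) (i e : NExp)
  | storeReal (a : ℕ) (i : NExp) (e : RExp)
  /-- set the natural variable `x` to `1` with probability `e` and to `0` otherwise -/
  | coin (x : ℕ) (e : RExp)
  /-- oracle: draw `j` with probability `|A_{ij}|^p / ‖A_{i:}‖_p^p` into the variable `x` -/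
  | sampleRow (x : ℕ) (p : Expo) (i : NExp)
  /-- oracle: draw `i` with probability `|A_{ij}|^p / ‖A_{:j}‖_p^p` into the variable `x` -/
  | sampleCol (x : ℕ) (p : Expo) (j : NExp)
  /-- oracle: draw a uniform nonzero position of column `j` into the variable `x` -/
  | sampleColSupport (x : ℕ) (j : NExp)
  | seq (c₁ c₂ : Prog)
  | ite (b : Test) (c₁ c₂ : Prog)
  | loop (b : Test) (c : Prog)

/-- The memory. -/
structure Memory : Type where
  natVar : ℕ → ℕ
  realVar : ℕ → ℝ
  natArr : ℕ → ℕ → ℕ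
  realArr : ℕ → ℕ → ℝ

/-- The number of unit-cost operations in the evaluation of an expression. -/
def NExp.cost : NExp → ℕ
  | .lit _ => 1
  | .var _ => 1
  | .arr _ i => i.cost + 1
  | .add e₁ e₂ => e₁.cost + e₂.cost + 1
  | .sub e₁ e₂ => e₁.cost + e₂.cost + 1
  | .half e => e.cost + 1
  | .colNnz j => j.cost + 1
  | .nnz => 1
  | .rcs => 1

/-- The number of unit-cost operations in the evaluation of an expression. -/
def RExp.cost : RExp → ℕ
  | .ofNat e => e.cost + 1
  | .var _ => 1
  | .arr _ i => i.cost + 1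
  | .add e₁ e₂ => e₁.cost + e₂.cost + 1
  | .sub e₁ e₂ => e₁.cost + e₂.cost + 1
  | .mul e₁ e₂ => e₁.cost + e₂.cost + 1
  | .div e₁ e₂ => e₁.cost + e₂.cost + 1
  | .exp e => e.cost + 1
  | .log e => e.cost + 1
  | .sqrt e => e.cost + 1
  | .entry i j => i.cost + j.cost + 1
  | .rowNorm _ i => i.cost + 1
  | .colNorm _ j => j.cost + 1
  | .maxRowNorm _ => 1
  | .maxColNorm _ => 1
  | .frob => 1

/-- The number of unit-cost operations in the evaluation of a test. -/
def Test.cost : Test → ℕ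
  | .natLt e₁ e₂ => e₁.cost + e₂.cost + 1
  | .realLt e₁ e₂ => e₁.cost + e₂.cost + 1
  | .not b => b.cost + 1

/-- `‖A_{i:}‖_p` -/
def rowNorm {m n : ℕ} (A : Matrix (Fin m) (Fin n) ℝ) : Expo → Fin m → ℝ
  | .one => rowL1 A
  | .two => rowL2 A

/-- `‖A_{:j}‖_p` -/
def colNorm {m n : ℕ} (A : Matrix (Fin m) (Fin n) ℝ) : Expo → Fin n → ℝ
  | .one => colL1 A
  | .two => colL2 A

/-- `|a|^p` -/
def absPow : Expo → ℝ → ℝ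
  | .one, a => |a|
  | .two, a => a ^ 2

/-- The value of an expression; oracle calls with an index out of range return `0`. -/
def NExp.eval {m n : ℕ} (A : Matrix (Fin m) (Fin n) ℝ) (s : Memory) : NExp → ℕ
  | .lit c => c
  | .var x => s.natVar x
  | .arr a i => s.natArr a (i.eval A s)
  | .add e₁ e₂ => e₁.eval A s + e₂.eval A s
  | .sub e₁ e₂ => e₁.eval A s - e₂.eval A s
  | .half e => e.eval A s / 2
  | .colNnz j => if h : j.eval A s < n then L2L1.colNnz A ⟨j.eval A s, h⟩ else 0
  | .nnz => L2L1.nnz A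
  | .rcs => L2L1.rcs A

/-- The value of an expression; oracle calls with an index out of range return `0`. -/
def RExp.eval {m n : ℕ} (A : Matrix (Fin m) (Fin n) ℝ) (s : Memory) : RExp → ℝ
  | .ofNat e => (e.eval A s : ℝ)
  | .var x => s.realVar x
  | .arr a i => s.realArr a (i.eval A s)
  | .add e₁ e₂ => e₁.eval A s + e₂.eval A s
  | .sub e₁ e₂ => e₁.eval A s - e₂.eval A s
  | .mul e₁ e₂ => e₁.eval A s * e₂.eval A s
  | .div e₁ e₂ => e₁.eval A s / e₂.eval A s
  | .exp e => Real.exp (e.eval A s)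
  | .log e => Real.log (e.eval A s)
  | .sqrt e => √(e.eval A s)
  | .entry i j =>
      if h : i.eval A s < m ∧ j.eval A s < n then A ⟨i.eval A s, h.1⟩ ⟨j.eval A s, h.2⟩ else 0
  | .rowNorm p i => if h : i.eval A s < m then L2L1.rowNorm A p ⟨i.eval A s, h⟩ else 0
  | .colNorm p j => if h : j.eval A s < n then L2L1.colNorm A p ⟨j.eval A s, h⟩ else 0
  | .maxRowNorm p => ⨆ i, L2L1.rowNorm A p i
  | .maxColNorm p => ⨆ j, L2L1.colNorm A p j
  | .frob => L2L1.frob A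

/-- The truth of a test. -/
def Test.holds {m n : ℕ} (A : Matrix (Fin m) (Fin n) ℝ) (s : Memory) : Test → Prop
  | .natLt e₁ e₂ => e₁.eval A s < e₂.eval A s
  | .realLt e₁ e₂ => e₁.eval A s < e₂.eval A s
  | .not b => ¬ b.holds A s

/-- Assignment to a natural variable. -/
def Memory.setNat (s : Memory) (x v : ℕ) : Memory :=
  { s with natVar := Function.update s.natVar x v }

/-- Assignment to a real variable. -/
def Memory.setReal (s : Memory) (x : ℕ) (v : ℝ) : Memory :=
  { s with realVar := Function.update s.realVar x v }

/-- Assignment to a cell of a natural array. -/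
def Memory.storeNat (s : Memory) (a i v : ℕ) : Memory :=
  { s with natArr := Function.update s.natArr a (Function.update (s.natArr a) i v) }

/-- Assignment to a cell of a real array. -/
def Memory.storeReal (s : Memory) (a i : ℕ) (v : ℝ) : Memory :=
  { s with realArr := Function.update s.realArr a (Function.update (s.realArr a) i v) }

/-- A biased coin: `1` with probability `p` (clamped to `[0, 1]`), otherwise `0`. -/
def coinLaw (p : ℝ) : PMF ℕ := (propTo ![1 - max 0 (min 1 p), max 0 (min 1 p)]).map Fin.val

/-- The row sampling oracle; it returns `0` on an index out of range. -/
def rowSample {m n : ℕ} [NeZero n] (A : Matrix (Fin m) (Fin n) ℝ) (p : Expo) (i : ℕ) : PMF ℕ :=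
  if h : i < m then (propTo fun j => absPow p (A ⟨i, h⟩ j)).map Fin.val else PMF.pure 0

/-- The column sampling oracle; it returns `0` on an index out of range. -/
def colSample {m n : ℕ} [NeZero m] (A : Matrix (Fin m) (Fin n) ℝ) (p : Expo) (j : ℕ) : PMF ℕ :=
  if h : j < n then (propTo fun i => absPow p (A i ⟨j, h⟩)).map Fin.val else PMF.pure 0

/-- The oracle for uniform nonzero positions of columns; it returns `0` on an index out of
range. -/
def colSupportSample {m n : ℕ} [NeZero m] (A : Matrix (Fin m) (Fin n) ℝ) (j : ℕ) : PMF ℕ :=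
  if h : j < n then (propTo fun i => if A i ⟨j, h⟩ = 0 then 0 else 1).map Fin.val
  else PMF.pure 0

/-- A configuration: the stack of programs still to be executed, the memory, and the number of
unit-cost operations performed so far. -/
structure Config : Type where
  todo : List Prog
  mem : Memory
  time : ℕ

open Classical in
/-- One step of execution. A configuration with an empty stack has halted. -/
def Config.step {m n : ℕ} [NeZero m] [NeZero n] (A : Matrix (Fin m) (Fin n) ℝ)
    (c : Config) : PMF Config :=
  match c with
  | ⟨[], s, t⟩ => PMF.pure ⟨[], s, t⟩
  | ⟨.skip :: K, s, t⟩ => PMF.pure ⟨K, s, t + 1⟩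
  | ⟨.setNat x e :: K, s, t⟩ => PMF.pure ⟨K, s.setNat x (e.eval A s), t + e.cost + 1⟩
  | ⟨.setReal x e :: K, s, t⟩ => PMF.pure ⟨K, s.setReal x (e.eval A s), t + e.cost + 1⟩
  | ⟨.storeNat a i e :: K, s, t⟩ =>
      PMF.pure ⟨K, s.storeNat a (i.eval A s) (e.eval A s), t + i.cost + e.cost + 1⟩
  | ⟨.storeReal a i e :: K, s, t⟩ =>
      PMF.pure ⟨K, s.storeReal a (i.eval A s) (e.eval A s), t + i.cost + e.cost + 1⟩
  | ⟨.coin x e :: K, s, t⟩ =>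
      (coinLaw (e.eval A s)).map fun v => ⟨K, s.setNat x v, t + e.cost + 1⟩
  | ⟨.sampleRow x p i :: K, s, t⟩ =>
      (rowSample A p (i.eval A s)).map fun v => ⟨K, s.setNat x v, t + i.cost + 1⟩
  | ⟨.sampleCol x p j :: K, s, t⟩ =>
      (colSample A p (j.eval A s)).map fun v => ⟨K, s.setNat x v, t + j.cost + 1⟩
  | ⟨.sampleColSupport x j :: K, s, t⟩ =>
      (colSupportSample A (j.eval A s)).map fun v => ⟨K, s.setNat x v, t + j.cost + 1⟩
  | ⟨.seq c₁ c₂ :: K, s, t⟩ => PMF.pure ⟨c₁ :: c₂ :: K, s, t + 1⟩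
  | ⟨.ite b c₁ c₂ :: K, s, t⟩ =>
      PMF.pure ⟨(if b.holds A s then c₁ else c₂) :: K, s, t + b.cost + 1⟩
  | ⟨.loop b d :: K, s, t⟩ =>
      PMF.pure ⟨if b.holds A s then d :: .loop b d :: K else K, s, t + b.cost + 1⟩

/-- The law of the configuration after `N` steps. -/
def Config.run {m n : ℕ} [NeZero m] [NeZero n] (A : Matrix (Fin m) (Fin n) ℝ)
    (c : Config) : ℕ → PMF Config
  | 0 => PMF.pure c
  | N + 1 => (c.run A N).bind (Config.step A)

/-- The initial configuration: the natural variables `0` and `1` hold `m` and `n`, the real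
variable `0` holds `ε`, and everything else is `0`. -/
def Prog.start (P : Prog) (m n : ℕ) (ε : ℝ) : Config where
  todo := [P]
  mem :=
    { natVar := fun x => if x = 0 then m else if x = 1 then n else 0
      realVar := fun x => if x = 0 then ε else 0
      natArr := fun _ _ => 0
      realArr := fun _ _ => 0 }
  time := 0

/-- The output: the first block is read from the real array `0`, the second one from the real
array `1`. -/
def Config.output (n m : ℕ) (c : Config) : Point n m :=
  (fun j => c.mem.realArr 0 j, fun i => c.mem.realArr 1 i)

/-- On the matrix `A` and the accuracy `ε`, the program `P` halts after at most `τ` unit-cost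
operations, whatever the random choices are, and its output has the law `μ`. -/
def Prog.Implements (P : Prog) {m n : ℕ} [NeZero m] [NeZero n] (A : Matrix (Fin m) (Fin n) ℝ)
    (ε : ℝ) (τ : ℕ) (μ : PMF (Point n m)) : Prop :=
  ∃ N : ℕ, (∀ c ∈ ((P.start m n ε).run A N).support, c.todo = [] ∧ c.time ≤ τ) ∧
    ((P.start m n ε).run A N).map (Config.output n m) = μ

/-- The expected duality gap of a random point with law `μ` exists and is at most `ε`. -/
def ExpectedGapLE {m n : ℕ} (A : Matrix (Fin m) (Fin n) ℝ) (μ : PMF (Point n m)) (ε : ℝ) : Prop :=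
  Summable (fun z => (μ z).toReal * gap A z) ∧ ∑' z, (μ z).toReal * gap A z ≤ ε

end L2L1

end

noncomputable section

namespace L2L1

/-! ### Finitely supported laws -/

/-! The theorem has an analytic half, the expected gap, and an algorithmic half, exact simulation in
logarithmic time per iteration.

Gap. Each step obeys the deterministic three-point inequality of mirror descent for the sampled,
clipped gradient; telescoping it gives the invariant of `ghostInv_step`. The comparators in the gap
depend on the random run, so the accumulated noise Ξ (true minus clipped estimated gradients, times
η) cannot simply be averaged away. It is maximized over comparators instead: this costs at most ½ +
½‖Ξ^x‖² on the ball and log ∑ exp(-Ξ^y_i) on the simplex. Together with the regret terms these form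
`potential`, which dominates η times the unnormalized gap (`objective_sub_le_of_ghostInv`), starts
at 2Θ, and rises in expectation by at most (5/2)η²L² per step (`expect_potential_step`). The rise is
of second order: the gradient field at z is orthogonal to z by bilinearity, the estimator is
unbiased, and the clipping bias is itself quadratic. The second moments are controlled by
`sum_pLaw_sq` and `sum_qLaw_sq`. Averaging T + 1 iterates gives a gap of at most 2Θ/(η(T+1)) +
(5/2)ηL² ≤ ε/3 + 5ε/18.

Simulation. By `proxStep_eq` a step changes one coordinate of each block and then rescales the
block. Hence the iterate is kept as x = νu and y = w/W, and the running sums as cu + b and c'w + b',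
with scalars ν, c, c'. A changed entry of u or w is compensated in b or b', so apart from the trees
a step touches O(1) cells. The first index of each pair is drawn by descending a binary sum tree,
over w or over the column weights at u (`descendLaw_apply`); the second one comes from an oracle.
The law q does not change when u is rescaled, so projection leaves the column tree alone, and a
changed leaf is repaired along one path. The judgment `Triple` carries the exact law and a
worst-case time bound through the program. -/

theorem sum_ofReal_eq {α : Type} [Fintype α] {w : α → ℝ} (h0 : ∀ a, 0 ≤ w a) :
    ∑ a, ENNReal.ofReal (w a) = ENNReal.ofReal (∑ a, w a) :=
  (ENNReal.ofReal_sum_of_nonneg fun a _ => h0 a).symm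

theorem propTo_apply {α : Type} [Fintype α] [Nonempty α] {w : α → ℝ} (h0 : ∀ a, 0 ≤ w a)
    (hs : 0 < ∑ a, w a) (a : α) : propTo w a = ENNReal.ofReal (w a / ∑ b, w b) := by
  have h : (∑ a, ENNReal.ofReal (w a)) ≠ 0 := by
    rw [sum_ofReal_eq h0]
    simpa using hs
  unfold propTo
  rw [dif_pos h, PMF.normalize_apply, tsum_fintype, sum_ofReal_eq h0,
    ENNReal.ofReal_div_of_pos hs, div_eq_mul_inv]

theorem bind_congr_support {α β : Type} (μ : PMF α) {f g : α → PMF β}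
    (h : ∀ a ∈ μ.support, f a = g a) : μ.bind f = μ.bind g := by
  ext b
  simp only [PMF.bind_apply]
  refine tsum_congr fun a => ?_
  by_cases ha : μ a = 0
  · simp [ha]
  · rw [h a ((PMF.mem_support_iff _ _).2 ha)]

/-- The expectation of `f` under the law `μ`. -/
def expect {α : Type} (μ : PMF α) (f : α → ℝ) : ℝ := ∑' a, (μ a).toReal * f a

theorem expect_eq_sum {α : Type} {μ : PMF α} (s : Finset α) (hs : μ.support ⊆ s) (f : α → ℝ) :
    expect μ f = ∑ a ∈ s, (μ a).toReal * f a := by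
  refine tsum_eq_sum fun a ha => ?_
  have : μ a = 0 := by
    by_contra h
    exact ha (hs ((PMF.mem_support_iff _ _).2 h))
  simp [this]

theorem expect_fintype {α : Type} [Fintype α] (μ : PMF α) (f : α → ℝ) :
    expect μ f = ∑ a, (μ a).toReal * f a :=
  expect_eq_sum Finset.univ (by simp) f

theorem summable_expect {α : Type} {μ : PMF α} (h : μ.support.Finite) (f : α → ℝ) :
    Summable fun a => (μ a).toReal * f a := by
  refine summable_of_ne_finset_zero (s := h.toFinset) fun a ha => ?_
  have : μ a = 0 := by
    by_contra h'
    exact ha (h.mem_toFinset.2 ((PMF.mem_support_iff _ _).2 h'))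
  simp [this]

theorem expect_pure {α : Type} (a : α) (f : α → ℝ) : expect (PMF.pure a) f = f a := by
  rw [expect_eq_sum {a} (by simp)]
  simp

theorem sum_toReal_eq_one {α : Type} [Fintype α] (μ : PMF α) : ∑ a, (μ a).toReal = 1 := by
  rw [← ENNReal.toReal_sum fun a _ => μ.apply_ne_top a, ← tsum_fintype (L := .unconditional _), μ.tsum_coe]
  simp

/-- With finite supports the interchange of sums is a finite one and needs no integrability of `f`.
-/
theorem expect_bind {α β : Type} {μ : PMF α} {κ : α → PMF β} (hμ : μ.support.Finite)
    (hκ : ∀ a ∈ μ.support, (κ a).support.Finite) (f : β → ℝ) :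
    expect (μ.bind κ) f = expect μ fun a => expect (κ a) f := by
  classical
  have hfin : (μ.bind κ).support.Finite := by
    rw [PMF.support_bind]
    exact hμ.biUnion hκ
  have hb : ∀ a ∈ hμ.toFinset, expect (κ a) f = ∑ b ∈ hfin.toFinset, (κ a b).toReal * f b := by
    intro a ha
    refine expect_eq_sum _ (fun b hb => ?_) f
    simp only [Set.Finite.coe_toFinset, PMF.support_bind, Set.mem_iUnion]
    exact ⟨a, hμ.mem_toFinset.1 ha, hb⟩
  have hr : expect μ (fun a => expect (κ a) f) =
      ∑ a ∈ hμ.toFinset, ∑ b ∈ hfin.toFinset, (μ a).toReal * ((κ a b).toReal * f b) := by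
    rw [expect_eq_sum hμ.toFinset (by simp)]
    exact Finset.sum_congr rfl fun a ha => by rw [hb a ha, Finset.mul_sum]
  rw [hr, expect_eq_sum hfin.toFinset (by simp), Finset.sum_comm]
  refine Finset.sum_congr rfl fun b _ => ?_
  rw [PMF.bind_apply, tsum_eq_sum (s := hμ.toFinset), ENNReal.toReal_sum, Finset.sum_mul]
  · refine Finset.sum_congr rfl fun a _ => ?_
    rw [ENNReal.toReal_mul, mul_assoc]
  · exact fun a _ => ENNReal.mul_ne_top (μ.apply_ne_top a) ((κ a).apply_ne_top b)
  · intro a ha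
    have : μ a = 0 := by
      by_contra h'
      exact ha (hμ.mem_toFinset.2 ((PMF.mem_support_iff _ _).2 h'))
    simp [this]

theorem expect_map {α β : Type} {μ : PMF α} (hμ : μ.support.Finite) (g : α → β) (f : β → ℝ) :
    expect (μ.map g) f = expect μ (f ∘ g) := by
  rw [PMF.map, expect_bind hμ (fun a _ => by simp)]
  simp [expect_pure, Function.comp_def]

theorem expect_mono {α : Type} {μ : PMF α} (hμ : μ.support.Finite) {f g : α → ℝ}
    (h : ∀ a ∈ μ.support, f a ≤ g a) : expect μ f ≤ expect μ g := by
  rw [expect_eq_sum hμ.toFinset (by simp), expect_eq_sum hμ.toFinset (by simp)]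
  refine Finset.sum_le_sum fun a ha => ?_
  exact mul_le_mul_of_nonneg_left (h a (hμ.mem_toFinset.1 ha)) ENNReal.toReal_nonneg

theorem sum_support_toReal {α : Type} {μ : PMF α} (hμ : μ.support.Finite) :
    ∑ a ∈ hμ.toFinset, (μ a).toReal = 1 := by
  rw [← ENNReal.toReal_sum fun a _ => μ.apply_ne_top a, ← tsum_eq_sum (L := .unconditional _), μ.tsum_coe]
  · simp
  · intro a ha
    by_contra h'
    exact ha (hμ.mem_toFinset.2 ((PMF.mem_support_iff _ _).2 h'))

theorem expect_add_const {α : Type} {μ : PMF α} (hμ : μ.support.Finite) (f : α → ℝ) (c : ℝ) :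
    expect μ (fun a => f a + c) = expect μ f + c := by
  rw [expect_eq_sum hμ.toFinset (by simp), expect_eq_sum hμ.toFinset (by simp)]
  simp only [mul_add, Finset.sum_add_distrib, ← Finset.sum_mul, sum_support_toReal, one_mul]

/-! ### Closed forms of the proximal steps -/

/-- The Bregman divergence of `t ↦ t log t`, without its linearization at `0`. -/
def entGap (w v : ℝ) : ℝ := w * Real.log w - w * Real.log v - w + v

theorem entGap_nonneg {w v : ℝ} (hw : 0 ≤ w) (hv : 0 < v) : 0 ≤ entGap w v := by
  unfold entGap
  rcases hw.eq_or_lt with rfl | hw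
  · simp [hv.le]
  · have h := Real.log_le_sub_one_of_pos (div_pos hv hw)
    rw [Real.log_div hv.ne' hw.ne'] at h
    have h2 := mul_le_mul_of_nonneg_left h hw.le
    have h3 : w * (v / w - 1) = v - w := by field_simp
    linarith

theorem eq_of_entGap_le {w v : ℝ} (hw : 0 ≤ w) (hv : 0 < v) (h : entGap w v ≤ 0) : w = v := by
  unfold entGap at h
  rcases hw.eq_or_lt with rfl | hw
  · simp at h
    linarith
  · by_contra hne
    have h1 : v / w ≠ 1 := by
      rw [Ne, div_eq_one_iff_eq hw.ne']
      exact fun h => hne h.symm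
    have h := Real.log_lt_sub_one_of_pos (div_pos hv hw) h1
    rw [Real.log_div hv.ne' hw.ne'] at h
    have h2 := mul_lt_mul_of_pos_left h hw
    have h3 : w * (v / w - 1) = v - w := by field_simp
    linarith

theorem mem_domain {n m : ℕ} {z : Point n m} :
    z ∈ domain n m ↔ ∑ j, z.1 j ^ 2 ≤ 1 ∧ (∀ i, 0 ≤ z.2 i) ∧ ∑ i, z.2 i = 1 := Iff.rfl

/-- `argminOn` chooses some minimizer, so a closed form requires uniqueness. The growth bound gives
existence and uniqueness at once: its left side is nonnegative and vanishes only at `w`. -/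
theorem argminOn_eq {n m : ℕ} {F : Point n m → ℝ} {w : Point n m} (hw : w ∈ domain n m)
    (hpos : ∀ i, 0 < w.2 i)
    (h : ∀ u ∈ domain n m,
      (1 / 2) * ∑ j, (u.1 j - w.1 j) ^ 2 + ∑ i, entGap (u.2 i) (w.2 i) ≤ F u - F w) :
    argminOn (domain n m) F = w := by
  have hent : ∀ u ∈ domain n m, ∀ i, 0 ≤ entGap (u.2 i) (w.2 i) := fun u hu i =>
    entGap_nonneg ((mem_domain.1 hu).2.1 i) (hpos i)
  have hmin : w ∈ domain n m ∧ IsMinOn F (domain n m) w := by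
    refine ⟨hw, fun u hu => ?_⟩
    have h1 := h u hu
    have h2 : 0 ≤ ∑ j, (u.1 j - w.1 j) ^ 2 := Finset.sum_nonneg fun j _ => sq_nonneg _
    have h3 := Finset.sum_nonneg fun i (_ : i ∈ Finset.univ) => hent u hu i
    show F w ≤ F u
    linarith
  have hs := Classical.epsilon_spec (p := fun z => z ∈ domain n m ∧ IsMinOn F (domain n m) z)
    ⟨w, hmin⟩
  change argminOn (domain n m) F ∈ domain n m ∧ IsMinOn F (domain n m) (argminOn (domain n m) F)
    at hs
  set u := argminOn (domain n m) F
  have hle : F u ≤ F w := hs.2 hw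
  have h1 := h u hs.1
  have h2 : 0 ≤ ∑ j, (u.1 j - w.1 j) ^ 2 := Finset.sum_nonneg fun j _ => sq_nonneg _
  have h3 := Finset.sum_nonneg fun i (_ : i ∈ Finset.univ) => hent u hs.1 i
  have h4 : ∑ j, (u.1 j - w.1 j) ^ 2 = 0 := by linarith
  have h5 : ∑ i, entGap (u.2 i) (w.2 i) = 0 := by linarith
  rw [Finset.sum_eq_zero_iff_of_nonneg fun j _ => sq_nonneg _] at h4
  rw [Finset.sum_eq_zero_iff_of_nonneg fun i _ => hent u hs.1 i] at h5
  refine Prod.ext (funext fun j => ?_) (funext fun i => ?_)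
  · have := h4 j (Finset.mem_univ _)
    have := pow_eq_zero_iff (two_ne_zero) |>.1 this
    linarith
  · exact eq_of_entGap_le ((mem_domain.1 hs.1).2.1 i) (hpos i) (h5 i (Finset.mem_univ _)).le

theorem startPoint_eq {n m : ℕ} [NeZero m] :
    startPoint n m = (fun _ => 0, fun _ => (m : ℝ)⁻¹) := by
  have hm : (0 : ℝ) < m := by exact_mod_cast Nat.pos_of_ne_zero (NeZero.ne m)
  refine argminOn_eq ?_ (fun i => by simpa using hm) fun u hu => ?_
  · refine mem_domain.2 ⟨by simp, fun i => by simp, ?_⟩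
    simp [hm.ne']
  · have h1 := (mem_domain.1 hu).2.2
    simp only [distGen, entGap, Finset.sum_add_distrib, Finset.sum_sub_distrib, ← Finset.sum_mul,
      h1]
    simp
    have : (m : ℝ) * ((m : ℝ)⁻¹ * Real.log m) = Real.log m := by field_simp
    linarith

theorem hasFDerivAt_distGen {n m : ℕ} (z : Point n m) (hpos : ∀ i, 0 < z.2 i) :
    ∃ D : Point n m →L[ℝ] ℝ, HasFDerivAt distGen D z ∧
      ∀ d, D d = ∑ j, z.1 j * d.1 j + ∑ i, (Real.log (z.2 i) + 1) * d.2 i := by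
  have h1 : ∀ j : Fin n, HasFDerivAt (fun w : Point n m => w.1 j ^ 2)
      ((2 * z.1 j) • ((ContinuousLinearMap.proj (R := ℝ) (φ := fun _ => ℝ) j).comp
        (ContinuousLinearMap.fst ℝ (Fin n → ℝ) (Fin m → ℝ)))) z := by
    intro j
    have := (((ContinuousLinearMap.proj (R := ℝ) (φ := fun _ => ℝ) j).comp
        (ContinuousLinearMap.fst ℝ (Fin n → ℝ) (Fin m → ℝ))).hasFDerivAt (x := z)).pow 2
    simpa using this
  have h2 : ∀ i : Fin m, HasFDerivAt (fun w : Point n m => w.2 i * Real.log (w.2 i))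
      ((Real.log (z.2 i) + 1) • ((ContinuousLinearMap.proj (R := ℝ) (φ := fun _ => ℝ) i).comp
        (ContinuousLinearMap.snd ℝ (Fin n → ℝ) (Fin m → ℝ)))) z := by
    intro i
    exact (Real.hasDerivAt_mul_log (hpos i).ne').comp_hasFDerivAt z
      (((ContinuousLinearMap.proj (R := ℝ) (φ := fun _ => ℝ) i).comp
        (ContinuousLinearMap.snd ℝ (Fin n → ℝ) (Fin m → ℝ))).hasFDerivAt (x := z))
  refine ⟨_, ((HasFDerivAt.fun_sum fun j _ => h1 j).const_mul (1 / 2)).add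
    (HasFDerivAt.fun_sum (u := Finset.univ) fun i _ => h2 i), fun d => ?_⟩
  simp [Finset.mul_sum, ← mul_assoc]

/-- Positivity matters: at a zero coordinate t log t is not differentiable and `fderiv` takes its
default value 0. All iterates therefore have to be kept in the interior of the simplex. -/
theorem bregman_eq {n m : ℕ} (z w : Point n m) (hpos : ∀ i, 0 < z.2 i) :
    bregman z w = distGen w - distGen z -
      (∑ j, z.1 j * (w.1 j - z.1 j) + ∑ i, (Real.log (z.2 i) + 1) * (w.2 i - z.2 i)) := by
  obtain ⟨D, hD, h⟩ := hasFDerivAt_distGen z hpos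
  simp [bregman, hD.fderiv, h]

/-- The Euclidean projection onto the unit ball. -/
def ballProj {n : ℕ} (v : Fin n → ℝ) : Fin n → ℝ :=
  if 1 < ∑ j, v j ^ 2 then fun j => v j / √(∑ l, v l ^ 2) else v

/-- The multiplicative weights update of `y` by `c`. -/
def mwu {m : ℕ} (y c : Fin m → ℝ) : Fin m → ℝ :=
  fun i => y i * Real.exp (-c i) / ∑ l, y l * Real.exp (-c l)

theorem sum_sq_ballProj_le {n : ℕ} (v : Fin n → ℝ) : ∑ j, ballProj v j ^ 2 ≤ 1 := by
  unfold ballProj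
  split_ifs with h
  · simp only [div_pow, ← Finset.sum_div]
    rw [Real.sq_sqrt (by linarith)]
    exact div_self_le_one _
  · linarith

/-- Pythagorean inequality of a projection: the angle at the projected point is not acute, which for
v outside the ball follows from Cauchy–Schwarz. -/
theorem sum_sq_sub_ballProj_le {n : ℕ} (v x : Fin n → ℝ) (hx : ∑ j, x j ^ 2 ≤ 1) :
    ∑ j, (x j - ballProj v j) ^ 2 + ∑ j, (ballProj v j - v j) ^ 2 ≤ ∑ j, (x j - v j) ^ 2 := by
  have key : 0 ≤ ∑ j, (x j - ballProj v j) * (ballProj v j - v j) := by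
    unfold ballProj
    split_ifs with h
    · set S := ∑ l, v l ^ 2 with hS
      have hS0 : 0 < S := by linarith
      have hr : 1 < √S := by rw [Real.lt_sqrt] <;> linarith
      have hrr : √S * √S = S := Real.mul_self_sqrt hS0.le
      have e : ∀ j, (x j - v j / √S) * (v j / √S - v j) =
          (1 / √S - 1) * (x j * v j) - (1 / √S - 1) / √S * v j ^ 2 := fun j => by ring
      simp only [e, Finset.sum_sub_distrib, ← Finset.mul_sum, ← hS]
      have cs := Finset.sum_mul_sq_le_sq_mul_sq Finset.univ x v
      have hle : ∑ j, x j * v j ≤ √S := by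
        apply Real.le_sqrt_of_sq_le
        nlinarith
      have hneg : 1 / √S - 1 ≤ 0 := by
        rw [sub_nonpos, div_le_one (by linarith)]
        exact hr.le
      have e2 : (1 / √S - 1) / √S * S = (1 / √S - 1) * √S := by
        have : √S ≠ 0 := by linarith
        field_simp
        nlinarith
      rw [e2]
      nlinarith
    · simp
  have e : ∀ j, (x j - v j) ^ 2 = (x j - ballProj v j) ^ 2 + (ballProj v j - v j) ^ 2 +
      2 * ((x j - ballProj v j) * (ballProj v j - v j)) := fun j => by ring
  simp only [e, Finset.sum_add_distrib, ← Finset.mul_sum]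
  linarith

theorem mwu_sum_pos {m : ℕ} [NeZero m] {y : Fin m → ℝ} (c : Fin m → ℝ) (hy : ∀ i, 0 < y i) :
    0 < ∑ l, y l * Real.exp (-c l) :=
  Finset.sum_pos (fun l _ => mul_pos (hy l) (Real.exp_pos _)) ⟨0, Finset.mem_univ _⟩

theorem mwu_pos {m : ℕ} [NeZero m] {y : Fin m → ℝ} (c : Fin m → ℝ) (hy : ∀ i, 0 < y i) (i : Fin m) :
    0 < mwu y c i :=
  div_pos (mul_pos (hy i) (Real.exp_pos _)) (mwu_sum_pos c hy)

theorem sum_mwu {m : ℕ} [NeZero m] {y : Fin m → ℝ} (c : Fin m → ℝ) (hy : ∀ i, 0 < y i) :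
    ∑ i, mwu y c i = 1 := by
  simp only [mwu, ← Finset.sum_div]
  exact div_self (mwu_sum_pos c hy).ne'

theorem log_mwu {m : ℕ} [NeZero m] {y : Fin m → ℝ} (c : Fin m → ℝ) (hy : ∀ i, 0 < y i)
    (i : Fin m) :
    Real.log (mwu y c i) = Real.log (y i) - c i - Real.log (∑ l, y l * Real.exp (-c l)) := by
  rw [mwu, Real.log_div (mul_pos (hy i) (Real.exp_pos _)).ne' (mwu_sum_pos c hy).ne',
    Real.log_mul (hy i).ne' (Real.exp_pos _).ne', Real.log_exp]
  ring

/-- The objective separates into blocks. Completing the square turns the ball block into a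
projection. On the simplex the excess of the objective is exactly a relative entropy, because the
logarithm of the normalization is multiplied by two total masses that are both 1. -/
theorem proxStep_eq {n m : ℕ} [NeZero m] (η : ℝ) (z g : Point n m) (hpos : ∀ i, 0 < z.2 i) :
    proxStep η z g =
      (ballProj fun j => z.1 j - η * g.1 j, mwu z.2 (clip (η • g)).2) := by
  set c := (clip (η • g)).2 with hc
  set v : Fin n → ℝ := fun j => z.1 j - η * g.1 j with hv
  have hwpos : ∀ i, 0 < mwu z.2 c i := mwu_pos c hpos
  have hw1 : ∑ i, mwu z.2 c i = 1 := sum_mwu c hpos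
  refine argminOn_eq (mem_domain.2 ⟨sum_sq_ballProj_le v, fun i => (hwpos i).le, hw1⟩) hwpos
    fun u hu => ?_
  obtain ⟨hu1, hu2, hu3⟩ := mem_domain.1 hu
  have hx := sum_sq_sub_ballProj_le v u.1 hu1
  have hfst : ∀ j, (clip (η • g)).1 j = η * g.1 j := fun j => rfl
  simp only [bregman_eq z _ hpos, pairing, distGen, ← hc, hfst]
  set p := ballProj v with hp
  set q := mwu z.2 c with hq
  set Z := ∑ l, z.2 l * Real.exp (-c l) with hZ
  have hlog : ∀ i, Real.log (z.2 i) = Real.log (q i) + c i + Real.log Z := fun i => by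
    rw [hq, log_mwu c hpos i]; ring
  have e1 : ∀ j, (u.1 j - v j) ^ 2 - (p j - v j) ^ 2 =
      (u.1 j ^ 2 - p j ^ 2) + 2 * (η * g.1 j * u.1 j) - 2 * (η * g.1 j * p j)
        - 2 * (z.1 j * (u.1 j - z.1 j)) + 2 * (z.1 j * (p j - z.1 j)) := fun j => by
    simp only [hv]; ring
  have e1s := Finset.sum_congr rfl fun j (_ : j ∈ (Finset.univ : Finset (Fin n))) => e1 j
  simp only [Finset.sum_sub_distrib, Finset.sum_add_distrib, ← Finset.mul_sum] at e1s
  have e2 : ∀ i, entGap (u.2 i) (q i) = u.2 i * Real.log (u.2 i) - q i * Real.log (q i)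
      + c i * u.2 i - c i * q i - (Real.log (z.2 i) + 1) * (u.2 i - z.2 i)
      + (Real.log (z.2 i) + 1) * (q i - z.2 i) + Real.log Z * u.2 i - Real.log Z * q i := fun i => by
    rw [hlog i]; unfold entGap; ring
  have e2s := Finset.sum_congr rfl fun i (_ : i ∈ (Finset.univ : Finset (Fin m))) => e2 i
  simp only [Finset.sum_sub_distrib, Finset.sum_add_distrib, ← Finset.mul_sum, hu3, hw1] at e2s
  linarith

theorem proxStep_mem {n m : ℕ} [NeZero m] (η : ℝ) (z g : Point n m) (hpos : ∀ i, 0 < z.2 i) :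
    proxStep η z g ∈ domain n m ∧ ∀ i, 0 < (proxStep η z g).2 i := by
  rw [proxStep_eq η z g hpos]
  exact ⟨mem_domain.2 ⟨sum_sq_ballProj_le _, fun i => (mwu_pos _ hpos i).le, sum_mwu _ hpos⟩,
    mwu_pos _ hpos⟩

theorem startPoint_mem {n m : ℕ} [NeZero m] :
    startPoint n m ∈ domain n m ∧ ∀ i, 0 < (startPoint n m).2 i := by
  have hm : (0 : ℝ) < m := by exact_mod_cast Nat.pos_of_ne_zero (NeZero.ne m)
  rw [startPoint_eq]
  refine ⟨mem_domain.2 ⟨by simp, fun i => by simp, by simp [hm.ne']⟩, fun i => by simpa using hm⟩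

/-! ### The gradient field and the moments of its estimator -/

/-- The first block of the gradient field, `Aᵀ y`. -/
def gradX {m n : ℕ} (A : Matrix (Fin m) (Fin n) ℝ) (y : Fin m → ℝ) (j : Fin n) : ℝ :=
  ∑ i, A i j * y i

/-- The negative of the second block of the gradient field, `A x`. -/
def gradY {m n : ℕ} (A : Matrix (Fin m) (Fin n) ℝ) (x : Fin n → ℝ) (i : Fin m) : ℝ :=
  ∑ j, A i j * x j

section Matrix

variable {m n : ℕ} (A : Matrix (Fin m) (Fin n) ℝ)

theorem objective_eq_sum_gradY (x : Fin n → ℝ) (y : Fin m → ℝ) :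
    objective A x y = ∑ i, y i * gradY A x i := by
  simp only [objective, gradY, Finset.mul_sum, mul_assoc]

theorem objective_eq_sum_gradX (x : Fin n → ℝ) (y : Fin m → ℝ) :
    objective A x y = ∑ j, x j * gradX A y j := by
  rw [objective, Finset.sum_comm]
  simp only [gradX, Finset.mul_sum]
  exact Finset.sum_congr rfl fun j _ => Finset.sum_congr rfl fun i _ => by ring

theorem rowL1_nonneg (i : Fin m) : 0 ≤ rowL1 A i := Finset.sum_nonneg fun _ _ => abs_nonneg _

theorem colL1_nonneg (j : Fin n) : 0 ≤ colL1 A j := Finset.sum_nonneg fun _ _ => abs_nonneg _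

theorem rowL2_nonneg (i : Fin m) : 0 ≤ rowL2 A i := Real.sqrt_nonneg _

theorem rowL2_sq (i : Fin m) : rowL2 A i ^ 2 = ∑ j, A i j ^ 2 :=
  Real.sq_sqrt (Finset.sum_nonneg fun _ _ => sq_nonneg _)

theorem colL2_sq (j : Fin n) : colL2 A j ^ 2 = ∑ i, A i j ^ 2 :=
  Real.sq_sqrt (Finset.sum_nonneg fun _ _ => sq_nonneg _)

theorem frob_sq : frob A ^ 2 = ∑ i, ∑ j, A i j ^ 2 :=
  Real.sq_sqrt (Finset.sum_nonneg fun _ _ => Finset.sum_nonneg fun _ _ => sq_nonneg _)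

theorem frob_sq_eq_sum_col : frob A ^ 2 = ∑ j, colL2 A j ^ 2 := by
  simp only [frob_sq, colL2_sq]
  exact Finset.sum_comm

theorem le_iSup_fin {k : ℕ} (f : Fin k → ℝ) (i : Fin k) : f i ≤ ⨆ i, f i :=
  le_ciSup (Set.finite_range f).bddAbove i

theorem rowL1_pos {i : Fin m} (h : ∃ j, A i j ≠ 0) : 0 < rowL1 A i := by
  obtain ⟨j, hj⟩ := h
  exact Finset.sum_pos' (fun _ _ => abs_nonneg _) ⟨j, Finset.mem_univ _, abs_pos.2 hj⟩

theorem colNnz_eq_sum (j : Fin n) : (colNnz A j : ℝ) = ∑ i, if A i j = 0 then 0 else 1 := by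
  classical
  rw [colNnz, Set.ncard_eq_toFinset_card']
  simp [Finset.sum_ite]

theorem colNnz_le_rcs (j : Fin n) : (colNnz A j : ℝ) ≤ rcs A := by
  have h : colNnz A j ≤ Finset.univ.sup (colNnz A) := Finset.le_sup (Finset.mem_univ j)
  exact_mod_cast h.trans (le_max_right _ _)

/-- The column weight of a scheme at `x`: the marginal law of `j` under `q(z)` is proportional
to it. -/
def colWeight : Scheme → (Fin n → ℝ) → Fin n → ℝ
  | .frobenius, _, j => colL2 A j ^ 2
  | .support, x, j => colNnz A j * x j ^ 2
  | .columnAbs, x, j => colL1 A j * x j ^ 2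

/-- The unnormalized conditional law of `i` given `j` under `q(z)`. -/
def condWeight : Scheme → Fin n → Fin m → ℝ
  | .frobenius, j, i => A i j ^ 2
  | .support, j, i => if A i j = 0 then 0 else 1
  | .columnAbs, j, i => |A i j|

/-- The factor by which `condWeight` is multiplied in `q(z)`. -/
def coordWeight : Scheme → (Fin n → ℝ) → Fin n → ℝ
  | .frobenius, _, _ => 1
  | .support, x, j => x j ^ 2
  | .columnAbs, x, j => x j ^ 2

theorem condWeight_nonneg (k : Scheme) (j : Fin n) (i : Fin m) : 0 ≤ condWeight A k j i := by
  cases k <;> simp only [condWeight]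
  · positivity
  · split_ifs <;> simp
  · positivity

theorem coordWeight_nonneg (k : Scheme) (x : Fin n → ℝ) (j : Fin n) : 0 ≤ coordWeight k x j := by
  cases k <;> simp only [coordWeight] <;> positivity

theorem condWeight_ne_zero (k : Scheme) {j : Fin n} {i : Fin m} (h : A i j ≠ 0) :
    condWeight A k j i ≠ 0 := by
  cases k <;> simp [condWeight, h]

theorem sum_condWeight_pos (k : Scheme) {j : Fin n} (h : ∃ i, A i j ≠ 0) :
    0 < ∑ i, condWeight A k j i := by
  obtain ⟨i, hi⟩ := h
  exact Finset.sum_pos' (fun _ _ => condWeight_nonneg A k _ _)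
    ⟨i, Finset.mem_univ _, (condWeight_nonneg A k _ _).lt_of_ne' (condWeight_ne_zero A k hi)⟩

theorem colWeight_eq (k : Scheme) (x : Fin n → ℝ) (j : Fin n) :
    colWeight A k x j = coordWeight k x j * ∑ i, condWeight A k j i := by
  cases k
  · simp [colWeight, coordWeight, condWeight, colL2_sq]
  · simp only [colWeight, coordWeight, condWeight, colNnz_eq_sum, mul_comm]
  · simp only [colWeight, coordWeight, condWeight, colL1, mul_comm]

theorem colWeight_nonneg (k : Scheme) (x : Fin n → ℝ) (j : Fin n) : 0 ≤ colWeight A k x j := by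
  rw [colWeight_eq]
  exact mul_nonneg (coordWeight_nonneg k x j)
    (Finset.sum_nonneg fun i _ => condWeight_nonneg A k j i)

/-- One factorization covers the three schemes. It exhibits the marginal of j and the conditional
law of i given j, which is the order in which the program samples. -/
theorem qProb_eq (k : Scheme) (z : Point n m) (s : Fin m × Fin n) :
    qProb A k z s = coordWeight k z.1 s.2 * condWeight A k s.2 s.1 / ∑ j, colWeight A k z.1 j := by
  cases k
  · simp [qProb, colWeight, coordWeight, condWeight, frob_sq_eq_sum_col]
  · simp only [qProb, colWeight, coordWeight, condWeight]
  · simp only [qProb, colWeight, coordWeight, condWeight, mul_comm]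

variable {A}

theorem sum_colWeight_pos [NeZero n] (hcol : ∀ j, ∃ i, A i j ≠ 0) (k : Scheme) {x : Fin n → ℝ}
    (hx : k = .frobenius ∨ x ≠ 0) : 0 < ∑ j, colWeight A k x j := by
  have : ∃ j, coordWeight k x j ≠ 0 := by
    cases k
    · exact ⟨0, by simp [coordWeight]⟩
    all_goals
      obtain ⟨j, hj⟩ := Function.ne_iff.1 (hx.resolve_left (by simp))
      exact ⟨j, by simpa [coordWeight] using hj⟩
  obtain ⟨j, hj⟩ := this
  refine Finset.sum_pos' (fun _ _ => colWeight_nonneg A k _ _) ⟨j, Finset.mem_univ _, ?_⟩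
  rw [colWeight_eq]
  exact mul_pos ((coordWeight_nonneg k x j).lt_of_ne' hj) (sum_condWeight_pos A k (hcol j))

theorem qProb_nonneg (k : Scheme) (z : Point n m) (s : Fin m × Fin n) : 0 ≤ qProb A k z s := by
  rw [qProb_eq]
  exact div_nonneg (mul_nonneg (coordWeight_nonneg _ _ _) (condWeight_nonneg _ _ _ _))
    (Finset.sum_nonneg fun j _ => colWeight_nonneg A k _ j)

theorem sum_qProb [NeZero n] (hcol : ∀ j, ∃ i, A i j ≠ 0) (k : Scheme) (z : Point n m)
    (hx : k = .frobenius ∨ z.1 ≠ 0) : ∑ s, qProb A k z s = 1 := by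
  simp only [qProb_eq, ← Finset.sum_div]
  rw [Fintype.sum_prod_type_right]
  simp only [← Finset.mul_sum, ← colWeight_eq]
  exact div_self (sum_colWeight_pos hcol k hx).ne'

/-- This absolute continuity is what makes importance sampling unbiased. -/
theorem qProb_ne_zero [NeZero n] (hcol : ∀ j, ∃ i, A i j ≠ 0) (k : Scheme) (z : Point n m)
    (s : Fin m × Fin n) (h : A s.1 s.2 * z.1 s.2 ≠ 0) : qProb A k z s ≠ 0 := by
  have hx : z.1 s.2 ≠ 0 := right_ne_zero_of_mul h
  rw [qProb_eq]
  refine div_ne_zero (mul_ne_zero ?_ (condWeight_ne_zero A k (left_ne_zero_of_mul h)))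
    (sum_colWeight_pos hcol k (Or.inr fun h0 => hx (by simp [h0]))).ne'
  cases k <;> simp [coordWeight, hx]

theorem pProb_nonneg {z : Point n m} (hz : ∀ i, 0 ≤ z.2 i) (s : Fin m × Fin n) :
    0 ≤ pProb A z s :=
  mul_nonneg (div_nonneg (abs_nonneg _) (rowL1_nonneg A _)) (hz _)

theorem sum_pProb (hrow : ∀ i, ∃ j, A i j ≠ 0) {z : Point n m} (hz : ∑ i, z.2 i = 1) :
    ∑ s, pProb A z s = 1 := by
  rw [Fintype.sum_prod_type]
  simp only [pProb, ← Finset.sum_mul, ← Finset.sum_div]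
  rw [← hz]
  refine Finset.sum_congr rfl fun i _ => ?_
  rw [show ∑ j, |A i j| = rowL1 A i from rfl, div_self (rowL1_pos A (hrow i)).ne', one_mul]

theorem pProb_ne_zero (hrow : ∀ i, ∃ j, A i j ≠ 0) {z : Point n m} (s : Fin m × Fin n)
    (h : A s.1 s.2 * z.2 s.1 ≠ 0) : pProb A z s ≠ 0 :=
  mul_ne_zero (div_ne_zero (abs_ne_zero.2 (left_ne_zero_of_mul h)) (rowL1_pos A (hrow _)).ne')
    (right_ne_zero_of_mul h)

/-- The real weights of `p(z)`. -/
def pLaw [NeZero m] [NeZero n] (A : Matrix (Fin m) (Fin n) ℝ) (z : Point n m) (s : Fin m × Fin n) :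
    ℝ := (propTo (pProb A z) s).toReal

/-- The real weights of `q(z)`. -/
def qLaw [NeZero m] [NeZero n] (A : Matrix (Fin m) (Fin n) ℝ) (k : Scheme) (z : Point n m)
    (s : Fin m × Fin n) : ℝ := (propTo (qProb A k z) s).toReal

theorem propTo_toReal {α : Type} [Fintype α] [Nonempty α] {w : α → ℝ} (h0 : ∀ a, 0 ≤ w a)
    (hs : ∑ a, w a = 1) (a : α) : (propTo w a).toReal = w a := by
  rw [propTo_apply h0 (by rw [hs]; exact one_pos), hs, div_one, ENNReal.toReal_ofReal (h0 a)]

variable [NeZero m] [NeZero n] {z : Point n m}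

theorem pLaw_eq (hrow : ∀ i, ∃ j, A i j ≠ 0) (hz : z ∈ domain n m) (s : Fin m × Fin n) :
    pLaw A z s = pProb A z s :=
  propTo_toReal (pProb_nonneg (mem_domain.1 hz).2.1) (sum_pProb hrow (mem_domain.1 hz).2.2) s

theorem qLaw_eq (hcol : ∀ j, ∃ i, A i j ≠ 0) (k : Scheme) (hx : k = .frobenius ∨ z.1 ≠ 0)
    (s : Fin m × Fin n) : qLaw A k z s = qProb A k z s :=
  propTo_toReal (qProb_nonneg k z) (sum_qProb hcol k z hx) s

theorem sum_pLaw_estimator (hrow : ∀ i, ∃ j, A i j ≠ 0) (hz : z ∈ domain n m) (k : Scheme)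
    (s' : Fin m × Fin n) (j : Fin n) :
    ∑ s, pLaw A z s * (estimator A k z s s').1 j = gradX A z.2 j := by
  rw [Fintype.sum_prod_type, gradX]
  refine Finset.sum_congr rfl fun i _ => ?_
  rw [Finset.sum_eq_single j]
  · simp only [pLaw_eq hrow hz, estimator, Pi.single_eq_same]
    by_cases h : A i j * z.2 i = 0
    · simp [h]
    · have := pProb_ne_zero hrow (z := z) (i, j) h
      field_simp
  · intro l _ hl
    simp [estimator, Pi.single_eq_of_ne hl.symm]
  · simp

theorem sum_single_sq {k : ℕ} (a : Fin k) (v : ℝ) (W : Fin k → ℝ) :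
    ∑ i, W i * (Pi.single (M := fun _ => ℝ) a v i) ^ 2 = W a * v ^ 2 := by
  rw [Finset.sum_eq_single a]
  · simp
  · intro i _ hi
    simp [Pi.single_eq_of_ne hi]
  · simp

/-- The second moment is ∑ (A_ij y_i)² / p_ij, and p is chosen so that row i contributes exactly
‖A_{i:}‖₁² y_i. -/
theorem sum_pLaw_sq (hrow : ∀ i, ∃ j, A i j ≠ 0) (hz : z ∈ domain n m) (k : Scheme)
    (s' : Fin m × Fin n) :
    ∑ s, pLaw A z s * ∑ j, (estimator A k z s s').1 j ^ 2 ≤ ⨆ i, rowL1 A i ^ 2 := by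
  have e : ∀ s : Fin m × Fin n, pLaw A z s * ∑ j, (estimator A k z s s').1 j ^ 2 =
      |A s.1 s.2| * (rowL1 A s.1 * z.2 s.1) := by
    intro s
    have := sum_single_sq s.2 (A s.1 s.2 * z.2 s.1 / pProb A z s) (fun _ => 1)
    simp only [one_mul] at this
    rw [pLaw_eq hrow hz]
    simp only [estimator]
    rw [this]
    by_cases h : A s.1 s.2 * z.2 s.1 = 0
    · rcases mul_eq_zero.1 h with h | h <;> simp [h]
    · have hA := abs_ne_zero.2 (left_ne_zero_of_mul h)
      have hz := right_ne_zero_of_mul h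
      have hr := (rowL1_pos A (hrow s.1)).ne'
      rw [pProb, div_pow, mul_pow, ← sq_abs (A s.1 s.2)]
      field_simp
  simp only [e]
  rw [Fintype.sum_prod_type]
  simp only [← Finset.sum_mul]
  calc ∑ i, rowL1 A i * (rowL1 A i * z.2 i) ≤ ∑ i, (⨆ i, rowL1 A i ^ 2) * z.2 i := by
        refine Finset.sum_le_sum fun i _ => ?_
        rw [← mul_assoc, ← sq]
        exact mul_le_mul_of_nonneg_right (le_iSup_fin (fun i => rowL1 A i ^ 2) i)
          ((mem_domain.1 hz).2.1 i)
    _ = _ := by rw [← Finset.mul_sum, (mem_domain.1 hz).2.2, mul_one]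

omit [NeZero m] [NeZero n] in
theorem estimator_snd_eq_zero (k : Scheme) (hx : z.1 = 0) (s s' : Fin m × Fin n) :
    (estimator A k z s s').2 = 0 := by
  simp [estimator, hx]

theorem sum_qLaw_estimator (hcol : ∀ j, ∃ i, A i j ≠ 0) (k : Scheme) (s : Fin m × Fin n)
    (i : Fin m) : ∑ s', qLaw A k z s' * (estimator A k z s s').2 i = -gradY A z.1 i := by
  by_cases hx : z.1 = 0
  · simp [estimator_snd_eq_zero k hx, gradY, hx]
  rw [Fintype.sum_prod_type_right, gradY, ← Finset.sum_neg_distrib]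
  refine Finset.sum_congr rfl fun j _ => ?_
  rw [Finset.sum_eq_single i]
  · simp only [qLaw_eq hcol k (Or.inr hx), estimator, Pi.single_eq_same]
    by_cases h : A i j * z.1 j = 0
    · simp [h]
    · have := qProb_ne_zero hcol k z (i, j) h
      field_simp
  · intro l _ hl
    simp [estimator, Pi.single_eq_of_ne hl.symm]
  · simp

/-- General weights are needed because the bound is used twice: for z^y, and for the exponential
weights of the accumulated noise. -/
theorem sum_qLaw_sq (hcol : ∀ j, ∃ i, A i j ≠ 0) (hz : z ∈ domain n m) (k : Scheme)
    (s : Fin m × Fin n) {W : Fin m → ℝ} (hW : ∀ i, 0 ≤ W i) (hW1 : ∑ i, W i = 1) :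
    ∑ s', qLaw A k z s' * ∑ i, W i * (estimator A k z s s').2 i ^ 2 ≤ schemeConst A k := by
  have hx1 : ∑ j, z.1 j ^ 2 ≤ 1 := (mem_domain.1 hz).1
  have hconst : 0 ≤ schemeConst A k := by
    cases k <;> simp only [schemeConst]
    · positivity
    · exact mul_nonneg (Nat.cast_nonneg _) (Real.iSup_nonneg fun i => sq_nonneg _)
    · exact mul_nonneg (Real.iSup_nonneg fun i => rowL1_nonneg A i)
        (Real.iSup_nonneg fun i => colL1_nonneg A i)
  by_cases hx : z.1 = 0
  · simpa [estimator_snd_eq_zero k hx] using hconst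
  have e : ∀ s' : Fin m × Fin n, qLaw A k z s' * ∑ i, W i * (estimator A k z s s').2 i ^ 2 =
      W s'.1 * ((A s'.1 s'.2 * z.1 s'.2) ^ 2 / qProb A k z s') := by
    intro s'
    rw [qLaw_eq hcol k (Or.inr hx)]
    simp only [estimator]
    rw [sum_single_sq]
    by_cases h : A s'.1 s'.2 * z.1 s'.2 = 0
    · simp [h]
    · have := qProb_ne_zero hcol k z s' h
      field_simp
  simp only [e]
  rw [Fintype.sum_prod_type]
  simp only [← Finset.mul_sum]
  have hpos := sum_colWeight_pos hcol k (Or.inr hx)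
  -- The weights average over rows, so a bound for each single row is enough.
  suffices h : ∀ i, ∑ j, (A i j * z.1 j) ^ 2 / qProb A k z (i, j) ≤ schemeConst A k by
    calc _ ≤ ∑ i, W i * schemeConst A k :=
          Finset.sum_le_sum fun i _ => mul_le_mul_of_nonneg_left (h i) (hW i)
      _ = _ := by rw [← Finset.sum_mul, hW1, one_mul]
  intro i
  cases k
  · calc _ ≤ ∑ j, frob A ^ 2 * z.1 j ^ 2 := by
          refine Finset.sum_le_sum fun j _ => ?_
          simp only [qProb]
          by_cases h : A i j = 0
          · simp [h]; positivity
          · field_simp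
            exact le_refl _
      _ ≤ _ := by
          rw [← Finset.mul_sum]
          exact mul_le_of_le_one_right (sq_nonneg _) hx1
  · have hD : ∑ l, (colNnz A l : ℝ) * z.1 l ^ 2 ≤ rcs A := by
      calc _ ≤ ∑ l, (rcs A : ℝ) * z.1 l ^ 2 := Finset.sum_le_sum fun l _ =>
            mul_le_mul_of_nonneg_right (colNnz_le_rcs A l) (sq_nonneg _)
        _ ≤ _ := by
          rw [← Finset.mul_sum]
          exact mul_le_of_le_one_right (Nat.cast_nonneg _) hx1
    have hD0 : 0 < ∑ l, (colNnz A l : ℝ) * z.1 l ^ 2 := hpos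
    -- The factor x_j² cancels against q and leaves A_ij². Where x_j = 0 the left term is 0 by the
    -- convention 0 / 0 = 0, hence only an inequality.
    calc _ ≤ ∑ j, (∑ l, (colNnz A l : ℝ) * z.1 l ^ 2) * A i j ^ 2 := by
          refine Finset.sum_le_sum fun j _ => ?_
          simp only [qProb]
          by_cases h : A i j = 0
          · simp [h]
          · by_cases h' : z.1 j = 0
            · simp only [h']
              simp
              positivity
            · rw [if_neg h]
              field_simp
              exact le_refl _
      _ = (∑ l, (colNnz A l : ℝ) * z.1 l ^ 2) * rowL2 A i ^ 2 := by
          rw [← Finset.mul_sum, rowL2_sq]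
      _ ≤ _ := mul_le_mul hD (le_iSup_fin (fun i => rowL2 A i ^ 2) i) (sq_nonneg _)
          (Nat.cast_nonneg _)
  · have hD : ∑ l, colL1 A l * z.1 l ^ 2 ≤ ⨆ j, colL1 A j := by
      calc _ ≤ ∑ l, (⨆ j, colL1 A j) * z.1 l ^ 2 := Finset.sum_le_sum fun l _ =>
            mul_le_mul_of_nonneg_right (le_iSup_fin (colL1 A) l) (sq_nonneg _)
        _ ≤ _ := by
          rw [← Finset.mul_sum]
          exact mul_le_of_le_one_right (Real.iSup_nonneg fun i => colL1_nonneg A i) hx1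
    have hD0 : 0 < ∑ l, colL1 A l * z.1 l ^ 2 := hpos
    calc _ ≤ ∑ j, (∑ l, colL1 A l * z.1 l ^ 2) * |A i j| := by
          refine Finset.sum_le_sum fun j _ => ?_
          simp only [qProb]
          by_cases h : A i j = 0
          · simp [h]
          · by_cases h' : z.1 j = 0
            · simp only [h']
              simp
              positivity
            · have := abs_ne_zero.2 h
              rw [mul_pow, ← sq_abs (A i j)]
              field_simp
              exact le_refl _
      _ = (∑ l, colL1 A l * z.1 l ^ 2) * rowL1 A i := by
          rw [← Finset.mul_sum, rowL1]
      _ ≤ (⨆ j, colL1 A j) * ⨆ i, rowL1 A i := mul_le_mul hD (le_iSup_fin (rowL1 A) i)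
          (rowL1_nonneg A i) (Real.iSup_nonneg fun i => colL1_nonneg A i)
      _ = _ := mul_comm _ _

theorem sum_pLaw : ∑ s, pLaw A z s = 1 := sum_toReal_eq_one _

theorem sum_qLaw (k : Scheme) : ∑ s, qLaw A k z s = 1 := sum_toReal_eq_one _

theorem pLaw_nonneg (s : Fin m × Fin n) : 0 ≤ pLaw A z s := ENNReal.toReal_nonneg

theorem qLaw_nonneg (k : Scheme) (s : Fin m × Fin n) : 0 ≤ qLaw A k z s := ENNReal.toReal_nonneg

end Matrix

/-! ### Clipping and exponential weights -/

/-- Truncation to `[-1, 1]`. -/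
def trunc (x : ℝ) : ℝ := Real.sign x * min 1 |x|

theorem trunc_cases (x : ℝ) :
    (1 < x ∧ trunc x = 1) ∨ (x < -1 ∧ trunc x = -1) ∨ (-1 ≤ x ∧ x ≤ 1 ∧ trunc x = x) := by
  unfold trunc
  rcases lt_trichotomy x 0 with h | h | h
  · rw [Real.sign_of_neg h, abs_of_neg h]
    by_cases h1 : x < -1
    · rw [min_eq_left (by linarith)]
      exact Or.inr (Or.inl ⟨h1, by ring⟩)
    · rw [min_eq_right (by linarith)]
      exact Or.inr (Or.inr ⟨by linarith, by linarith, by ring⟩)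
  · subst h
    simp
  · rw [Real.sign_of_pos h, abs_of_pos h]
    by_cases h1 : 1 < x
    · rw [min_eq_left (by linarith)]
      exact Or.inl ⟨h1, by ring⟩
    · rw [min_eq_right (by linarith)]
      exact Or.inr (Or.inr ⟨by linarith, by linarith, by ring⟩)

theorem neg_one_le_trunc (x : ℝ) : -1 ≤ trunc x := by
  rcases trunc_cases x with ⟨h, e⟩ | ⟨h, e⟩ | ⟨h, h', e⟩ <;> rw [e] <;> linarith

theorem trunc_le_one (x : ℝ) : trunc x ≤ 1 := by
  rcases trunc_cases x with ⟨h, e⟩ | ⟨h, e⟩ | ⟨h, h', e⟩ <;> rw [e] <;> linarith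

theorem trunc_sq_le (x : ℝ) : trunc x ^ 2 ≤ x ^ 2 := by
  rcases trunc_cases x with ⟨h, e⟩ | ⟨h, e⟩ | ⟨h, h', e⟩ <;> rw [e] <;> nlinarith

/-- Outside [-1, 1] this amounts to (|x| - 2)² ≥ 0. It makes the clipping bias a second-order
quantity. -/
theorem abs_sub_trunc_le (x : ℝ) : |x - trunc x| ≤ x ^ 2 / 4 := by
  rcases trunc_cases x with ⟨h, e⟩ | ⟨h, e⟩ | ⟨h, h', e⟩ <;> rw [e, abs_le] <;> constructor <;>
    nlinarith [sq_nonneg (x - 2), sq_nonneg (x + 2)]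

/-- Truncation is the nearest-point projection onto [-1, 1], so it never increases the distance to a
point of that interval. -/
theorem sub_trunc_sq_le {a : ℝ} (h1 : -1 ≤ a) (h2 : a ≤ 1) (x : ℝ) :
    (a - trunc x) ^ 2 ≤ (a - x) ^ 2 := by
  rcases trunc_cases x with ⟨h, e⟩ | ⟨h, e⟩ | ⟨h, h', e⟩ <;> rw [e] <;> nlinarith

/-- The range up to 5/4 leaves room for a clipped term of size 1 plus a true gradient entry of size
2/9. Beyond 1 the exponential is split as e · exp(t - 1). -/
theorem exp_le_quadratic {t : ℝ} (ht : t ≤ 5 / 4) : Real.exp t ≤ 1 + t + t ^ 2 := by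
  by_cases h1 : t < -1
  · have : Real.exp t ≤ 1 := Real.exp_le_one_iff.2 (by linarith)
    nlinarith
  · by_cases h2 : t ≤ 1
    · have := (abs_le.1 (Real.abs_exp_sub_one_sub_id_le (abs_le.2 ⟨not_lt.1 h1, h2⟩))).2
      linarith
    · have h3 := (abs_le.1 (Real.abs_exp_sub_one_sub_id_le (x := t - 1)
        (abs_le.2 ⟨by linarith, by linarith⟩))).2
      have h4 : Real.exp t = Real.exp 1 * Real.exp (t - 1) := by
        rw [← Real.exp_add]; ring_nf
      have h5 := Real.exp_one_lt_d9
      have h6 := Real.exp_pos (t - 1)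
      rw [h4]
      nlinarith

/-- Second-order bound for a log-moment generating function. It serves both the normalization of the
multiplicative update and the growth of the noise term of the potential. -/
theorem log_sum_mul_exp_le {k : ℕ} {w x : Fin k → ℝ} (hw : ∀ i, 0 ≤ w i) (hw1 : ∑ i, w i = 1)
    (hx : ∀ i, -(5 / 4) ≤ x i) :
    Real.log (∑ i, w i * Real.exp (-x i)) ≤ ∑ i, (-(w i * x i) + w i * x i ^ 2) := by
  have hpos : 0 < ∑ i, w i * Real.exp (-x i) := by
    obtain ⟨i, hi, h⟩ : ∃ i ∈ Finset.univ, w i ≠ 0 := by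
      by_contra! h
      rw [Finset.sum_eq_zero h] at hw1
      exact zero_ne_one hw1
    exact Finset.sum_pos' (fun i _ => mul_nonneg (hw i) (Real.exp_pos _).le)
      ⟨i, hi, mul_pos ((hw i).lt_of_ne' h) (Real.exp_pos _)⟩
  refine (Real.log_le_sub_one_of_pos hpos).trans ?_
  rw [← hw1, ← Finset.sum_sub_distrib]
  refine Finset.sum_le_sum fun i _ => ?_
  have := mul_le_mul_of_nonneg_left (exp_le_quadratic (t := -x i) (by linarith [hx i])) (hw i)
  nlinarith

/-! ### The potential argument -/

/-- The noise g - h is centred, so the cross term with Ξ vanishes and the square grows by the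
variance, at most the second moment of h. This half adds up with the ½h² paid by the mirror step. -/
theorem expect_euclid_coord {α : Type} [Fintype α] {P : α → ℝ} (hP : ∑ s, P s = 1) (h : α → ℝ)
    (g z Ξ : ℝ) (hg : ∑ s, P s * h s = g) :
    ∑ s, P s * (-(h s * z) + 1 / 2 * h s ^ 2 + 1 / 2 * (Ξ + (g - h s)) ^ 2) ≤
      -(g * z) + ∑ s, P s * h s ^ 2 + 1 / 2 * Ξ ^ 2 := by
  have e : ∀ s, P s * (-(h s * z) + 1 / 2 * h s ^ 2 + 1 / 2 * (Ξ + (g - h s)) ^ 2) =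
      P s * h s ^ 2 + 1 / 2 * (Ξ + g) ^ 2 * P s - (z + Ξ + g) * (P s * h s) := fun s => by ring
  simp only [e, Finset.sum_sub_distrib, Finset.sum_add_distrib, ← Finset.mul_sum, hP, hg]
  nlinarith [sq_nonneg g]

/-- Without truncation the linear terms would average to -gz. The bias costs a quarter of the second
moment for each of z and σ (`abs_sub_trunc_le`), and the quadratic terms cost one second moment
each; hence 5/4. -/
theorem expect_entropy_coord {α : Type} [Fintype α] {P : α → ℝ} (h0 : ∀ s, 0 ≤ P s)
    (hP : ∑ s, P s = 1) (b : α → ℝ) {g z σ : ℝ} (hg : ∑ s, P s * b s = g) (h1 : -1 ≤ g)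
    (h2 : g ≤ 1) (hz : 0 ≤ z) (hσ : 0 ≤ σ) :
    ∑ s, P s * (-(trunc (b s) * z) + z * trunc (b s) ^ 2 +
        (-(σ * (g - trunc (b s))) + σ * (g - trunc (b s)) ^ 2)) ≤
      -(g * z) + 5 / 4 * (z + σ) * ∑ s, P s * b s ^ 2 := by
  have e : ∀ s, P s * (-(trunc (b s) * z) + z * trunc (b s) ^ 2 +
        (-(σ * (g - trunc (b s))) + σ * (g - trunc (b s)) ^ 2)) ≤
      (5 / 4 * (z + σ)) * (P s * b s ^ 2) - (z + σ * g * 2 - σ) * (P s * b s) +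
        (σ * g ^ 2 - σ * g) * P s := by
    intro s
    have a1 := mul_le_mul_of_nonneg_left (trunc_sq_le (b s)) hz
    have a2 := mul_le_mul_of_nonneg_left (sub_trunc_sq_le h1 h2 (b s)) hσ
    have a3 := abs_le.1 (abs_sub_trunc_le (b s))
    have a4 := mul_le_mul_of_nonneg_left a3.2 hz
    have a5 := mul_le_mul_of_nonneg_left a3.1 hσ
    calc _ ≤ P s * ((5 / 4 * (z + σ)) * b s ^ 2 - (z + σ * g * 2 - σ) * b s +
        (σ * g ^ 2 - σ * g)) := mul_le_mul_of_nonneg_left (by nlinarith) (h0 s)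
      _ = _ := by ring
  refine (Finset.sum_le_sum fun s _ => e s).trans ?_
  simp only [Finset.sum_sub_distrib, Finset.sum_add_distrib, ← Finset.mul_sum, hP, hg]
  nlinarith [mul_nonneg hσ (sq_nonneg g)]

/-- The state of the analysis: the iterate, the sum of the earlier iterates, the accumulated
regret terms, and the accumulated noise. -/
abbrev Ghost (n m : ℕ) : Type := Point n m × Point n m × ℝ × Point n m

section Analysis

variable {m n : ℕ} [NeZero m] [NeZero n] (A : Matrix (Fin m) (Fin n) ℝ) (k : Scheme) (η : ℝ)

/-- One step of the analysis process. -/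
def ghostStep (σ : Ghost n m) (s s' : Fin m × Fin n) : Ghost n m :=
  let z := σ.1
  let g := estimator A k z s s'
  (proxStep η z g, σ.2.1 + z,
    σ.2.2.1 + (∑ j, (η * g.1 j * z.1 j - 1 / 2 * (η * g.1 j) ^ 2) +
      ∑ i, (trunc (η * g.2 i) * z.2 i - z.2 i * trunc (η * g.2 i) ^ 2)),
    (fun j => σ.2.2.2.1 j + (η * gradX A z.2 j - η * g.1 j),
      fun i => σ.2.2.2.2 i + (-(η * gradY A z.1 i) - trunc (η * g.2 i))))

/-- The potential. -/
def potential (σ : Ghost n m) : ℝ :=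
  setupRange m + 1 / 2 - σ.2.2.1 + ∑ j, 1 / 2 * σ.2.2.2.1 j ^ 2 +
    Real.log (∑ i, Real.exp (-σ.2.2.2.2 i))

/-- The invariant of the analysis process. -/
def GhostInv (σ : Ghost n m) : Prop :=
  (σ.1 ∈ domain n m ∧ ∀ i, 0 < σ.1.2 i) ∧ ∀ u ∈ unitBall n, ∀ i,
    σ.2.2.1 - ∑ j, (η * gradX A σ.2.1.2 j - σ.2.2.2.1 j) * u j +
      1 / 2 * ∑ j, (u j - σ.1.1 j) ^ 2 - (-(η * gradY A σ.2.1.1 i) - σ.2.2.2.2 i)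
      - Real.log (σ.1.2 i) ≤ setupRange m

variable {A k η}

omit [NeZero n] in
-- Regret inequality against the point u and the vertex e_i: the quantity ½‖u - z‖² - log z_i is the
-- divergence from z to (u, e_i). The projection pays ½(ηg)² and the multiplicative update pays z ·
-- trunc², exactly the terms collected in the regret component.
theorem ghostInv_step {σ : Ghost n m} (hσ : GhostInv A η σ) (s s' : Fin m × Fin n) :
    GhostInv A η (ghostStep A k η σ s s') := by
  obtain ⟨⟨hz, hpos⟩, h⟩ := hσ
  refine ⟨proxStep_mem _ _ _ hpos, fun u hu i => ?_⟩
  have h0 := h u hu i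
  obtain ⟨z, S, Q, Ξ⟩ := σ
  simp only at hz hpos h0
  simp only [ghostStep]
  rw [proxStep_eq η z _ hpos]
  set g := estimator A k z s s'
  have e0 : ∀ i, (clip (η • g)).2 i = trunc (η * g.2 i) := fun i => rfl
  have eX : ∀ j, gradX A (S + z).2 j = gradX A S.2 j + gradX A z.2 j := fun j => by
    simp only [gradX, Prod.snd_add, Pi.add_apply, mul_add, Finset.sum_add_distrib]
  have eY : ∀ i, gradY A (S + z).1 i = gradY A S.1 i + gradY A z.1 i := fun j => by
    simp only [gradY, Prod.fst_add, Pi.add_apply, mul_add, Finset.sum_add_distrib]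
  have hl := log_sum_mul_exp_le (x := fun i => trunc (η * g.2 i)) (mem_domain.1 hz).2.1
    (mem_domain.1 hz).2.2 (fun i => by linarith [neg_one_le_trunc (η * g.2 i)])
  have hp := sum_sq_sub_ballProj_le (fun j => z.1 j - η * g.1 j) u hu
  have hp' : 0 ≤ ∑ j, (ballProj (fun j => z.1 j - η * g.1 j) j - (z.1 j - η * g.1 j)) ^ 2 :=
    Finset.sum_nonneg fun _ _ => sq_nonneg _
  rw [log_mwu _ hpos i]
  simp only [e0, eX, eY]
  have e1 : ∑ j, (u j - (z.1 j - η * g.1 j)) ^ 2 = ∑ j, (u j - z.1 j) ^ 2 +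
      ∑ j, (2 * (η * g.1 j * u j) - 2 * (η * g.1 j * z.1 j - 1 / 2 * (η * g.1 j) ^ 2)) := by
    rw [← Finset.sum_add_distrib]
    exact Finset.sum_congr rfl fun j _ => by ring
  have e2 : ∑ j, (η * (gradX A S.2 j + gradX A z.2 j) -
        (Ξ.1 j + (η * gradX A z.2 j - η * g.1 j))) * u j =
      ∑ j, (η * gradX A S.2 j - Ξ.1 j) * u j + ∑ j, η * g.1 j * u j := by
    rw [← Finset.sum_add_distrib]
    exact Finset.sum_congr rfl fun j _ => by ring
  have e3 : ∑ i, (-(z.2 i * trunc (η * g.2 i)) + z.2 i * trunc (η * g.2 i) ^ 2) =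
      -∑ i, (trunc (η * g.2 i) * z.2 i - z.2 i * trunc (η * g.2 i) ^ 2) := by
    rw [← Finset.sum_neg_distrib]
    exact Finset.sum_congr rfl fun j _ => by ring
  rw [e3] at hl
  rw [e2]
  rw [e1] at hp
  simp only [Finset.sum_sub_distrib (f := fun j => 2 * (η * g.1 j * u j)), ← Finset.mul_sum] at hp
  linarith

omit [NeZero n] in
-- The comparator is arbitrary, so the noise is bounded uniformly: by Young's inequality on the
-- ball, and on the simplex by a maximum bounded by log-sum-exp. Linearity in v reduces the simplex
-- to its vertices.
theorem objective_sub_le_of_ghostInv {σ : Ghost n m} (hσ : GhostInv A η σ)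
    {u : Fin n → ℝ} (hu : u ∈ unitBall n) {v : Fin m → ℝ} (hv : v ∈ stdSimplex ℝ (Fin m)) :
    η * (objective A σ.2.1.1 v - objective A u σ.2.1.2) ≤ potential σ := by
  obtain ⟨⟨hz, hpos⟩, h⟩ := hσ
  have key : ∀ i, η * gradY A σ.2.1.1 i - η * objective A u σ.2.1.2 ≤ potential σ := by
    intro i
    have h0 := h u hu i
    have hlog : Real.log (σ.1.2 i) ≤ 0 := by
      refine Real.log_nonpos (hpos i).le ?_
      rw [← (mem_domain.1 hz).2.2]
      exact Finset.single_le_sum (fun i _ => (hpos i).le) (Finset.mem_univ i)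
    have hexp : -σ.2.2.2.2 i ≤ Real.log (∑ i, Real.exp (-σ.2.2.2.2 i)) := by
      rw [Real.le_log_iff_exp_le
        (Finset.sum_pos (fun i _ => Real.exp_pos _) ⟨0, Finset.mem_univ _⟩)]
      exact Finset.single_le_sum (f := fun i => Real.exp (-σ.2.2.2.2 i))
        (fun i _ => (Real.exp_pos _).le) (Finset.mem_univ i)
    have hsq : 0 ≤ ∑ j, (u j - σ.1.1 j) ^ 2 := Finset.sum_nonneg fun _ _ => sq_nonneg _
    have hu1 : ∑ j, u j ^ 2 ≤ 1 := hu
    have hx : -∑ j, σ.2.2.2.1 j * u j ≤ 1 / 2 * ∑ j, u j ^ 2 + ∑ j, 1 / 2 * σ.2.2.2.1 j ^ 2 := by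
      rw [← Finset.sum_neg_distrib, Finset.mul_sum, ← Finset.sum_add_distrib]
      exact Finset.sum_le_sum fun j _ => by nlinarith [sq_nonneg (u j + σ.2.2.2.1 j)]
    have e : ∑ j, (η * gradX A σ.2.1.2 j - σ.2.2.2.1 j) * u j =
        η * objective A u σ.2.1.2 - ∑ j, σ.2.2.2.1 j * u j := by
      rw [objective_eq_sum_gradX, Finset.mul_sum, ← Finset.sum_sub_distrib]
      exact Finset.sum_congr rfl fun j _ => by ring
    unfold potential
    linarith
  have e : η * (objective A σ.2.1.1 v - objective A u σ.2.1.2) =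
      ∑ i, v i * (η * gradY A σ.2.1.1 i - η * objective A u σ.2.1.2) := by
    simp only [mul_sub, Finset.sum_sub_distrib, ← Finset.sum_mul, hv.2, one_mul]
    rw [objective_eq_sum_gradY, Finset.mul_sum]
    congr 1
    exact Finset.sum_congr rfl fun j _ => by ring
  rw [e]
  calc _ ≤ ∑ i, v i * potential σ :=
        Finset.sum_le_sum fun i _ => mul_le_mul_of_nonneg_left (key i) (hv.1 i)
    _ = _ := by rw [← Finset.sum_mul, hv.2, one_mul]

theorem sum_add_of_weights {α β : Type} [Fintype α] [Fintype β] {P : α → ℝ} {Q : β → ℝ}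
    (hP : ∑ s, P s = 1) (hQ : ∑ s, Q s = 1) (c : ℝ) (X : α → ℝ) (Y : β → ℝ) :
    ∑ s, P s * ∑ s', Q s' * (c + X s + Y s') = c + ∑ s, P s * X s + ∑ s', Q s' * Y s' := by
  simp only [mul_add, Finset.sum_add_distrib, ← Finset.sum_mul, hP, hQ]
  ring_nf

theorem expect_potential_step (hrow : ∀ i, ∃ j, A i j ≠ 0) (hcol : ∀ j, ∃ i, A i j ≠ 0)
    (hg : ∀ z ∈ domain n m, ∀ i, |η * gradY A z.1 i| ≤ 2 / 9) {σ : Ghost n m}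
    (hσ : GhostInv A η σ) :
    ∑ s, pLaw A σ.1 s * ∑ s', qLaw A k σ.1 s' * potential (ghostStep A k η σ s s') ≤
      potential σ + 5 / 2 * η ^ 2 * ((⨆ i, rowL1 A i ^ 2) + schemeConst A k) := by
  obtain ⟨⟨hz, hpos⟩, -⟩ := hσ
  obtain ⟨z, S, Q, Ξ⟩ := σ
  simp only at hz hpos ⊢
  set s₀ : Fin m × Fin n := (0, 0)
  set a : Fin m × Fin n → Fin n → ℝ := fun s j => η * (estimator A k z s s₀).1 j with ha
  set b : Fin m × Fin n → Fin m → ℝ := fun s i => η * (estimator A k z s₀ s).2 i with hb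
  have hg' := fun i => abs_le.1 (hg z hz i)
  set W := ∑ i, Real.exp (-Ξ.2 i) with hW
  have hWpos : 0 < W := Finset.sum_pos (fun i _ => Real.exp_pos _) ⟨0, Finset.mem_univ _⟩
  -- The exponential weights of the accumulated noise: the increment of the log-sum-exp is a
  -- log-moment under them.
  set w : Fin m → ℝ := fun i => Real.exp (-Ξ.2 i) / W with hw
  have hw0 : ∀ i, 0 ≤ w i := fun i => div_nonneg (Real.exp_pos _).le hWpos.le
  have hw1 : ∑ i, w i = 1 := by
    rw [hw, ← Finset.sum_div]
    exact div_self hWpos.ne'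
  set X : Fin m × Fin n → ℝ := fun s => ∑ j, (-(a s j * z.1 j) + 1 / 2 * a s j ^ 2 +
    1 / 2 * (Ξ.1 j + (η * gradX A z.2 j - a s j)) ^ 2) with hX
  set Y : Fin m × Fin n → ℝ := fun s => ∑ i, (-(trunc (b s i) * z.2 i) + z.2 i * trunc (b s i) ^ 2 +
    (-(w i * (-(η * gradY A z.1 i) - trunc (b s i))) +
      w i * (-(η * gradY A z.1 i) - trunc (b s i)) ^ 2)) with hY
  -- The new potential is bounded by a constant, a function of the first sample and a function of
  -- the second one, so the two expectations separate.
  have step : ∀ s s', potential (ghostStep A k η (z, S, Q, Ξ) s s') ≤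
      (setupRange m + 1 / 2 - Q + Real.log W) + X s + Y s' := by
    intro s s'
    have ea : ∀ j, η * (estimator A k z s s').1 j = a s j := fun j => rfl
    have eb : ∀ i, η * (estimator A k z s s').2 i = b s' i := fun i => rfl
    simp only [potential, ghostStep, ea, eb]
    have hl := log_sum_mul_exp_le (x := fun i => -(η * gradY A z.1 i) - trunc (b s' i)) hw0 hw1
      (fun i => by linarith [trunc_le_one (b s' i), (hg' i).2])
    have e : ∑ i, Real.exp (-(Ξ.2 i + (-(η * gradY A z.1 i) - trunc (b s' i)))) =
        W * ∑ i, w i * Real.exp (-(-(η * gradY A z.1 i) - trunc (b s' i))) := by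
      rw [Finset.mul_sum]
      refine Finset.sum_congr rfl fun i _ => ?_
      rw [neg_add, Real.exp_add, hw]
      field_simp
    have hne : ∑ i, w i * Real.exp (-(-(η * gradY A z.1 i) - trunc (b s' i))) ≠ 0 :=
      (Finset.sum_pos (fun i _ => mul_pos (div_pos (Real.exp_pos _) hWpos) (Real.exp_pos _))
        ⟨0, Finset.mem_univ _⟩).ne'
    rw [e, Real.log_mul hWpos.ne' hne]
    simp only [hX, hY, Finset.sum_add_distrib, Finset.sum_sub_distrib, Finset.sum_neg_distrib]
      at hl ⊢
    linarith
  have hP := sum_pLaw (A := A) (z := z)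
  have hQ := sum_qLaw (A := A) (z := z) k
  have bound : ∑ s, pLaw A z s * ∑ s', qLaw A k z s' *
      potential (ghostStep A k η (z, S, Q, Ξ) s s') ≤ (setupRange m + 1 / 2 - Q + Real.log W) +
        ∑ s, pLaw A z s * X s + ∑ s', qLaw A k z s' * Y s' := by
    rw [← sum_add_of_weights hP hQ]
    exact Finset.sum_le_sum fun s _ => mul_le_mul_of_nonneg_left (Finset.sum_le_sum fun s' _ =>
      mul_le_mul_of_nonneg_left (step s s') (qLaw_nonneg k s')) (pLaw_nonneg s)
  have hEX : ∑ s, pLaw A z s * X s ≤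
      -(η * ∑ j, gradX A z.2 j * z.1 j) + η ^ 2 * (⨆ i, rowL1 A i ^ 2) +
        ∑ j, 1 / 2 * Ξ.1 j ^ 2 := by
    have h2 := mul_le_mul_of_nonneg_left (sum_pLaw_sq hrow hz k s₀) (sq_nonneg η)
    have h1 : ∀ j, _ := fun j => expect_euclid_coord hP (fun s => a s j) (η * gradX A z.2 j)
      (z.1 j) (Ξ.1 j) (by
        simp only [ha, ← sum_pLaw_estimator hrow hz k s₀ j, Finset.mul_sum]
        exact Finset.sum_congr rfl fun s _ => by ring)
    simp only [hX, Finset.mul_sum]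
    rw [Finset.sum_comm]
    refine (Finset.sum_le_sum fun j _ => h1 j).trans ?_
    have e : ∑ j, ∑ s, pLaw A z s * a s j ^ 2 =
        η ^ 2 * ∑ s, pLaw A z s * ∑ j, (estimator A k z s s₀).1 j ^ 2 := by
      rw [Finset.sum_comm, Finset.mul_sum]
      simp only [Finset.mul_sum]
      exact Finset.sum_congr rfl fun s _ => Finset.sum_congr rfl fun j _ => by
        simp only [ha]; ring
    simp only [Finset.sum_add_distrib, Finset.sum_neg_distrib, e, mul_assoc]
    linarith
  have hEY : ∑ s', qLaw A k z s' * Y s' ≤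
      η * ∑ i, gradY A z.1 i * z.2 i + 5 / 2 * η ^ 2 * schemeConst A k := by
    have hz2 := sum_qLaw_sq hcol hz k s₀ (mem_domain.1 hz).2.1 (mem_domain.1 hz).2.2
    have hw2 := sum_qLaw_sq hcol hz k s₀ hw0 hw1
    have h2 := mul_le_mul_of_nonneg_left (add_le_add hz2 hw2) (sq_nonneg η)
    have h1 : ∀ i, _ := fun i => expect_entropy_coord (qLaw_nonneg k) hQ (fun s => b s i)
      (g := -(η * gradY A z.1 i)) (z := z.2 i) (σ := w i) (by
        rw [← mul_neg, ← sum_qLaw_estimator hcol k s₀ i, Finset.mul_sum]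
        exact Finset.sum_congr rfl fun s _ => by simp only [hb]; ring)
      (by linarith [(hg' i).2]) (by linarith [(hg' i).1]) (hpos i).le (hw0 i)
    simp only [hY, Finset.mul_sum]
    rw [Finset.sum_comm]
    refine (Finset.sum_le_sum fun i _ => h1 i).trans ?_
    have e : ∑ i, 5 / 4 * (z.2 i + w i) * ∑ s, qLaw A k z s * b s i ^ 2 =
        5 / 4 * (η ^ 2 * (∑ s, qLaw A k z s * ∑ i, z.2 i * (estimator A k z s₀ s).2 i ^ 2 +
          ∑ s, qLaw A k z s * ∑ i, w i * (estimator A k z s₀ s).2 i ^ 2)) := by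
      rw [← Finset.sum_add_distrib]
      simp only [Finset.mul_sum, ← Finset.sum_add_distrib]
      rw [Finset.sum_comm]
      exact Finset.sum_congr rfl fun s _ => Finset.sum_congr rfl fun j _ => by
        simp only [hb]; ring
    rw [Finset.sum_add_distrib, e]
    simp only [neg_mul, neg_neg, mul_assoc]
    linarith
  -- The gradient field at z is orthogonal to z, so the first-order terms of the two blocks cancel.
  have hsym : ∑ j, gradX A z.2 j * z.1 j = ∑ i, gradY A z.1 i * z.2 i := by
    simp only [mul_comm (gradX _ _ _), mul_comm (gradY _ _ _)]
    rw [← objective_eq_sum_gradX, objective_eq_sum_gradY]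
  rw [hsym] at hEX
  have hM : 0 ≤ η ^ 2 * ⨆ i, rowL1 A i ^ 2 :=
    mul_nonneg (sq_nonneg η) (Real.iSup_nonneg fun i => sq_nonneg _)
  have hpot : potential (z, S, Q, Ξ) = setupRange m + 1 / 2 - Q + ∑ j, 1 / 2 * Ξ.1 j ^ 2 +
    Real.log W := rfl
  rw [hpot]
  linarith

end Analysis

/-! ### The expected gap of mirror descent -/

section Gap

variable {m n : ℕ} (A : Matrix (Fin m) (Fin n) ℝ)

theorem gap_le [NeZero m] {z : Point n m} {B : ℝ}
    (h : ∀ u ∈ unitBall n, ∀ v ∈ stdSimplex ℝ (Fin m),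
      objective A z.1 v - objective A u z.2 ≤ B) : gap A z ≤ B := by
  have hu : (unitBall n).Nonempty := ⟨0, by simp [unitBall]⟩
  have hv : (stdSimplex ℝ (Fin m)).Nonempty := ⟨_, single_mem_stdSimplex ℝ 0⟩
  have h1 : ∀ u ∈ unitBall n,
      sSup ((fun y' => objective A z.1 y') '' stdSimplex ℝ (Fin m)) ≤ B + objective A u z.2 := by
    intro u hu
    refine csSup_le (hv.image _) ?_
    rintro _ ⟨v, hv, rfl⟩
    have := h u hu v hv
    simp only
    linarith
  have h2 : sSup ((fun y' => objective A z.1 y') '' stdSimplex ℝ (Fin m)) - B ≤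
      sInf ((fun x' => objective A x' z.2) '' unitBall n) := by
    refine le_csInf (hu.image _) ?_
    rintro _ ⟨u, hu, rfl⟩
    have := h1 u hu
    simp only
    linarith
  unfold gap
  linarith

theorem abs_gradY_le {x : Fin n → ℝ} (hx : x ∈ unitBall n) (i : Fin m) :
    |gradY A x i| ≤ rowL1 A i := by
  refine (Finset.abs_sum_le_sum_abs _ _).trans (Finset.sum_le_sum fun j _ => ?_)
  rw [abs_mul]
  refine mul_le_of_le_one_right (abs_nonneg _) ?_
  have h1 : x j ^ 2 ≤ 1 :=
    (Finset.single_le_sum (f := fun j => x j ^ 2) (fun j _ => sq_nonneg _)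
      (Finset.mem_univ j)).trans hx
  exact abs_le_one_iff_mul_self_le_one.2 (by nlinarith)

theorem schemeConst_nonneg (k : Scheme) : 0 ≤ schemeConst A k := by
  cases k <;> simp only [schemeConst]
  · positivity
  · exact mul_nonneg (Nat.cast_nonneg _) (Real.iSup_nonneg fun i => sq_nonneg _)
  · exact mul_nonneg (Real.iSup_nonneg fun i => rowL1_nonneg A i)
      (Real.iSup_nonneg fun i => colL1_nonneg A i)

theorem Lco_sq {k : Scheme} (hk : IsBest A k) :
    Lco A ^ 2 = (⨆ i, rowL1 A i ^ 2) + schemeConst A k := by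
  have h : schemeConst A k = min (schemeConst A .frobenius)
      (min (schemeConst A .support) (schemeConst A .columnAbs)) := by
    refine le_antisymm (le_min (hk _) (le_min (hk _) (hk _))) ?_
    cases k
    · exact min_le_left _ _
    · exact (min_le_right _ _).trans (min_le_left _ _)
    · exact (min_le_right _ _).trans (min_le_right _ _)
  have h0 : 0 ≤ (⨆ i, rowL1 A i ^ 2) + schemeConst A k :=
    add_nonneg (Real.iSup_nonneg fun i => sq_nonneg _) (schemeConst_nonneg A k)
  rw [h] at h0 ⊢
  exact Real.sq_sqrt h0

theorem rowL1_le_Lco {k : Scheme} (hk : IsBest A k) (i : Fin m) : rowL1 A i ≤ Lco A := by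
  refine (sq_le_sq₀ (rowL1_nonneg A i) (show 0 ≤ Lco A from Real.sqrt_nonneg _)).1 ?_
  rw [Lco_sq A hk]
  have := le_iSup_fin (fun i => rowL1 A i ^ 2) i
  have := schemeConst_nonneg A k
  linarith

theorem Lco_pos [NeZero m] (hrow : ∀ i, ∃ j, A i j ≠ 0) {k : Scheme} (hk : IsBest A k) :
    0 < Lco A :=
  (rowL1_pos A (hrow 0)).trans_le (rowL1_le_Lco A hk 0)

theorem abs_objective_le {k : Scheme} (hk : IsBest A k) {u : Fin n → ℝ} (hu : u ∈ unitBall n)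
    {v : Fin m → ℝ} (hv : v ∈ stdSimplex ℝ (Fin m)) : |objective A u v| ≤ Lco A := by
  rw [objective_eq_sum_gradY]
  calc |∑ i, v i * gradY A u i| ≤ ∑ i, |v i * gradY A u i| := Finset.abs_sum_le_sum_abs _ _
    _ ≤ ∑ i, v i * Lco A := Finset.sum_le_sum fun i _ => by
        rw [abs_mul, abs_of_nonneg (hv.1 i)]
        exact mul_le_mul_of_nonneg_left ((abs_gradY_le A hu i).trans (rowL1_le_Lco A hk i)) (hv.1 i)
    _ = Lco A := by rw [← Finset.sum_mul, hv.2, one_mul]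

theorem gap_le_of_mem_domain [NeZero m] {k : Scheme} (hk : IsBest A k) {z : Point n m}
    (hz : z ∈ domain n m) : gap A z ≤ 2 * Lco A := by
  refine gap_le A fun u hu v hv => ?_
  have h1 := (abs_le.1 (abs_objective_le A hk hz.1 hv)).2
  have h2 := (abs_le.1 (abs_objective_le A hk hu hz.2)).1
  linarith

theorem objective_smul_left (c : ℝ) (x : Fin n → ℝ) (y : Fin m → ℝ) :
    objective A (c • x) y = c * objective A x y := by
  simp only [objective_eq_sum_gradX, Finset.mul_sum, Pi.smul_apply, smul_eq_mul, mul_assoc]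

theorem objective_smul_right (c : ℝ) (x : Fin n → ℝ) (y : Fin m → ℝ) :
    objective A x (c • y) = c * objective A x y := by
  simp only [objective_eq_sum_gradY, Finset.mul_sum, Pi.smul_apply, smul_eq_mul, mul_assoc]

end Gap

theorem map_fun_const {α β : Type} (μ : PMF α) (b : β) : (μ.map fun _ => b) = PMF.pure b :=
  PMF.map_const _ _

theorem convex_unitBall (n : ℕ) : Convex ℝ (unitBall n) := by
  intro x hx y hy a b ha hb hab
  have hx' : ∑ j, x j ^ 2 ≤ 1 := hx
  have hy' : ∑ j, y j ^ 2 ≤ 1 := hy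
  have h : ∀ j, (a • x + b • y) j ^ 2 ≤ a * x j ^ 2 + b * y j ^ 2 := fun j => by
    have : b = 1 - a := by linarith
    subst this
    simp only [Pi.add_apply, Pi.smul_apply, smul_eq_mul]
    nlinarith [mul_nonneg (mul_nonneg ha hb) (sq_nonneg (x j - y j))]
  have h2 := Finset.sum_le_sum fun j (_ : j ∈ (Finset.univ : Finset (Fin n))) => h j
  simp only [Finset.sum_add_distrib, ← Finset.mul_sum] at h2
  show ∑ j, (a • x + b • y) j ^ 2 ≤ 1
  nlinarith

theorem convex_domain (n m : ℕ) : Convex ℝ (domain n m) :=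
  (convex_unitBall n).prod (convex_stdSimplex ℝ _)

/-! ### The analysis process as an extension of the algorithm, and the bound on the expected gap -/

section Chain

variable {m n : ℕ} [NeZero m] [NeZero n] (A : Matrix (Fin m) (Fin n) ℝ) (k : Scheme) (η : ℝ)

theorem iterateLaw_support (t : ℕ) : ∀ p ∈ (iterateLaw A k η t).support,
    (p.1 ∈ domain n m ∧ ∀ i, 0 < p.1.2 i) ∧ ((t : ℝ) + 1)⁻¹ • p.2 ∈ domain n m := by
  induction t with
  | zero =>
    intro p hp
    rw [iterateLaw, PMF.support_pure, Set.mem_singleton_iff] at hp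
    subst hp
    simpa using ⟨startPoint_mem, startPoint_mem.1⟩
  | succ t ih =>
    intro p hp
    simp only [iterateLaw, PMF.support_bind, PMF.support_map, Set.mem_iUnion, Set.mem_image] at hp
    obtain ⟨p, hp, g, -, rfl⟩ := hp
    obtain ⟨⟨-, hpos⟩, h2⟩ := ih p hp
    have hn := proxStep_mem η p.1 g hpos
    refine ⟨hn, ?_⟩
    have ht : (0 : ℝ) < t + 1 := by positivity
    have := convex_domain n m h2 hn.1 (a := ((t : ℝ) + 1) / (t + 1 + 1)) (b := 1 / ((t : ℝ) + 1 + 1))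
      (by positivity) (by positivity) (by field_simp)
    rw [smul_smul] at this
    push_cast
    convert this using 1
    rw [smul_add]
    congr 2
    · field_simp
    · field_simp

theorem mirrorDescent_support (T : ℕ) : ∀ z ∈ (mirrorDescent A k η T).support, z ∈ domain n m := by
  intro z hz
  simp only [mirrorDescent, PMF.support_map, Set.mem_image] at hz
  obtain ⟨p, hp, rfl⟩ := hz
  exact (iterateLaw_support A k η T p hp).2

/-- The law of one step of the analysis process. -/
def ghostKernel (σ : Ghost n m) : PMF (Ghost n m) :=
  (propTo (pProb A σ.1)).bind fun s => (propTo (qProb A k σ.1)).map fun s' =>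
    ghostStep A k η σ s s'

/-- The law of the analysis process. -/
def ghostLaw : ℕ → PMF (Ghost n m)
  | 0 => PMF.pure (startPoint n m, 0, 0, 0)
  | t + 1 => (ghostLaw t).bind (ghostKernel A k η)

theorem ghostKernel_finite (σ : Ghost n m) : (ghostKernel A k η σ).support.Finite := by
  rw [ghostKernel, PMF.support_bind]
  refine (Set.toFinite _).biUnion fun s _ => ?_
  rw [PMF.support_map]
  exact (Set.toFinite _).image _

theorem ghostLaw_finite (t : ℕ) : (ghostLaw A k η t).support.Finite := by
  induction t with
  | zero => simp [ghostLaw]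
  | succ t ih =>
    rw [ghostLaw, PMF.support_bind]
    exact ih.biUnion fun σ _ => ghostKernel_finite A k η σ

/-- The additional components never influence the iterates. The current iterate is added because the
sum kept by the analysis process lags by one. -/
theorem ghostLaw_map (t : ℕ) :
    (ghostLaw A k η t).map (fun σ => (σ.1, σ.2.1 + σ.1)) = iterateLaw A k η t := by
  induction t with
  | zero => simp [ghostLaw, iterateLaw, PMF.pure_map]
  | succ t ih =>
    rw [ghostLaw, iterateLaw, ← ih, PMF.map_bind, PMF.bind_map]
    congr 1
    funext σ
    simp only [ghostKernel, estimatorLaw, PMF.map_bind, PMF.map_comp, Function.comp_def, ghostStep]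

/-- One extra step puts z_T into the sum; the iterate produced by that step is discarded. -/
theorem ghostLaw_succ_map (T : ℕ) :
    (ghostLaw A k η (T + 1)).map (fun σ => ((T : ℝ) + 1)⁻¹ • σ.2.1) = mirrorDescent A k η T := by
  rw [mirrorDescent, ← ghostLaw_map, PMF.map_comp, ghostLaw, PMF.map_bind]
  conv_rhs => rw [PMF.map]
  congr 1
  funext σ
  simp [ghostKernel, PMF.map_bind, PMF.map_comp, Function.comp_def, ghostStep, map_fun_const]

variable {A k η}

omit [NeZero n] in
theorem ghostInv_start : GhostInv A η ((startPoint n m, 0, 0, 0) : Ghost n m) := by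
  refine ⟨startPoint_mem, fun u hu i => ?_⟩
  have hu1 : ∑ j, u j ^ 2 ≤ 1 := hu
  simp [startPoint_eq, gradX, gradY, setupRange]
  linarith

theorem ghostLaw_inv (t : ℕ) : ∀ σ ∈ (ghostLaw A k η t).support, GhostInv A η σ := by
  induction t with
  | zero =>
    intro σ hσ
    rw [ghostLaw, PMF.support_pure, Set.mem_singleton_iff] at hσ
    subst hσ
    exact ghostInv_start
  | succ t ih =>
    intro σ hσ
    simp only [ghostLaw, ghostKernel, PMF.support_bind, PMF.support_map, Set.mem_iUnion,
      Set.mem_image] at hσ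
    obtain ⟨σ, hσ, s, -, s', -, rfl⟩ := hσ
    exact ghostInv_step (ih σ hσ) s s'

theorem expect_ghostKernel (σ : Ghost n m) (f : Ghost n m → ℝ) :
    expect (ghostKernel A k η σ) f =
      ∑ s, pLaw A σ.1 s * ∑ s', qLaw A k σ.1 s' * f (ghostStep A k η σ s s') := by
  rw [ghostKernel, expect_bind (Set.toFinite _) (fun s _ => by
    rw [PMF.support_map]; exact (Set.toFinite _).image _), expect_fintype]
  refine Finset.sum_congr rfl fun s _ => ?_
  rw [expect_map (Set.toFinite _), expect_fintype]
  rfl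

/-- The potential starts at Θ + ½ + log m = 2Θ, and the one-step drift is then summed. -/
theorem expect_potential_le (hrow : ∀ i, ∃ j, A i j ≠ 0) (hcol : ∀ j, ∃ i, A i j ≠ 0)
    (hk : IsBest A k) (hg : ∀ z ∈ domain n m, ∀ i, |η * gradY A z.1 i| ≤ 2 / 9) (t : ℕ) :
    expect (ghostLaw A k η t) potential ≤
      2 * setupRange m + t * (5 / 2 * η ^ 2 * Lco A ^ 2) := by
  induction t with
  | zero =>
    have : expect (ghostLaw A k η 0) potential = 2 * setupRange m := by
      rw [ghostLaw, expect_pure]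
      simp [potential, setupRange]
      ring
    simp [this]
  | succ t ih =>
    rw [ghostLaw, expect_bind (ghostLaw_finite A k η t) fun σ _ => ghostKernel_finite A k η σ]
    have h : expect (ghostLaw A k η t) (fun σ => expect (ghostKernel A k η σ) potential) ≤
        expect (ghostLaw A k η t) fun σ => potential σ + 5 / 2 * η ^ 2 * Lco A ^ 2 := by
      refine expect_mono (ghostLaw_finite A k η t) fun σ hσ => ?_
      rw [expect_ghostKernel, Lco_sq A hk]
      exact expect_potential_step hrow hcol hg (ghostLaw_inv t σ hσ)
    refine h.trans ?_
    rw [expect_add_const (ghostLaw_finite A k η t)]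
    push_cast
    linarith

theorem expectedGapLE_mirrorDescent (hrow : ∀ i, ∃ j, A i j ≠ 0) (hcol : ∀ j, ∃ i, A i j ≠ 0)
    (hk : IsBest A k) {ε : ℝ} (hε : 0 < ε) :
    ExpectedGapLE A (mirrorDescent A k (stepSize A ε) (numIters A ε)) ε := by
  set η := stepSize A ε with hη
  set T := numIters A ε with hT
  have hL := Lco_pos A hrow hk
  have hη0 : 0 < η := div_pos hε (by positivity)
  have hfin : (mirrorDescent A k η T).support.Finite := by
    rw [← ghostLaw_succ_map, PMF.support_map]
    exact (ghostLaw_finite A k η _).image _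
  refine ⟨summable_expect hfin _, ?_⟩
  change expect (mirrorDescent A k η T) (gap A) ≤ ε
  -- The quadratic bound on the exponential needs η|g_i| ≤ 2/9, which η = ε / (9L²) guarantees when
  -- ε < 2L. For larger ε the trivial bound 2L on the gap suffices.
  by_cases hbig : 2 * Lco A ≤ ε
  · calc _ ≤ expect (mirrorDescent A k η T) (fun _ => 0 + ε) :=
          expect_mono hfin fun z hz => by
            rw [zero_add]
            exact (gap_le_of_mem_domain A hk (mirrorDescent_support A k η T z hz)).trans hbig
      _ = ε := by
          rw [expect_add_const hfin]
          simp [expect]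
  · have hηL : η * Lco A ≤ 2 / 9 := by
      rw [hη, stepSize, div_mul_eq_mul_div, div_le_div_iff₀ (by positivity) (by norm_num)]
      nlinarith
    have hg : ∀ z ∈ domain n m, ∀ i, |η * gradY A z.1 i| ≤ 2 / 9 := by
      intro z hz i
      rw [abs_mul, abs_of_pos hη0]
      exact (mul_le_mul_of_nonneg_left ((abs_gradY_le A hz.1 i).trans (rowL1_le_Lco A hk i))
        hη0.le).trans hηL
    have hT1 : (0 : ℝ) < T + 1 := by positivity
    have hpot := expect_potential_le (k := k) hrow hcol hk hg (T + 1)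
    rw [← ghostLaw_succ_map, expect_map (ghostLaw_finite A k η _)]
    have hgap : ∀ σ ∈ (ghostLaw A k η (T + 1)).support,
        (gap A ∘ fun σ : Ghost n m => ((T : ℝ) + 1)⁻¹ • σ.2.1) σ ≤
          (η * (T + 1))⁻¹ * potential σ := by
      intro σ hσ
      refine gap_le A fun u hu v hv => ?_
      have h := objective_sub_le_of_ghostInv (ghostLaw_inv _ σ hσ) hu hv
      rw [Prod.smul_fst, Prod.smul_snd, objective_smul_left, objective_smul_right, ← mul_sub,
        mul_inv, mul_comm η⁻¹, mul_assoc]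
      refine mul_le_mul_of_nonneg_left ?_ (by positivity)
      rwa [le_inv_mul_iff₀ hη0]
    refine (expect_mono (ghostLaw_finite A k η _) hgap).trans ?_
    have e : expect (ghostLaw A k η (T + 1)) (fun σ => (η * (T + 1))⁻¹ * potential σ) =
        (η * (T + 1))⁻¹ * expect (ghostLaw A k η (T + 1)) potential := by
      rw [expect, expect, ← tsum_mul_left]
      exact tsum_congr fun σ => by ring
    rw [e, inv_mul_le_iff₀ (by positivity)]
    refine hpot.trans ?_
    -- By the choice of T the initial value 2Θ is at most a third of Tηε, and the total drift is
    -- 5/18 of (T + 1)ηε; the two fractions sum to less than 1.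
    have h6 : 6 * setupRange m ≤ T * (η * ε) := by
      have := Nat.le_ceil (6 * setupRange m / (η * ε))
      rwa [div_le_iff₀ (by positivity)] at this
    have hL2 : 9 * (η * Lco A ^ 2) = ε := by
      rw [hη, stepSize]
      field_simp
    push_cast
    have : ((T : ℝ) + 1) * (5 / 2 * η ^ 2 * Lco A ^ 2) = (T + 1) * η * (5 / 18) * ε := by
      rw [← hL2]; ring
    rw [this]
    have := mul_pos hη0 hε
    nlinarith [mul_pos hT1 this]

end Chain

/-! ### A program logic for the randomized RAM -/

section Logic

variable {m n : ℕ} [NeZero m] [NeZero n] (A : Matrix (Fin m) (Fin n) ℝ)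

/-- `Config.run` appends steps at the end, whereas symbolic execution peels off the first one. -/
theorem Config.run_succ' (c : Config) (N : ℕ) :
    c.run A (N + 1) = (c.step A).bind fun c' => c'.run A N := by
  induction N with
  | zero => simp [Config.run]
  | succ N ih =>
    rw [Config.run, ih, PMF.bind_bind]
    rfl

/-- From `c`, execution halts within `N` steps at time at most `T`, with an output of law `ρ`. -/
def Halts (c : Config) (N T : ℕ) (ρ : PMF (Point n m)) : Prop :=
  (∀ c' ∈ (c.run A N).support, c'.todo = [] ∧ c'.time ≤ T) ∧
    (c.run A N).map (Config.output n m) = ρ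

variable {A}

theorem Halts.nil (s : Memory) {t T : ℕ} (h : t ≤ T) :
    Halts A ⟨[], s, t⟩ 0 T (PMF.pure (Config.output n m ⟨[], s, t⟩)) := by
  refine ⟨fun c' hc' => ?_, ?_⟩
  · rw [Config.run, PMF.support_pure, Set.mem_singleton_iff] at hc'
    subst hc'
    exact ⟨rfl, h⟩
  · rw [Config.run, PMF.pure_map]

/-- Halted configurations are fixed by `Config.step`, so branches of different lengths can share one
step budget. -/
theorem Halts.succ {c : Config} {N T : ℕ} {ρ : PMF (Point n m)} (h : Halts A c N T ρ) :
    Halts A c (N + 1) T ρ := by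
  have : c.run A (N + 1) = c.run A N := by
    rw [Config.run]
    conv_rhs => rw [← PMF.bind_pure (c.run A N)]
    refine bind_congr_support _ fun c' hc' => ?_
    obtain ⟨l, s, t⟩ := c'
    obtain rfl : l = [] := (h.1 _ hc').1
    rfl
  rwa [Halts, this]

theorem Halts.mono {c : Config} {N N' T T' : ℕ} {ρ : PMF (Point n m)} (h : Halts A c N T ρ)
    (hN : N ≤ N') (hT : T ≤ T') : Halts A c N' T' ρ := by
  induction hN with
  | refl => exact ⟨fun c' hc' => ⟨(h.1 c' hc').1, (h.1 c' hc').2.trans hT⟩, h.2⟩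
  | step _ ih => exact ih.succ

theorem Halts.of_step {α : Type} {c : Config} {N T : ℕ} {κ : PMF α} {g : α → Config}
    {ν : α → PMF (Point n m)} (hc : c.step A = κ.map g)
    (h : ∀ a ∈ κ.support, Halts A (g a) N T (ν a)) : Halts A c (N + 1) T (κ.bind ν) := by
  rw [Halts, Config.run_succ', hc, PMF.bind_map]
  refine ⟨fun c' hc' => ?_, ?_⟩
  · simp only [PMF.support_bind, Set.mem_iUnion, Function.comp_apply] at hc'
    obtain ⟨a, ha, hc'⟩ := hc'
    exact (h a ha).1 c' hc'
  · rw [PMF.map_bind]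
    exact bind_congr_support _ fun a ha => (h a ha).2

theorem Halts.of_step_pure {c c' : Config} {N T : ℕ} {ρ : PMF (Point n m)}
    (hc : c.step A = PMF.pure c') (h : Halts A c' N T ρ) : Halts A c (N + 1) T ρ := by
  have := Halts.of_step (κ := PMF.pure ()) (g := fun _ => c') (ν := fun _ => ρ)
    (by rw [hc, PMF.pure_map]) (fun _ _ => h)
  rwa [PMF.pure_bind] at this

variable (A)

/-- The program `P`, started in the memory `s`, takes time at most `τ`; it draws a value of
law `κ` and ends in a memory that `R` relates to that value. -/
def Triple {α : Type} (P : Prog) (s : Memory) (τ : ℕ) (κ : PMF α) (R : α → Memory → Prop) : Prop :=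
  ∀ (K : List Prog) (t N T : ℕ) (ν : α → PMF (Point n m)),
    (∀ a ∈ κ.support, ∀ s', R a s' → ∀ t' ≤ t + τ, Halts A ⟨K, s', t'⟩ N T (ν a)) →
      Halts A ⟨P :: K, s, t⟩ (τ + N) T (κ.bind ν)

/-- `Triple` for a program without random choices. -/
def DTriple (P : Prog) (s : Memory) (τ : ℕ) (R : Memory → Prop) : Prop :=
  Triple A P s τ (PMF.pure ()) fun _ => R

variable {A}

theorem Triple.mono {α : Type} {P : Prog} {s : Memory} {τ τ' : ℕ} {κ : PMF α}
    {R R' : α → Memory → Prop} (h : Triple A P s τ κ R) (hτ : τ ≤ τ')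
    (hR : ∀ a ∈ κ.support, ∀ s', R a s' → R' a s') : Triple A P s τ' κ R' :=
  fun K t N T ν hν => (h K t N T ν fun a ha s' hs t' ht =>
    hν a ha s' (hR a ha s' hs) t' (by omega)).mono (by omega) le_rfl

theorem DTriple.mono {P : Prog} {s : Memory} {τ τ' : ℕ} {R R' : Memory → Prop}
    (h : DTriple A P s τ R) (hτ : τ ≤ τ') (hR : ∀ s', R s' → R' s') : DTriple A P s τ' R' :=
  Triple.mono h hτ fun _ _ => hR

theorem Triple.map {α β : Type} {P : Prog} {s : Memory} {τ : ℕ} {κ : PMF α}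
    {R : α → Memory → Prop} {R' : β → Memory → Prop} (f : α → β) (h : Triple A P s τ κ R)
    (hR : ∀ a ∈ κ.support, ∀ s', R a s' → R' (f a) s') : Triple A P s τ (κ.map f) R' := by
  intro K t N T ν hν
  rw [PMF.bind_map]
  refine h K t N T _ fun a ha s' hs t' ht => hν (f a) ?_ s' (hR a ha s' hs) t' ht
  rw [PMF.support_map]
  exact Set.mem_image_of_mem f ha

/-- Oracle answers and tree leaves are natural numbers; this reads their law as a law on the index
type. -/
theorem Triple.of_map {α β : Type} [Nonempty α] {P : Prog} {s : Memory} {τ : ℕ} {κ : PMF α}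
    {R : β → Memory → Prop} {f : α → β} (hf : Function.Injective f)
    (h : Triple A P s τ (κ.map f) R) : Triple A P s τ κ fun a => R (f a) := by
  intro K t N T ν hν
  have := h K t N T (ν ∘ Function.invFun f) fun b hb s' hs t' ht => by
    rw [PMF.support_map] at hb
    obtain ⟨a, ha, rfl⟩ := hb
    rw [Function.comp_apply, Function.leftInverse_invFun hf]
    exact hν a ha s' hs t' ht
  rwa [PMF.bind_map, Function.comp_assoc, (Function.leftInverse_invFun hf).comp_eq_id] at this

/-- Since `Triple` quantifies over the continuation and its output law, composition is plain
chaining, and no law on memories is ever needed. -/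
theorem Triple.seq {α β : Type} {P₁ P₂ : Prog} {s : Memory} {τ₁ τ₂ : ℕ} {κ₁ : PMF α}
    {κ₂ : α → PMF β} {R₁ : α → Memory → Prop} {R₂ : β → Memory → Prop}
    (h₁ : Triple A P₁ s τ₁ κ₁ R₁)
    (h₂ : ∀ a ∈ κ₁.support, ∀ s', R₁ a s' → Triple A P₂ s' τ₂ (κ₂ a) R₂) :
    Triple A (.seq P₁ P₂) s (1 + τ₁ + τ₂) (κ₁.bind κ₂) R₂ := by
  intro K t N T ν hν
  rw [PMF.bind_bind]
  refine (Halts.of_step_pure (N := τ₁ + (τ₂ + N)) (c' := ⟨P₁ :: P₂ :: K, s, t + 1⟩) rfl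
    (h₁ _ _ _ _ _ fun a ha s' hs t' ht =>
      h₂ a ha s' hs _ _ _ _ _ fun b hb s'' hs' t'' ht' => ?_)).mono (by omega) le_rfl
  refine hν b ?_ s'' hs' t'' (by omega)
  rw [PMF.support_bind]
  exact Set.mem_biUnion ha hb

theorem DTriple.seq_triple {β : Type} {P₁ P₂ : Prog} {s : Memory} {τ₁ τ₂ : ℕ} {κ : PMF β}
    {R₁ : Memory → Prop} {R₂ : β → Memory → Prop} (h₁ : DTriple A P₁ s τ₁ R₁)
    (h₂ : ∀ s', R₁ s' → Triple A P₂ s' τ₂ κ R₂) :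
    Triple A (.seq P₁ P₂) s (1 + τ₁ + τ₂) κ R₂ := by
  have := Triple.seq h₁ fun _ _ => h₂
  rwa [PMF.pure_bind] at this

theorem DTriple.seq {P₁ P₂ : Prog} {s : Memory} {τ₁ τ₂ : ℕ} {R₁ R₂ : Memory → Prop}
    (h₁ : DTriple A P₁ s τ₁ R₁) (h₂ : ∀ s', R₁ s' → DTriple A P₂ s' τ₂ R₂) :
    DTriple A (.seq P₁ P₂) s (1 + τ₁ + τ₂) R₂ :=
  h₁.seq_triple h₂

theorem Triple.seq_dtriple {α : Type} {P₁ P₂ : Prog} {s : Memory} {τ₁ τ₂ : ℕ} {κ : PMF α}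
    {R₁ R₂ : α → Memory → Prop} (h₁ : Triple A P₁ s τ₁ κ R₁)
    (h₂ : ∀ a ∈ κ.support, ∀ s', R₁ a s' → DTriple A P₂ s' τ₂ (R₂ a)) :
    Triple A (.seq P₁ P₂) s (1 + τ₁ + τ₂) κ R₂ := by
  have := Triple.seq (κ₂ := PMF.pure) h₁ fun a ha s' hs => by
    have := Triple.map (R' := R₂) (fun _ : Unit => a) (h₂ a ha s' hs) fun _ _ _ h => h
    rwa [PMF.pure_map] at this
  rwa [PMF.bind_pure] at this

theorem dtriple_of_step {P : Prog} {s s' : Memory} {τ : ℕ} (hτ : 1 ≤ τ)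
    (h : ∀ K t, Config.step A ⟨P :: K, s, t⟩ = PMF.pure ⟨K, s', t + τ⟩) {R : Memory → Prop}
    (hR : R s') : DTriple A P s τ R := by
  intro K t N T ν hν
  rw [PMF.pure_bind]
  exact (Halts.of_step_pure (h K t) (hν () (by simp) s' hR _ le_rfl)).mono (by omega) le_rfl

theorem dtriple_skip {s : Memory} {R : Memory → Prop} (h : R s) : DTriple A .skip s 1 R :=
  dtriple_of_step le_rfl (fun _ _ => rfl) h

theorem dtriple_setNat {x : ℕ} {e : NExp} {s : Memory} {R : Memory → Prop}
    (h : R (s.setNat x (e.eval A s))) : DTriple A (.setNat x e) s (e.cost + 1) R :=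
  dtriple_of_step (by omega) (fun _ _ => rfl) h

theorem dtriple_setReal {x : ℕ} {e : RExp} {s : Memory} {R : Memory → Prop}
    (h : R (s.setReal x (e.eval A s))) : DTriple A (.setReal x e) s (e.cost + 1) R :=
  dtriple_of_step (by omega) (fun _ _ => rfl) h

theorem dtriple_storeReal {a : ℕ} {i : NExp} {e : RExp} {s : Memory} {R : Memory → Prop}
    (h : R (s.storeReal a (i.eval A s) (e.eval A s))) :
    DTriple A (.storeReal a i e) s (i.cost + e.cost + 1) R :=
  dtriple_of_step (by omega) (fun _ _ => by simp only [Config.step, Nat.add_assoc]) h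

theorem triple_of_step {α : Type} {P : Prog} {s : Memory} {τ : ℕ} (hτ : 1 ≤ τ) {κ : PMF α}
    {g : α → Memory}
    (h : ∀ K t, Config.step A ⟨P :: K, s, t⟩ = κ.map fun v => ⟨K, g v, t + τ⟩)
    {R : α → Memory → Prop} (hR : ∀ a ∈ κ.support, R a (g a)) : Triple A P s τ κ R := by
  intro K t N T ν hν
  exact (Halts.of_step (h K t) fun a ha => hν a ha _ (hR a ha) _ le_rfl).mono (by omega) le_rfl

theorem triple_coin {x : ℕ} {e : RExp} {s : Memory} :
    Triple A (.coin x e) s (e.cost + 1) (coinLaw (e.eval A s)) fun v s' => s' = s.setNat x v :=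
  triple_of_step (by omega) (fun _ _ => rfl) fun _ _ => rfl

theorem triple_sampleRow {x : ℕ} {p : Expo} {e : NExp} {s : Memory} (i : Fin m)
    (h : e.eval A s = i) : Triple A (.sampleRow x p e) s (e.cost + 1)
      (propTo fun j => absPow p (A i j)) fun v s' => s' = s.setNat x v := by
  refine Triple.of_map (f := Fin.val) (R := fun v s' => s' = s.setNat x v)
    Fin.val_injective (triple_of_step (by omega) (fun K t => ?_) fun _ _ => rfl)
  simp [Config.step, rowSample, h, Nat.add_assoc]

theorem triple_sampleCol {x : ℕ} {p : Expo} {e : NExp} {s : Memory} (j : Fin n)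
    (h : e.eval A s = j) : Triple A (.sampleCol x p e) s (e.cost + 1)
      (propTo fun i => absPow p (A i j)) fun v s' => s' = s.setNat x v := by
  refine Triple.of_map (f := Fin.val) (R := fun v s' => s' = s.setNat x v)
    Fin.val_injective (triple_of_step (by omega) (fun K t => ?_) fun _ _ => rfl)
  simp [Config.step, colSample, h, Nat.add_assoc]

theorem triple_sampleColSupport {x : ℕ} {e : NExp} {s : Memory} (j : Fin n)
    (h : e.eval A s = j) : Triple A (.sampleColSupport x e) s (e.cost + 1)
      (propTo fun i => if A i j = 0 then 0 else 1) fun v s' => s' = s.setNat x v := by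
  refine Triple.of_map (f := Fin.val) (R := fun v s' => s' = s.setNat x v)
    Fin.val_injective (triple_of_step (by omega) (fun K t => ?_) fun _ _ => rfl)
  simp [Config.step, colSupportSample, h, Nat.add_assoc]

theorem Triple.ite {α : Type} {b : Test} {P₁ P₂ : Prog} {s : Memory} {τ : ℕ} {κ : PMF α}
    {R : α → Memory → Prop} (h₁ : b.holds A s → Triple A P₁ s τ κ R)
    (h₂ : ¬ b.holds A s → Triple A P₂ s τ κ R) :
    Triple A (.ite b P₁ P₂) s (b.cost + 1 + τ) κ R := by
  intro K t N T ν hν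
  have hν' : ∀ a ∈ κ.support, ∀ s', R a s' → ∀ t' ≤ t + b.cost + 1 + τ,
      Halts A ⟨K, s', t'⟩ N T (ν a) := fun a ha s' hs t' ht => hν a ha s' hs t' (by omega)
  by_cases h : b.holds A s
  · exact (Halts.of_step_pure (c' := ⟨P₁ :: K, s, t + b.cost + 1⟩) (by simp [Config.step, h])
      (h₁ h _ _ _ _ _ hν')).mono (by omega) le_rfl
  · exact (Halts.of_step_pure (c' := ⟨P₂ :: K, s, t + b.cost + 1⟩) (by simp [Config.step, h])
      (h₂ h _ _ _ _ _ hν')).mono (by omega) le_rfl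

theorem DTriple.ite {b : Test} {P₁ P₂ : Prog} {s : Memory} {τ : ℕ}
    {R : Memory → Prop} (h₁ : b.holds A s → DTriple A P₁ s τ R)
    (h₂ : ¬ b.holds A s → DTriple A P₂ s τ R) :
    DTriple A (.ite b P₁ P₂) s (b.cost + 1 + τ) R :=
  Triple.ite h₁ h₂

/-- A loop with at most `d` remaining rounds and abstract state `a`; `κ d a` is the law of the
final value. -/
theorem Triple.loop {α β : Type} {b : Test} {P : Prog} {τ : ℕ} {κ : ℕ → α → PMF β}
    {I : ℕ → α → Memory → Prop} {R : β → Memory → Prop}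
    (hexit : ∀ d a s, I d a s → ¬ b.holds A s → ∃ v, κ d a = PMF.pure v ∧ R v s)
    (hstep : ∀ d a s, I d a s → b.holds A s → ∃ d', d = d' + 1 ∧ ∃ ρ : PMF α,
      Triple A P s τ ρ (I d') ∧ κ d a = ρ.bind (κ d'))
    (d : ℕ) (a : α) (s : Memory) (h : I d a s) :
    Triple A (.loop b P) s (d * (b.cost + 1 + τ) + (b.cost + 1)) (κ d a) R := by
  induction d generalizing a s with
  | zero =>
    have hb : ¬ b.holds A s := fun hb => by
      obtain ⟨d', hd', -⟩ := hstep _ _ _ h hb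
      omega
    intro K t N T ν hν
    obtain ⟨v, hv, hR⟩ := hexit _ _ _ h hb
    rw [hv, PMF.pure_bind]
    exact (Halts.of_step_pure (c' := ⟨K, s, t + b.cost + 1⟩) (by simp [Config.step, hb])
      (hν v (by simp [hv]) s hR _ (by omega))).mono (by omega) le_rfl
  | succ d ih =>
    intro K t N T ν hν
    by_cases hb : b.holds A s
    · obtain ⟨d', hd', ρ, hT, hκ⟩ := hstep _ _ _ h hb
      obtain rfl : d = d' := by omega
      rw [hκ, PMF.bind_bind]
      have e : (d + 1) * (b.cost + 1 + τ) = d * (b.cost + 1 + τ) + (b.cost + 1 + τ) := by ring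
      refine (Halts.of_step_pure (c' := ⟨P :: .loop b P :: K, s, t + b.cost + 1⟩)
        (by simp [Config.step, hb]) (hT _ _ _ _ _ fun a' ha' s' hs' t' ht' =>
          ih a' s' hs' K t' N T ν fun v hv s'' hs'' t'' ht'' => ?_)).mono (by omega) le_rfl
      refine hν v ?_ s'' hs'' t'' (by omega)
      rw [hκ, PMF.support_bind]
      exact Set.mem_biUnion ha' hv
    · obtain ⟨v, hv, hR⟩ := hexit _ _ _ h hb
      rw [hv, PMF.pure_bind]
      exact (Halts.of_step_pure (c' := ⟨K, s, t + b.cost + 1⟩) (by simp [Config.step, hb])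
        (hν v (by simp [hv]) s hR _ (by omega))).mono (by omega) le_rfl

theorem DTriple.loop {b : Test} {P : Prog} {τ : ℕ} {I : ℕ → Memory → Prop} {R : Memory → Prop}
    (hexit : ∀ d s, I d s → ¬ b.holds A s → R s)
    (hstep : ∀ d s, I d s → b.holds A s → ∃ d', d = d' + 1 ∧ DTriple A P s τ (I d'))
    (d : ℕ) (s : Memory) (h : I d s) :
    DTriple A (.loop b P) s (d * (b.cost + 1 + τ) + (b.cost + 1)) R :=
  Triple.loop (κ := fun _ _ => PMF.pure ()) (I := fun d (_ : Unit) => I d) (R := fun _ => R)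
    (fun d _ s h hb => ⟨(), rfl, hexit d s h hb⟩)
    (fun d _ s h hb => by
      obtain ⟨d', hd, hT⟩ := hstep d s h hb
      exact ⟨d', hd, PMF.pure (), hT, (PMF.pure_bind _ _).symm⟩) d () s h

/-- A complete program computes its output law. -/
theorem implements_of_triple {P : Prog} {ε : ℝ} {τ : ℕ} {μ : PMF (Point n m)}
    (h : Triple A P (P.start m n ε).mem τ μ fun z s => z = Config.output n m ⟨[], s, 0⟩) :
    P.Implements A ε τ μ := by
  have := h [] 0 0 τ PMF.pure fun z _ s' hs t' ht => by
    rw [hs]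
    exact Halts.nil s' (by omega)
  rw [PMF.bind_pure] at this
  exact ⟨τ + 0, this⟩

end Logic

/-! ### Binary sum trees

The tree with `M` leaves lives in the cells `1, …, 2M - 1` of an array: the children of `j < M` are
`2j` and `2j + 1`, and the leaves are the cells `M, …, 2M - 1`. -/

/-- The nodes `j ≥ lo` outside `E` carry the sum of their children. -/
def SumTree (M lo : ℕ) (E : Set ℕ) (t : ℕ → ℝ) : Prop :=
  ∀ j, lo ≤ j → j < M → j ∉ E → t j = t (j + j) + t (j + j + 1)

/-- The nodes in [k, 2k) have the same total for every k from 1 to M: replacing k by its children 2k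
and 2k + 1 yields [k + 1, 2k + 2). Hence M need not be a power of two. -/
theorem SumTree.root_eq {M : ℕ} {t : ℕ → ℝ} (hM : 1 ≤ M) (h : SumTree M 1 ∅ t) :
    t 1 = ∑ i : Fin M, t (M + i) := by
  have key : ∀ k, k + 1 ≤ M → t 1 = ∑ j ∈ Finset.Ico (k + 1) (k + 1 + (k + 1)), t j := by
    intro k
    induction k with
    | zero => simp
    | succ k ih =>
      intro hk
      have hj := h (k + 1) (by omega) (by omega) (by simp)
      rw [ih (by omega), Finset.sum_eq_sum_Ico_succ_bot (by omega), hj,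
        show k + 1 + 1 + (k + 1 + 1) = k + 1 + (k + 1) + 1 + 1 by ring,
        Finset.sum_Ico_succ_top (by omega), Finset.sum_Ico_succ_top (by omega)]
      ring
  obtain ⟨k, rfl⟩ : ∃ k, M = k + 1 := ⟨M - 1, by omega⟩
  rw [key k le_rfl, Finset.sum_Ico_eq_sum_range, Nat.add_sub_cancel, Finset.sum_range]

theorem SumTree.nonneg {M : ℕ} {t : ℕ → ℝ} (h : SumTree M 1 ∅ t)
    (h0 : ∀ i, M ≤ i → i < 2 * M → 0 ≤ t i) (j : ℕ) (hj : 1 ≤ j) (hj2 : j < 2 * M) : 0 ≤ t j := by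
  induction hd : M - j using Nat.strong_induction_on generalizing j with
  | _ d ih =>
    by_cases hM : M ≤ j
    · exact h0 j hM hj2
    · rw [h j hj (by omega) (by simp)]
      exact add_nonneg (ih (M - (j + j)) (by omega) _ (by omega) (by omega) rfl)
        (ih (M - (j + j + 1)) (by omega) _ (by omega) (by omega) rfl)

/-- The law of the leaf reached from node `k` by descending with probabilities proportional to
the values of the children. -/
def descendLaw (M : ℕ) (t : ℕ → ℝ) (k : ℕ) : PMF ℕ :=
  if 1 ≤ k ∧ k < M then
    (coinLaw (t (k + k + 1) / t k)).bind fun c => descendLaw M t (k + k + c)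
  else PMF.pure k
termination_by M - k

theorem coinLaw_support {p : ℝ} {c : ℕ} (h : c ∈ (coinLaw p).support) : c ≤ 1 := by
  rw [coinLaw, PMF.support_map] at h
  obtain ⟨i, -, rfl⟩ := h
  omega

theorem coinLaw_bind_apply {α : Type} {p : ℝ} (h0 : 0 ≤ p) (h1 : p ≤ 1) (f : ℕ → PMF α) (a : α) :
    ((coinLaw p).bind f a).toReal = (1 - p) * (f 0 a).toReal + p * (f 1 a).toReal := by
  have hc : max 0 (min 1 p) = p := by rw [min_eq_right h1, max_eq_right h0]
  have hw : ∀ i, 0 ≤ (![1 - p, p] : Fin 2 → ℝ) i := fun i => by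
    fin_cases i <;> simp [h0, h1]
  have hs : ∑ i, (![1 - p, p] : Fin 2 → ℝ) i = 1 := by simp
  rw [coinLaw, hc, PMF.bind_map, PMF.bind_apply, tsum_fintype, Fin.sum_univ_two,
    ENNReal.toReal_add (ENNReal.mul_ne_top (PMF.apply_ne_top _ _) (PMF.apply_ne_top _ _))
      (ENNReal.mul_ne_top (PMF.apply_ne_top _ _) (PMF.apply_ne_top _ _)), ENNReal.toReal_mul,
    ENNReal.toReal_mul, propTo_toReal hw hs, propTo_toReal hw hs]
  simp

theorem descendLaw_support {M : ℕ} {t : ℕ → ℝ} {k : ℕ} (h1 : 1 ≤ k) (h2 : k < 2 * M) :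
    ∀ l ∈ (descendLaw M t k).support, M ≤ l ∧ l < 2 * M := by
  induction hd : M - k using Nat.strong_induction_on generalizing k with
  | _ d ih =>
    intro l hl
    rw [descendLaw] at hl
    split_ifs at hl with h
    · rw [PMF.support_bind] at hl
      simp only [Set.mem_iUnion] at hl
      obtain ⟨c, hc, hl⟩ := hl
      have := coinLaw_support hc
      exact ih (M - (k + k + c)) (by omega) (by omega) (by omega) rfl l hl
    · rw [PMF.support_pure, Set.mem_singleton_iff] at hl
      omega

/-- For a fixed leaf, the node value times the probability of reaching that leaf from the node is
again a sum tree, and its root is the sum of its leaves. A node of value 0 is harmless, as its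
children vanish too. -/
theorem descendLaw_apply {M : ℕ} {t : ℕ → ℝ} (hM : 1 ≤ M) (h : SumTree M 1 ∅ t)
    (h0 : ∀ i, M ≤ i → i < 2 * M → 0 ≤ t i) (l : ℕ) :
    t 1 * (descendLaw M t 1 l).toReal =
      ∑ i : Fin M, t (M + i) * (PMF.pure (M + (i : ℕ)) l).toReal := by
  have hF : SumTree M 1 ∅ fun k => t k * (descendLaw M t k l).toReal := by
    intro j hj hjM _
    have hn := h.nonneg h0
    have e := h j hj hjM (by simp)
    have ha := hn (j + j) (by omega) (by omega)
    have hb := hn (j + j + 1) (by omega) (by omega)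
    simp only
    rw [descendLaw, if_pos ⟨hj, hjM⟩]
    by_cases h0 : t j = 0
    · have ha0 : t (j + j) = 0 := by linarith
      have hb0 : t (j + j + 1) = 0 := by linarith
      simp [h0, ha0, hb0]
    · have hpos : 0 < t j := (hn j hj (by omega)).lt_of_ne' h0
      rw [coinLaw_bind_apply (div_nonneg hb hpos.le) (by rw [div_le_one hpos]; linarith)]
      have : 1 - t (j + j + 1) / t j = t (j + j) / t j := by
        field_simp
        linarith
      rw [this]
      field_simp
      simp
  refine (hF.root_eq hM).trans ?_
  refine Finset.sum_congr rfl fun i _ => ?_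
  rw [show descendLaw M t (M + i) = PMF.pure (M + (i : ℕ)) by rw [descendLaw, if_neg (by omega)]]

/-- The law of the leaf drawn from the root. -/
theorem exists_descendLaw_eq_map {M : ℕ} [NeZero M] {t : ℕ → ℝ} (h : SumTree M 1 ∅ t)
    (h0 : ∀ i, M ≤ i → i < 2 * M → 0 ≤ t i) :
    ∃ κ : PMF (Fin M), descendLaw M t 1 = PMF.map (fun i : Fin M => M + (i : ℕ)) κ ∧
      (0 < t 1 → κ = propTo fun i : Fin M => t (M + i)) := by
  have hM : 1 ≤ M := Nat.pos_of_ne_zero (NeZero.ne M)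
  by_cases hpos : 0 < t 1
  · refine ⟨_, ?_, fun _ => rfl⟩
    have hr := h.root_eq hM
    ext l
    rw [← ENNReal.toReal_eq_toReal_iff' (PMF.apply_ne_top _ _) (PMF.apply_ne_top _ _)]
    refine mul_left_cancel₀ hpos.ne' ?_
    rw [descendLaw_apply hM h h0 l, PMF.map, PMF.bind_apply, tsum_fintype, ENNReal.toReal_sum
      fun i _ => ENNReal.mul_ne_top (PMF.apply_ne_top _ _) (PMF.apply_ne_top _ _), Finset.mul_sum]
    refine Finset.sum_congr rfl fun i _ => ?_
    have hnn : ∀ i : Fin M, 0 ≤ t (M + i) := fun i => h0 _ (by omega) (by omega)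
    rw [ENNReal.toReal_mul, propTo_apply hnn (by rwa [← hr]), ENNReal.toReal_ofReal
      (div_nonneg (hnn i) (by rw [← hr]; exact hpos.le)), ← hr, Function.comp_apply]
    field_simp
  -- When the total is 0 the coin biases are meaningless, but the descent still ends in some leaf,
  -- and no particular law is required.
  · refine ⟨PMF.map (fun l => Fin.ofNat M (l - M)) (descendLaw M t 1), ?_, fun h => absurd h hpos⟩
    rw [PMF.map_comp]
    conv_lhs => rw [← PMF.bind_pure (descendLaw M t 1)]
    rw [PMF.map]
    refine bind_congr_support _ fun l hl => ?_
    obtain ⟨h1, h2⟩ := descendLaw_support le_rfl (by omega) l hl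
    simp only [Function.comp_apply, Fin.ofNat]
    rw [Nat.mod_eq_of_lt (by omega), Nat.add_sub_cancel' h1]

/-! ### Programs on trees -/

/-- The expression for the sum of the children of the node in variable `4`. -/
def childSum (a : ℕ) : RExp :=
  .add (.arr a (.add (.var 4) (.var 4))) (.arr a (.add (.add (.var 4) (.var 4)) (.lit 1)))

/-- Draw a leaf of the tree in the array `a`, whose number of leaves is in variable `v`. -/
def descend (a v : ℕ) : Prog :=
  .seq (.setNat 4 (.lit 1)) (.loop (.natLt (.var 4) (.var v))
    (.seq (.coin 5 (.div (.arr a (.add (.add (.var 4) (.var 4)) (.lit 1))) (.arr a (.var 4))))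
      (.setNat 4 (.add (.add (.var 4) (.var 4)) (.var 5)))))

/-- Recompute the ancestors of the node in variable `4`. -/
def repair (a : ℕ) : Prog :=
  .loop (.natLt (.lit 1) (.var 4))
    (.seq (.setNat 4 (.half (.var 4))) (.storeReal a (.var 4) (childSum a)))

/-- Compute all inner nodes of the tree in the array `a`. -/
def build (a v : ℕ) : Prog :=
  .seq (.setNat 4 (.var v)) (.loop (.natLt (.lit 1) (.var 4))
    (.seq (.setNat 4 (.sub (.var 4) (.lit 1))) (.storeReal a (.var 4) (childSum a))))

/-- An upper bound for the number of levels of a tree with `M` leaves. -/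
def levels (M : ℕ) : ℕ := Nat.log 2 M + 1

/-- The memories agree, except for the scratch variables `4` and `5`. -/
def SameButScratch (s s' : Memory) : Prop :=
  s'.realVar = s.realVar ∧ s'.realArr = s.realArr ∧ ∀ x, x ≠ 4 → x ≠ 5 → s'.natVar x = s.natVar x

/-- The memories agree, except for the scratch variable `4` and the inner nodes of the tree with
`M` leaves in the array `a`. -/
def SameButTree (a M : ℕ) (s s' : Memory) : Prop :=
  s'.realVar = s.realVar ∧ (∀ x, x ≠ 4 → s'.natVar x = s.natVar x) ∧
    (∀ b, b ≠ a → s'.realArr b = s.realArr b) ∧ ∀ i, M ≤ i → s'.realArr a i = s.realArr a i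

section Programs

variable {m n : ℕ} [NeZero m] [NeZero n] {A : Matrix (Fin m) (Fin n) ℝ}

/-- Every round at least doubles the node, so M ≤ k · 2^d is maintained with d rounds left; one
round costs 21 units including the test. -/
theorem triple_descend {a v M : ℕ} [NeZero M] {s : Memory} {κ : PMF (Fin M)} (hv : v < 4)
    (hM : s.natVar v = M)
    (hκ : descendLaw M (s.realArr a) 1 = PMF.map (fun i : Fin M => M + (i : ℕ)) κ) :
    Triple A (descend a v) s (21 * levels M + 7) κ fun i s' =>
      SameButScratch s s' ∧ s'.natVar 4 = M + (i : ℕ) := by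
  refine Triple.of_map (f := fun i : Fin M => M + (i : ℕ))
    (R := fun l s' => SameButScratch s s' ∧ s'.natVar 4 = l)
    (fun i j h => Fin.ext (Nat.add_left_cancel h)) ?_
  rw [← hκ]
  have h4 : v ≠ 4 := by omega
  have h5 : v ≠ 5 := by omega
  refine Triple.mono (τ := 1 + 2 + (levels M * (3 + 1 + 17) + (3 + 1))) ?_ (by omega)
    (fun _ _ _ h => h)
  refine DTriple.seq_triple (dtriple_setNat (R := fun s' => SameButScratch s s' ∧ s'.natVar 4 = 1)
    ?_) fun s' hs' => ?_
  · refine ⟨⟨rfl, rfl, fun x h _ => ?_⟩, ?_⟩ <;> simp [Memory.setNat, NExp.eval, *]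
  refine Triple.loop (κ := fun _ k => descendLaw M (s.realArr a) k)
    (I := fun d k s' => SameButScratch s s' ∧ s'.natVar 4 = k ∧ 1 ≤ k ∧ M ≤ k * 2 ^ d)
    (R := fun l s' => SameButScratch s s' ∧ s'.natVar 4 = l) ?_ ?_ (levels M) 1 s'
    ⟨hs'.1, hs'.2, le_rfl, ?_⟩
  · rintro d k s' ⟨hs', hk, h1, -⟩ hb
    refine ⟨k, ?_, hs', hk⟩
    simp only [Test.holds, NExp.eval, hk, hs'.2.2 v h4 h5, hM] at hb
    rw [descendLaw, if_neg (by omega)]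
  · rintro d k s' ⟨hs', hk, h1, h2⟩ hb
    simp only [Test.holds, NExp.eval, hk, hs'.2.2 v h4 h5, hM] at hb
    obtain ⟨d', rfl⟩ : ∃ d', d = d' + 1 := by
      refine ⟨d - 1, ?_⟩
      rcases d with _ | d
      · simp at h2
        omega
      · rfl
    refine ⟨d', rfl, PMF.map (fun c => k + k + c) (coinLaw (s.realArr a (k + k + 1) / s.realArr a k)),
      ?_, ?_⟩
    · refine Triple.map (R := fun c s' => SameButScratch s s' ∧ s'.natVar 4 = k + k + c)
        (fun c => k + k + c) ?_ ?_
      · have hc := triple_coin (A := A) (x := 5) (s := s')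
          (e := .div (.arr a (.add (.add (.var 4) (.var 4)) (.lit 1))) (.arr a (.var 4)))
        simp only [RExp.eval, NExp.eval, hk, hs'.2.1] at hc
        refine (Triple.seq_dtriple hc fun c _ s'' hs'' => dtriple_setNat ?_)
        subst hs''
        refine ⟨⟨hs'.1, hs'.2.1, fun x h h' => ?_⟩, ?_⟩
        · simp [Memory.setNat, h, h', hs'.2.2 x h h']
        · simp [Memory.setNat, NExp.eval, hk]
      · rintro c - s'' ⟨h, h'⟩
        refine ⟨h, h', by omega, h2.trans ?_⟩
        rw [pow_succ]
        nlinarith [Nat.zero_le (c * 2 ^ d')]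
    · rw [PMF.bind_map]
      conv_lhs => rw [descendLaw, if_pos ⟨h1, hb⟩]
      rfl
  · rw [one_mul]
    exact (Nat.lt_pow_succ_log_self (by norm_num) M).le

/-- Only the parent of the current node may be inconsistent. Recomputing it moves the defect one
level up, until the current node is 1, whose half 0 lies outside the tree. -/
theorem dtriple_repair {a M : ℕ} {s : Memory} (hM : s.natVar 4 < 2 * M)
    (ht : SumTree M 1 {s.natVar 4 / 2} (s.realArr a)) :
    DTriple A (repair a) s (21 * levels M + 4) fun s' =>
      SameButTree a M s s' ∧ SumTree M 1 ∅ (s'.realArr a) := by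
  refine DTriple.mono (τ := levels M * (3 + 1 + 17) + (3 + 1)) ?_ (by omega) (fun _ h => h)
  refine DTriple.loop (I := fun d s' => SameButTree a M s s' ∧ s'.natVar 4 < 2 ^ (d + 1) ∧
    s'.natVar 4 < 2 * M ∧ SumTree M 1 {s'.natVar 4 / 2} (s'.realArr a)) ?_ ?_ _ s
    ⟨⟨rfl, fun _ _ => rfl, fun _ _ => rfl, fun _ _ => rfl⟩, ?_, hM, ht⟩
  · rintro d s' ⟨h1, -, -, h4⟩ hb
    refine ⟨h1, fun j hj hjM _ => h4 j hj hjM ?_⟩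
    simp only [Test.holds, NExp.eval] at hb
    simp only [Set.mem_singleton_iff]
    omega
  · rintro d s' ⟨h1, h2, h3, h4⟩ hb
    simp only [Test.holds, NExp.eval] at hb
    obtain ⟨d', rfl⟩ : ∃ d', d = d' + 1 := by
      refine ⟨d - 1, ?_⟩
      rcases d with _ | d
      · simp at h2
        omega
      · rfl
    refine ⟨d', rfl, DTriple.seq (dtriple_setNat rfl) fun s'' hs'' => dtriple_storeReal ?_⟩
    subst hs''
    set k := s'.natVar 4 / 2 with hk
    have hk1 : 1 ≤ k := by omega
    have hkM : k < M := by omega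
    refine ⟨⟨h1.1, fun x hx => ?_, fun b hb => ?_, fun i hi => ?_⟩, ?_, ?_, fun j hj hjM hjk => ?_⟩
    · simp [Memory.storeReal, Memory.setNat, hx, h1.2.1 x hx]
    · simp [Memory.storeReal, Memory.setNat, hb, h1.2.2.1 b hb]
    · have : i ≠ k := by omega
      simp [Memory.storeReal, Memory.setNat, NExp.eval, ← hk, this, h1.2.2.2 i hi]
    · simp only [Memory.storeReal, Memory.setNat, NExp.eval, Function.update_self]
      rw [pow_succ] at h2
      omega
    · simp only [Memory.storeReal, Memory.setNat, NExp.eval, Function.update_self]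
      omega
    · simp only [Memory.storeReal, Memory.setNat, NExp.eval, Function.update_self, ← hk,
        Set.mem_singleton_iff, childSum, RExp.eval] at hjk ⊢
      rw [Function.update_of_ne (a := j + j) (by omega),
        Function.update_of_ne (a := j + j + 1) (by omega)]
      by_cases hjk' : j = k
      · subst hjk'
        rw [Function.update_self]
      · rw [Function.update_of_ne hjk']
        exact h4 j hj hjM hjk'
  · have := Nat.lt_pow_succ_log_self (b := 2) (by norm_num) M
    rw [levels, pow_succ]
    omega

/-- Nodes are computed in decreasing order; children have larger indices than their parent, so later
writes never disturb finished nodes. -/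
theorem dtriple_build {a v M : ℕ} {s : Memory} (hM : s.natVar v = M) :
    DTriple A (build a v) s (23 * M + 7) fun s' =>
      SameButTree a M s s' ∧ SumTree M 1 ∅ (s'.realArr a) := by
  refine DTriple.mono (τ := 1 + 2 + (M * (3 + 1 + 19) + (3 + 1))) ?_ (by omega) (fun _ h => h)
  refine DTriple.seq (dtriple_setNat
    (R := fun s' => SameButTree a M s s' ∧ s'.natVar 4 = M) ?_) fun s' hs' => ?_
  · refine ⟨⟨rfl, fun x hx => ?_, fun _ _ => rfl, fun _ _ => rfl⟩, ?_⟩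
    · simp [Memory.setNat, hx]
    · simp [Memory.setNat, NExp.eval, hM]
  refine DTriple.loop (I := fun d s' => SameButTree a M s s' ∧ s'.natVar 4 ≤ d ∧
    s'.natVar 4 ≤ M ∧ SumTree M (s'.natVar 4) ∅ (s'.realArr a)) ?_ ?_ _ s'
    ⟨hs'.1, hs'.2.le, hs'.2.le, fun j hj hjM => by omega⟩
  · rintro d s' ⟨h1, -, -, h4⟩ hb
    simp only [Test.holds, NExp.eval] at hb
    exact ⟨h1, fun j hj hjM => h4 j (by omega) hjM⟩
  · rintro d s' ⟨h1, h2, h3, h4⟩ hb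
    simp only [Test.holds, NExp.eval] at hb
    refine ⟨d - 1, by omega, DTriple.mono (τ := 1 + 4 + 13)
      (DTriple.seq (dtriple_setNat rfl) fun s'' hs'' => dtriple_storeReal ?_) (by omega)
      fun _ h => h⟩
    subst hs''
    set k := s'.natVar 4 - 1 with hk
    refine ⟨⟨h1.1, fun x hx => ?_, fun b hb => ?_, fun i hi => ?_⟩, ?_, ?_, fun j hj hjM _ => ?_⟩
    · simp [Memory.storeReal, Memory.setNat, hx, h1.2.1 x hx]
    · simp [Memory.storeReal, Memory.setNat, hb, h1.2.2.1 b hb]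
    · have : i ≠ k := by omega
      simp [Memory.storeReal, Memory.setNat, NExp.eval, ← hk, this, h1.2.2.2 i hi]
    · simp only [Memory.storeReal, Memory.setNat, NExp.eval, Function.update_self]
      omega
    · simp only [Memory.storeReal, Memory.setNat, NExp.eval, Function.update_self]
      omega
    · simp only [Memory.storeReal, Memory.setNat, NExp.eval, Function.update_self, ← hk,
        childSum, RExp.eval] at hj ⊢
      rw [Function.update_of_ne (a := j + j) (by omega),
        Function.update_of_ne (a := j + j + 1) (by omega)]
      by_cases hjk' : j = k
      · subst hjk'
        rw [Function.update_self]
      · rw [Function.update_of_ne hjk']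
        exact h4 j (by omega) hjM (by simp)

end Programs

/-! ### Memory lemmas -/

section MemoryLemmas

variable (s : Memory) (x y a b i : ℕ) (v : ℕ) (r : ℝ)

@[simp] theorem Memory.setNat_natVar :
    (s.setNat x v).natVar y = if y = x then v else s.natVar y := by
  simp [Memory.setNat, Function.update_apply]

@[simp] theorem Memory.setNat_realVar : (s.setNat x v).realVar = s.realVar := rfl

@[simp] theorem Memory.setNat_realArr : (s.setNat x v).realArr = s.realArr := rfl

@[simp] theorem Memory.setReal_realVar :
    (s.setReal x r).realVar y = if y = x then r else s.realVar y := by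
  simp [Memory.setReal, Function.update_apply]

@[simp] theorem Memory.setReal_natVar : (s.setReal x r).natVar = s.natVar := rfl

@[simp] theorem Memory.setReal_realArr : (s.setReal x r).realArr = s.realArr := rfl

@[simp] theorem Memory.storeReal_realArr :
    (s.storeReal a i r).realArr b =
      if b = a then Function.update (s.realArr a) i r else s.realArr b := by
  by_cases h : b = a
  · subst h
    simp [Memory.storeReal]
  · simp [Memory.storeReal, h]

@[simp] theorem Memory.storeReal_realVar : (s.storeReal a i r).realVar = s.realVar := rfl

@[simp] theorem Memory.storeReal_natVar : (s.storeReal a i r).natVar = s.natVar := rfl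

end MemoryLemmas

/-! ### The representation of the iterates -/

/-- The code of a scheme. -/
def Scheme.code : Scheme → ℕ
  | .frobenius => 0
  | .support => 1
  | .columnAbs => 2

section Representation

variable {m n : ℕ} (A : Matrix (Fin m) (Fin n) ℝ) (k : Scheme)

/-- The parameters and counters in memory. -/
structure RepParams (m n : ℕ) (k : Scheme) (η R : ℝ) (t : ℕ) (s : Memory) : Prop where
  rows : s.natVar 0 = m
  cols : s.natVar 1 = n
  code : s.natVar 2 = k.code
  count : s.natVar 3 = t
  eta : s.realVar 1 = η
  bound : s.realVar 2 = R

/-- The memory represents the ball block `x` of the iterate and the ball block `S` of the sum. -/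
structure RepX (x S : Fin n → ℝ) (s : Memory) : Prop where
  scale_pos : 0 < s.realVar 3
  iterate : ∀ j, x j = s.realVar 3 * s.realArr 4 j
  total : ∀ j, S j = s.realVar 4 * s.realArr 4 j + s.realArr 5 j
  normSq : s.realVar 6 = ∑ j : Fin n, s.realArr 4 j ^ 2
  tree : SumTree n 1 ∅ (s.realArr 3)
  leaf : ∀ j : Fin n, s.realArr 3 (n + j) = colWeight A k (fun l => s.realArr 4 l) j

/-- The memory represents the simplex block `y` of the iterate and the simplex block `S` of the
sum. -/
structure RepY (y S : Fin m → ℝ) (s : Memory) : Prop where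
  weight_pos : ∀ i : Fin m, 0 < s.realArr 2 (m + i)
  iterate : ∀ i, y i = s.realArr 2 (m + i) / s.realArr 2 1
  total : ∀ i, S i = s.realVar 5 * s.realArr 2 (m + i) + s.realArr 6 i
  tree : SumTree m 1 ∅ (s.realArr 2)

/-- The memory represents the state `p = (z_t, z_0 + ⋯ + z_t)`. -/
structure Rep (η R : ℝ) (t : ℕ) (p : Point n m × Point n m) (s : Memory) : Prop where
  params : RepParams m n k η R t s
  repX : RepX A k p.1.1 p.2.1 s
  repY : RepY p.1.2 p.2.2 s

/-- The memory represents the gradient estimate `g`. -/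
def RepGrad (g : Point n m) (s : Memory) : Prop :=
  ∃ (j : Fin n) (i : Fin m), s.natVar 7 = j ∧ s.natVar 8 = i ∧
    g = (Pi.single j (s.realVar 7), Pi.single i (s.realVar 8))

variable {A k}

theorem RepParams.congr {η R : ℝ} {t : ℕ} {s s' : Memory} (h : RepParams m n k η R t s)
    (h0 : ∀ x < 4, s'.natVar x = s.natVar x) (h1 : s'.realVar 1 = s.realVar 1)
    (h2 : s'.realVar 2 = s.realVar 2) : RepParams m n k η R t s' :=
  ⟨(h0 0 (by omega)).trans h.rows, (h0 1 (by omega)).trans h.cols, (h0 2 (by omega)).trans h.code,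
    (h0 3 (by omega)).trans h.count, h1.trans h.eta, h2.trans h.bound⟩

theorem RepX.congr {x S : Fin n → ℝ} {s s' : Memory} (h : RepX A k x S s)
    (h3 : s'.realVar 3 = s.realVar 3) (h4 : s'.realVar 4 = s.realVar 4)
    (h6 : s'.realVar 6 = s.realVar 6) (a3 : s'.realArr 3 = s.realArr 3)
    (a4 : s'.realArr 4 = s.realArr 4) (a5 : s'.realArr 5 = s.realArr 5) : RepX A k x S s' := by
  constructor <;> simp only [h3, h4, h6, a3, a4, a5]
  exacts [h.scale_pos, h.iterate, h.total, h.normSq, h.tree, h.leaf]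

theorem RepY.congr {y S : Fin m → ℝ} {s s' : Memory} (h : RepY y S s)
    (h5 : s'.realVar 5 = s.realVar 5) (a2 : s'.realArr 2 = s.realArr 2)
    (a6 : s'.realArr 6 = s.realArr 6) : RepY y S s' := by
  constructor <;> simp only [h5, a2, a6]
  exacts [h.weight_pos, h.iterate, h.total, h.tree]

theorem Rep.congr {η R : ℝ} {t : ℕ} {p : Point n m × Point n m} {s s' : Memory}
    (h : Rep A k η R t p s) (hn : ∀ x < 4, s'.natVar x = s.natVar x)
    (hr : ∀ x < 7, s'.realVar x = s.realVar x) (ha : s'.realArr = s.realArr) :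
    Rep A k η R t p s' :=
  ⟨h.params.congr hn (hr 1 (by omega)) (hr 2 (by omega)),
    h.repX.congr (hr 3 (by omega)) (hr 4 (by omega)) (hr 6 (by omega)) (by rw [ha]) (by rw [ha])
      (by rw [ha]),
    h.repY.congr (hr 5 (by omega)) (by rw [ha]) (by rw [ha])⟩

end Representation

/-! ### Sampling pairs of indices in two stages -/

/-- Chain rule, marginal times conditional. The equivalence permits drawing the indices in either
order: row first for p, column first for q. -/
theorem bind_propTo_eq {α β γ : Type} [Fintype α] [Nonempty α] [Fintype β] [Nonempty β]
    [Fintype γ] [Nonempty γ] (e : α × β ≃ γ) {w : α → ℝ} {c : α → β → ℝ} {W : γ → ℝ}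
    (hw : ∀ a, 0 ≤ w a) (hw1 : 0 < ∑ a, w a) (hc : ∀ a b, 0 ≤ c a b) (hc1 : ∀ a, 0 < ∑ b, c a b)
    (hW : ∀ a b, W (e (a, b)) = w a / (∑ a, w a) * (c a b / ∑ b, c a b)) :
    (propTo w).bind (fun a => PMF.map (fun b => e (a, b)) (propTo (c a))) = propTo W := by
  have hW0 : ∀ g, 0 ≤ W g := fun g => by
    obtain ⟨⟨a, b⟩, rfl⟩ := e.surjective g
    rw [hW]
    exact mul_nonneg (div_nonneg (hw a) hw1.le) (div_nonneg (hc a b) (hc1 a).le)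
  have hW1 : ∑ g, W g = 1 := by
    rw [← Equiv.sum_comp e, Fintype.sum_prod_type]
    simp only [hW, ← Finset.mul_sum, ← Finset.sum_div]
    simp only [div_self (hc1 _).ne', mul_one, ← Finset.sum_div]
    exact div_self hw1.ne'
  ext g
  obtain ⟨⟨a, b⟩, rfl⟩ := e.surjective g
  rw [propTo_apply hW0 (by rw [hW1]; exact one_pos), hW1, div_one, hW, PMF.bind_apply,
    tsum_fintype, Finset.sum_eq_single a, PMF.map_apply, tsum_fintype, Finset.sum_eq_single b,
    if_pos rfl, propTo_apply hw hw1, propTo_apply (hc a) (hc1 a),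
    ENNReal.ofReal_mul (div_nonneg (hw a) hw1.le)]
  · intro b' _ hb
    rw [if_neg]
    simpa using hb.symm
  · simp
  · intro a' _ ha
    rw [PMF.map_apply, tsum_fintype, Finset.sum_eq_zero, mul_zero]
    intro b' _
    rw [if_neg]
    simpa using fun h => absurd h.symm ha
  · simp

/-! ### The sampling part of an iteration -/

/-- Draw `(i, j)` from `p(z)` into the variables `6` and `7`, and compute the entry of the first
block of the estimator. -/
def sampleP : Prog :=
  .seq (descend 2 0) (.seq (.setNat 6 (.sub (.var 4) (.var 0))) (.seq (.sampleRow 7 .one (.var 6))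
    (.setReal 7 (.div
      (.mul (.entry (.var 6) (.var 7)) (.div (.arr 2 (.add (.var 0) (.var 6))) (.arr 2 (.lit 1))))
      (.mul (.div (.sqrt (.mul (.entry (.var 6) (.var 7)) (.entry (.var 6) (.var 7))))
        (.rowNorm .one (.var 6)))
        (.div (.arr 2 (.add (.var 0) (.var 6))) (.arr 2 (.lit 1))))))))

/-- The expression `A_{i'j'}`. -/
def entryQ : RExp := .entry (.var 8) (.var 9)

/-- The expression for the stored coordinate `j'`. -/
def coordQ : RExp := .arr 4 (.var 9)

/-- Draw `i'` given `j'`, and compute `q_{i'j'}(z)` (if `A_{i'j'} ≠ 0`). -/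
def sampleCond : Prog :=
  .ite (.natLt (.var 2) (.lit 1))
    (.seq (.sampleCol 8 .two (.var 9)) (.setReal 9 (.div (.mul entryQ entryQ) (.arr 3 (.lit 1)))))
    (.ite (.natLt (.var 2) (.lit 2))
      (.seq (.sampleColSupport 8 (.var 9))
        (.setReal 9 (.div (.mul coordQ coordQ) (.arr 3 (.lit 1)))))
      (.seq (.sampleCol 8 .one (.var 9))
        (.setReal 9 (.div (.mul (.mul coordQ coordQ) (.sqrt (.mul entryQ entryQ)))
          (.arr 3 (.lit 1))))))

/-- Draw `(i', j')` from `q(z)` into the variables `8` and `9`, and compute the entry of the second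
block of the estimator. -/
def sampleQ : Prog :=
  .seq (descend 3 1) (.seq (.setNat 9 (.sub (.var 4) (.var 1))) (.seq sampleCond
    (.setReal 8 (.div (.sub (.ofNat (.lit 0)) (.mul entryQ (.mul (.var 3) coordQ))) (.var 9)))))

section Sampling

variable {m n : ℕ} [NeZero m] [NeZero n] {A : Matrix (Fin m) (Fin n) ℝ} {k : Scheme}
  {η R : ℝ} {t : ℕ} {p : Point n m × Point n m}

omit [NeZero m] [NeZero n] in
theorem Rep.sameButScratch {s s' : Memory} (h : Rep A k η R t p s) (hs : SameButScratch s s') :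
    Rep A k η R t p s' :=
  h.congr (fun x hx => hs.2.2 x (by omega) (by omega)) (fun x _ => by rw [hs.1]) hs.2.1

theorem RepY.root_eq {y S : Fin m → ℝ} {s : Memory} (h : RepY y S s) :
    s.realArr 2 1 = ∑ i : Fin m, s.realArr 2 (m + i) :=
  h.tree.root_eq (Nat.pos_of_ne_zero (NeZero.ne m))

theorem RepY.root_pos {y S : Fin m → ℝ} {s : Memory} (h : RepY y S s) : 0 < s.realArr 2 1 := by
  rw [h.root_eq]
  exact Finset.sum_pos (fun i _ => h.weight_pos i) ⟨0, Finset.mem_univ _⟩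

omit [NeZero m] in
theorem RepX.root_eq {x S : Fin n → ℝ} {s : Memory} (h : RepX A k x S s) :
    s.realArr 3 1 = ∑ j : Fin n, colWeight A k (fun l => s.realArr 4 l) j := by
  rw [h.tree.root_eq (Nat.pos_of_ne_zero (NeZero.ne n))]
  exact Finset.sum_congr rfl fun j _ => h.leaf j

theorem leaf_nonneg {M : ℕ} {f : ℕ → ℝ} (h : ∀ i : Fin M, 0 ≤ f (M + i)) (i : ℕ) (h1 : M ≤ i)
    (h2 : i < 2 * M) : 0 ≤ f i := by
  have := h ⟨i - M, by omega⟩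
  rwa [Nat.add_sub_cancel' h1] at this

/-- The leaves of the row tree are y up to normalization, so the descent draws i from y; the row
oracle then supplies j. -/
theorem triple_sampleP (hrow : ∀ i, ∃ j, A i j ≠ 0) {s : Memory} (h : Rep A k η R t p s) :
    Triple A sampleP s (21 * levels m + 60) (propTo (pProb A p.1)) fun q s' =>
      Rep A k η R t p s' ∧ s'.natVar 7 = q.2 ∧
        s'.realVar 7 = A q.1 q.2 * p.1.2 q.1 / pProb A p.1 q := by
  obtain ⟨κ, hκ, hκ'⟩ := exists_descendLaw_eq_map h.repY.tree
    (leaf_nonneg fun i => (h.repY.weight_pos i).le)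
  have hp := h.repY.root_pos
  have hr := h.repY.root_eq
  obtain rfl := hκ' hp
  have hlaw : (propTo fun i : Fin m => s.realArr 2 (m + i)).bind (fun i =>
      PMF.map (fun j => (i, j)) (propTo fun j => absPow .one (A i j))) = propTo (pProb A p.1) := by
    refine bind_propTo_eq (Equiv.refl _) (fun i => (h.repY.weight_pos i).le) (by rwa [← hr])
      (fun i j => abs_nonneg _) (fun i => rowL1_pos A (hrow i)) fun i j => ?_
    simp only [Equiv.refl_apply, pProb, h.repY.iterate, ← hr, absPow, rowL1]
    ring
  rw [← hlaw]
  refine Triple.mono (Triple.seq (τ₂ := 40) (triple_descend (by norm_num) h.params.rows hκ)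
    fun i _ s₁ h₁ => ?_) ?_ fun _ _ _ h => h
  · obtain ⟨h₁, h4⟩ := h₁
    have hR₁ := h.sameButScratch h₁
    refine Triple.mono (DTriple.seq_triple (dtriple_setNat rfl) fun s₂ hs₂ => Triple.map
      (R := fun (j : Fin n) s' => Rep A k η R t p s' ∧ s'.natVar 7 = (j : ℕ) ∧
        s'.realVar 7 = A i j * p.1.2 i / pProb A p.1 (i, j)) (fun j => (i, j))
      (Triple.seq_dtriple (triple_sampleRow i ?_) fun j _ s₃ hs₃ => dtriple_setReal ?_)
      fun _ _ _ h => h) ?_ fun _ _ _ h => h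
    · subst hs₂
      simp [NExp.eval, h4, hR₁.params.rows]
    · subst hs₃ hs₂
      refine ⟨hR₁.congr (fun x hx => ?_) (fun x hx => ?_) (by simp), by simp, ?_⟩
      · have : x ≠ 6 := by omega
        have : x ≠ 7 := by omega
        simp [*]
      · have : x ≠ 7 := by omega
        simp [*]
      · simp [RExp.eval, NExp.eval, h4, hR₁.params.rows, hR₁.repY.iterate, pProb, rowNorm,
          Real.sqrt_mul_self_eq_abs]
    · simp [NExp.cost, RExp.cost]
  · omega

omit [NeZero m] [NeZero n] in
/-- The probability `q_{ij}(z)` in terms of the stored coordinates. -/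
theorem qProb_smul (z : Point n m) {u : Fin n → ℝ} {ν : ℝ} (hν : 0 < ν)
    (hx : ∀ j, z.1 j = ν * u j) (q : Fin m × Fin n) :
    qProb A k z q = coordWeight k u q.2 * condWeight A k q.2 q.1 / ∑ j, colWeight A k u j := by
  -- The weights are homogeneous in x of degree 0 or 2, so the factor cancels in the quotient.
  obtain ⟨θ, hθ, h⟩ : ∃ θ : ℝ, 0 < θ ∧ ∀ j, coordWeight k z.1 j = θ * coordWeight k u j := by
    cases k
    · exact ⟨1, one_pos, fun j => by simp [coordWeight]⟩
    · exact ⟨ν ^ 2, by positivity, fun j => by simp [coordWeight, hx, mul_pow]⟩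
    · exact ⟨ν ^ 2, by positivity, fun j => by simp [coordWeight, hx, mul_pow]⟩
  rw [qProb_eq]
  simp only [colWeight_eq, h, mul_assoc, ← Finset.mul_sum]
  rw [mul_div_mul_left _ _ hθ.ne']

/-- The value of q is claimed only at nonzero entries, since the support branch omits the indicator.
At a zero entry the estimator vanishes whatever is divided by. -/
theorem triple_sampleCond {s : Memory} (h : Rep A k η R t p s) (j : Fin n)
    (hj : s.natVar 9 = j) :
    Triple A sampleCond s 40 (propTo fun i => condWeight A k j i) fun i s' =>
      Rep A k η R t p s' ∧ s'.natVar 7 = s.natVar 7 ∧ s'.realVar 7 = s.realVar 7 ∧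
        s'.natVar 8 = i ∧ s'.natVar 9 = j ∧ (A i j ≠ 0 → s'.realVar 9 = qProb A k p.1 (i, j)) := by
  have hq := fun i => qProb_smul (A := A) (k := k) p.1 h.repX.scale_pos h.repX.iterate (i, j)
  simp only [← h.repX.root_eq] at hq
  have hcode := h.params.code
  have main : ∀ (v : ℕ) (r : ℝ), Rep A k η R t p ((s.setNat 8 v).setReal 9 r) := fun v r => by
    refine h.congr (fun x hx => ?_) (fun x hx => ?_) (by simp)
    · have : x ≠ 8 := by omega
      simp [*]
    · have : x ≠ 9 := by omega
      simp [*]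
  cases k
  · refine Triple.mono (Triple.ite (τ := 20) (fun _ => ?_) fun hb => ?_) ?_ fun _ _ _ h => h
    · refine Triple.mono (Triple.seq_dtriple (triple_sampleCol j (by simpa [NExp.eval] using hj))
        fun i _ s' hs' => dtriple_setReal ?_) ?_ fun _ _ _ h => h
      · subst hs'
        refine ⟨main _ _, by simp, by simp, by simp, by simp [hj], fun _ => ?_⟩
        simp [RExp.eval, NExp.eval, entryQ, hj, hq, coordWeight, condWeight, sq]
      · simp [NExp.cost, RExp.cost, entryQ]
    · simp [Test.holds, NExp.eval, hcode, Scheme.code] at hb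
    · simp [Test.cost, NExp.cost]
  · refine Triple.mono (Triple.ite (τ := 30) (fun hb => ?_) fun _ =>
      Triple.mono (Triple.ite (τ := 20) (fun _ => ?_) fun hb => ?_) ?_ fun _ _ _ h => h)
      ?_ fun _ _ _ h => h
    · simp [Test.holds, NExp.eval, hcode, Scheme.code] at hb
    · refine Triple.mono (Triple.seq_dtriple (triple_sampleColSupport j
        (by simpa [NExp.eval] using hj)) fun i _ s' hs' => dtriple_setReal ?_) ?_ fun _ _ _ h => h
      · subst hs'
        refine ⟨main _ _, by simp, by simp, by simp, by simp [hj], fun hA => ?_⟩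
        simp [RExp.eval, NExp.eval, coordQ, hj, hq, coordWeight, condWeight, sq, hA]
      · simp [NExp.cost, RExp.cost, coordQ]
    · simp [Test.holds, NExp.eval, hcode, Scheme.code] at hb
    · simp [Test.cost, NExp.cost]
    · simp [Test.cost, NExp.cost]
  · refine Triple.mono (Triple.ite (τ := 30) (fun hb => ?_) fun _ =>
      Triple.mono (Triple.ite (τ := 24) (fun hb => ?_) fun _ => ?_) ?_ fun _ _ _ h => h)
      ?_ fun _ _ _ h => h
    · simp [Test.holds, NExp.eval, hcode, Scheme.code] at hb
    · simp [Test.holds, NExp.eval, hcode, Scheme.code] at hb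
    · refine Triple.mono (Triple.seq_dtriple (triple_sampleCol j (by simpa [NExp.eval] using hj))
        fun i _ s' hs' => dtriple_setReal ?_) ?_ fun _ _ _ h => h
      · subst hs'
        refine ⟨main _ _, by simp, by simp, by simp, by simp [hj], fun hA => ?_⟩
        simp [RExp.eval, NExp.eval, coordQ, entryQ, hj, hq, coordWeight, condWeight, sq,
          Real.sqrt_mul_self_eq_abs]
      · simp [NExp.cost, RExp.cost, coordQ, entryQ]
    · simp [Test.cost, NExp.cost]
    · simp [Test.cost, NExp.cost]

theorem triple_sampleQ (hcol : ∀ j, ∃ i, A i j ≠ 0) {s : Memory} (h : Rep A k η R t p s)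
    (q : Fin m × Fin n) (h7 : s.natVar 7 = q.2)
    (h7' : s.realVar 7 = A q.1 q.2 * p.1.2 q.1 / pProb A p.1 q) :
    Triple A sampleQ s (21 * levels n + 80)
      (PMF.map (estimator A k p.1 q) (propTo (qProb A k p.1))) fun g s' =>
      Rep A k η R t p s' ∧ RepGrad g s' := by
  obtain ⟨κ, hκ, hκ'⟩ := exists_descendLaw_eq_map h.repX.tree
    (leaf_nonneg fun i => by rw [h.repX.leaf]; exact colWeight_nonneg A k _ _)
  have hr := h.repX.root_eq
  have hlaw : PMF.map (estimator A k p.1 q) (propTo (qProb A k p.1)) =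
      κ.bind fun j => PMF.map (fun i => estimator A k p.1 q (i, j))
        (propTo fun i => condWeight A k j i) := by
    by_cases hx : k = .frobenius ∨ p.1.1 ≠ 0
    · have hx' : k = .frobenius ∨ (fun l : Fin n => s.realArr 4 l) ≠ 0 := by
        refine hx.imp_right fun hx hu => hx ?_
        funext j
        rw [h.repX.iterate]
        simp [show s.realArr 4 j = 0 from congrFun hu j]
      have hpos := sum_colWeight_pos hcol k hx'
      rw [← hr] at hpos
      obtain rfl := hκ' hpos
      have : (propTo fun j : Fin n => s.realArr 3 (n + j)).bind (fun j =>
          PMF.map (fun i => Equiv.prodComm _ _ (j, i)) (propTo fun i => condWeight A k j i)) =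
          propTo (qProb A k p.1) := by
        refine bind_propTo_eq (Equiv.prodComm _ _)
          (fun j => by rw [h.repX.leaf]; exact colWeight_nonneg A k _ _) ?_
          (fun j i => condWeight_nonneg A k j i) (fun j => sum_condWeight_pos A k (hcol j))
          fun j i => ?_
        · simp only [h.repX.leaf]
          rwa [← hr]
        · simp only [Equiv.prodComm_apply, Prod.swap_prod_mk, h.repX.leaf,
            qProb_smul p.1 h.repX.scale_pos h.repX.iterate]
          rw [colWeight_eq]
          have := (sum_condWeight_pos A k (hcol j)).ne'
          field_simp
      rw [← this, PMF.map_bind]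
      simp only [PMF.map_comp]
      rfl
    -- At x = 0 in the two schemes depending on x, the column tree has root 0 and the drawn column
    -- is arbitrary. The second block of the estimator is 0 for every pair, so the law of the
    -- estimate is unaffected.
    · push Not at hx
      have : ∀ s', estimator A k p.1 q s' = ((estimator A k p.1 q q).1, 0) := fun s' =>
        Prod.ext rfl (estimator_snd_eq_zero k hx.2 q s')
      generalize hc : ((estimator A k p.1 q q).1, (0 : Fin m → ℝ)) = c at this
      rw [show estimator A k p.1 q = fun _ => c from funext this]
      simp only [map_fun_const, PMF.bind_const]
  rw [hlaw]
  refine Triple.mono (Triple.seq (τ₂ := 70) (triple_descend (by norm_num) h.params.cols hκ)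
    fun j _ s₁ h₁ => ?_) ?_ fun _ _ _ h => h
  · obtain ⟨h₁, h4⟩ := h₁
    have hR₁ := h.sameButScratch h₁
    have hR₂ : Rep A k η R t p (s₁.setNat 9 j) := by
      refine hR₁.congr (fun x hx => ?_) (fun x hx => by simp) (by simp)
      have : x ≠ 9 := by omega
      simp [*]
    refine Triple.mono (DTriple.seq_triple (R₁ := fun s' => s' = s₁.setNat 9 j)
      (dtriple_setNat ?_) fun s₂ hs₂ => Triple.map
      (R := fun (i : Fin m) s' => Rep A k η R t p s' ∧ RepGrad (estimator A k p.1 q (i, j)) s')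
      (fun i => estimator A k p.1 q (i, j))
      (Triple.seq_dtriple (triple_sampleCond (hs₂ ▸ hR₂) j (by simp [hs₂]))
        fun i _ s₃ hs₃ => dtriple_setReal ?_)
      fun _ _ _ h => h) ?_ fun _ _ _ h => h
    · simp [NExp.eval, h4, hR₁.params.cols]
    · obtain ⟨hR₃, e7, e7', e8, e9, eq⟩ := hs₃
      subst hs₂
      refine ⟨hR₃.congr (fun x hx => by simp) (fun x hx => ?_) (by simp), q.2, i, ?_, ?_, ?_⟩
      · have : x ≠ 8 := by omega
        simp [*]
      · simp [e7, h₁.2.2, h7]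
      · simp [e8]
      · have e : s₃.realVar 7 = A q.1 q.2 * p.1.2 q.1 / pProb A p.1 q := by
          rw [e7']
          simp [h₁.1, h7']
        have hx := hR₃.repX.iterate j
        refine Prod.ext ?_ ?_
        · simp [estimator, e]
        · simp only [estimator, RExp.eval, NExp.eval, entryQ, coordQ, e8, e9,
            Memory.setReal_realVar, if_true]
          congr 1
          by_cases hA : A i j = 0
          · simp [hA]
          · simp [eq hA, hx]
    · simp [NExp.cost, RExp.cost, entryQ, coordQ]
  · omega

/-- Sample a gradient estimate. -/
def sampleGrad : Prog := .seq sampleP sampleQ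

theorem triple_sampleGrad (hrow : ∀ i, ∃ j, A i j ≠ 0) (hcol : ∀ j, ∃ i, A i j ≠ 0) {s : Memory}
    (h : Rep A k η R t p s) :
    Triple A sampleGrad s (21 * levels m + 21 * levels n + 150) (estimatorLaw A k p.1)
      fun g s' => Rep A k η R t p s' ∧ RepGrad g s' :=
  Triple.mono (Triple.seq (triple_sampleP hrow h) fun q _ _ hs =>
    triple_sampleQ hcol hs.1 q hs.2.1 hs.2.2) (by omega) fun _ _ _ h => h

end Sampling

/-! ### The update part of an iteration -/

/-- Update the ball block, up to the column tree. -/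
def moveX : Prog :=
  .seq (.setReal 9 (.sub (.arr 4 (.var 7)) (.div (.mul (.var 1) (.var 7)) (.var 3))))
    (.seq (.setReal 6 (.add (.var 6) (.sub (.mul (.var 9) (.var 9))
      (.mul (.arr 4 (.var 7)) (.arr 4 (.var 7))))))
    (.seq (.storeReal 5 (.var 7)
      (.sub (.arr 5 (.var 7)) (.mul (.var 4) (.sub (.var 9) (.arr 4 (.var 7))))))
    (.seq (.storeReal 4 (.var 7) (.var 9))
    (.seq (.ite (.realLt (.ofNat (.lit 1)) (.mul (.mul (.var 3) (.var 3)) (.var 6)))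
      (.setReal 3 (.div (.ofNat (.lit 1)) (.sqrt (.var 6)))) .skip)
    (.setReal 4 (.add (.var 4) (.var 3)))))))

/-- Update the column tree. -/
def moveCol : Prog :=
  .ite (.natLt (.lit 0) (.var 2))
    (.seq (.ite (.natLt (.var 2) (.lit 2)) (.setReal 9 (.ofNat (.colNnz (.var 7))))
      (.setReal 9 (.colNorm .one (.var 7))))
    (.seq (.storeReal 3 (.add (.var 1) (.var 7))
      (.mul (.var 9) (.mul (.arr 4 (.var 7)) (.arr 4 (.var 7)))))
    (.seq (.setNat 4 (.add (.var 1) (.var 7))) (repair 3)))) .skip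

/-- Update the simplex block. -/
def moveY : Prog :=
  .seq (.setReal 9 (.mul (.var 1) (.var 8)))
    (.seq (.ite (.realLt (.ofNat (.lit 1)) (.var 9)) (.setReal 9 (.ofNat (.lit 1)))
      (.ite (.realLt (.var 9) (.sub (.ofNat (.lit 0)) (.ofNat (.lit 1))))
        (.setReal 9 (.sub (.ofNat (.lit 0)) (.ofNat (.lit 1)))) .skip))
    (.seq (.setReal 9 (.mul (.arr 2 (.add (.var 0) (.var 8)))
      (.exp (.sub (.ofNat (.lit 0)) (.var 9)))))
    (.seq (.storeReal 6 (.var 8) (.sub (.arr 6 (.var 8))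
      (.mul (.var 5) (.sub (.var 9) (.arr 2 (.add (.var 0) (.var 8)))))))
    (.seq (.storeReal 2 (.add (.var 0) (.var 8)) (.var 9))
    (.seq (.setNat 4 (.add (.var 0) (.var 8)))
    (.seq (repair 2)
    (.setReal 5 (.add (.var 5) (.div (.ofNat (.lit 1)) (.arr 2 (.lit 1)))))))))))

/-- Projecting x = νu changes only the scalar ν, so it costs O(1) once ‖u‖² is maintained. -/
theorem ballProj_smul {n : ℕ} {ν : ℝ} (hν : 0 < ν) (u : Fin n → ℝ) (l : Fin n) :
    ballProj (fun l => ν * u l) l =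
      (if 1 < ν * ν * ∑ l, u l ^ 2 then 1 / √(∑ l, u l ^ 2) else ν) * u l := by
  have e : ∑ l, (ν * u l) ^ 2 = ν * ν * ∑ l, u l ^ 2 := by
    rw [Finset.mul_sum]
    exact Finset.sum_congr rfl fun l _ => by ring
  unfold ballProj
  rw [e]
  split_ifs with h
  · rw [Real.sqrt_mul (mul_nonneg hν.le hν.le), Real.sqrt_mul_self hν.le]
    field_simp
  · rfl

/-- The normalization cancels, so unnormalized weights can be updated in place. -/
theorem mwu_div {m : ℕ} {w y c : Fin m → ℝ} {W : ℝ} (hW : W ≠ 0) (hy : ∀ i, y i = w i / W)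
    (i : Fin m) : mwu y c i = w i * Real.exp (-c i) / ∑ l, w l * Real.exp (-c l) := by
  simp only [mwu, hy, div_mul_eq_mul_div, ← Finset.sum_div]
  rw [div_div_div_cancel_right₀ hW]

theorem sum_update_sq {n : ℕ} (f : ℕ → ℝ) (j : Fin n) (v : ℝ) :
    ∑ l : Fin n, Function.update f j v l ^ 2 = ∑ l : Fin n, f l ^ 2 + (v * v - f j * f j) := by
  rw [← Finset.add_sum_erase _ _ (Finset.mem_univ j),
    ← Finset.add_sum_erase Finset.univ (fun l : Fin n => f l ^ 2) (Finset.mem_univ j),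
    Function.update_self]
  have : ∀ l ∈ Finset.univ.erase j, Function.update f j v (l : ℕ) ^ 2 = f l ^ 2 := fun l hl => by
    rw [Function.update_of_ne]
    exact fun h => (Finset.mem_erase.1 hl).1 (Fin.ext h)
  rw [Finset.sum_congr rfl this]
  ring

section Updates

variable {m n : ℕ} [NeZero m] [NeZero n] {A : Matrix (Fin m) (Fin n) ℝ} {k : Scheme}
  {η R : ℝ} {t : ℕ}

theorem dtriple_setNat_eq {x : ℕ} {e : NExp} (s : Memory) :
    DTriple A (.setNat x e) s (e.cost + 1) fun s' => s' = s.setNat x (e.eval A s) :=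
  dtriple_setNat rfl

theorem dtriple_setReal_eq {x : ℕ} {e : RExp} (s : Memory) :
    DTriple A (.setReal x e) s (e.cost + 1) fun s' => s' = s.setReal x (e.eval A s) :=
  dtriple_setReal rfl

theorem dtriple_storeReal_eq {a : ℕ} {i : NExp} {e : RExp} (s : Memory) :
    DTriple A (.storeReal a i e) s (i.cost + e.cost + 1) fun s' =>
      s' = s.storeReal a (i.eval A s) (e.eval A s) :=
  dtriple_storeReal rfl

/-- The memories agree on what the update of the ball block does not touch. -/
def SameButX (s s' : Memory) : Prop :=
  (∀ x, x ≠ 4 → s'.natVar x = s.natVar x) ∧ s'.realVar 1 = s.realVar 1 ∧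
    s'.realVar 2 = s.realVar 2 ∧ s'.realVar 5 = s.realVar 5 ∧ s'.realVar 8 = s.realVar 8 ∧
    s'.realArr 2 = s.realArr 2 ∧ s'.realArr 6 = s.realArr 6

/-- Only u_j moves, by -ηg_j/ν. Subtracting c times this change from b_j preserves the sum cu + b,
and adding the new iterate ν'u to it amounts to adding ν' to c. -/
theorem dtriple_moveX {x S g : Fin n → ℝ} {s : Memory} (h : RepX A k x S s) (j : Fin n)
    (hj : s.natVar 7 = j) (hg : g = Pi.single j (s.realVar 7)) (hη : s.realVar 1 = η) :
    DTriple A moveX s 100 fun s' =>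
      (0 < s'.realVar 3 ∧
        (∀ l, ballProj (fun j => x j - η * g j) l = s'.realVar 3 * s'.realArr 4 l) ∧
        (∀ l, S l + ballProj (fun j => x j - η * g j) l =
          s'.realVar 4 * s'.realArr 4 l + s'.realArr 5 l) ∧
        s'.realVar 6 = ∑ j : Fin n, s'.realArr 4 j ^ 2) ∧ s'.realArr 3 = s.realArr 3 ∧
        (∀ l, l ≠ (j : ℕ) → s'.realArr 4 l = s.realArr 4 l) ∧ SameButX s s' := by
  set v := s.realArr 4 j - η * s.realVar 7 / s.realVar 3 with hv
  set u := Function.update (s.realArr 4) j v with hu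
  have hν := h.scale_pos
  have hN : s.realVar 6 + (v * v - s.realArr 4 j * s.realArr 4 j) = ∑ l : Fin n, u l ^ 2 := by
    rw [hu, sum_update_sq, h.normSq]
  have hx : (fun l => x l - η * g l) = fun l : Fin n => s.realVar 3 * u l := by
    funext l
    by_cases hl : l = j
    · subst hl
      rw [hu, Function.update_self, hv, h.iterate, hg, Pi.single_eq_same]
      field_simp
    · rw [hu, Function.update_of_ne (fun h => hl (Fin.ext h)), h.iterate, hg,
        Pi.single_eq_of_ne hl]
      ring
  have hp := fun l => ballProj_smul hν (fun l : Fin n => u l) l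
  rw [← hx, ← hN] at hp
  refine DTriple.mono (DTriple.seq (dtriple_setReal_eq _) fun s₁ h₁ =>
    DTriple.seq (dtriple_setReal_eq _) fun s₂ h₂ => DTriple.seq (dtriple_storeReal_eq _) fun s₃ h₃ =>
    DTriple.seq (dtriple_storeReal_eq _) fun s₄ h₄ => DTriple.seq (τ₁ := 20)
      (R₁ := fun s' => s' = s₄.setReal 3 (if 1 < s.realVar 3 * s.realVar 3 *
        (s.realVar 6 + (v * v - s.realArr 4 j * s.realArr 4 j)) then
        1 / √(s.realVar 6 + (v * v - s.realArr 4 j * s.realArr 4 j)) else s.realVar 3))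
      ?_ fun s₅ h₅ => dtriple_setReal ?_) ?_ fun _ h => h
  · have e9 : s₁.realVar 9 = v := by simp [h₁, RExp.eval, NExp.eval, hj, hη, hv]
    have e6 : s₄.realVar 6 = s.realVar 6 + (v * v - s.realArr 4 j * s.realArr 4 j) := by
      rw [h₄, h₃, h₂]
      simp only [Memory.storeReal_realVar, Memory.setReal_realVar, if_true, RExp.eval, NExp.eval, e9]
      simp [h₁, hj]
    have e3 : s₄.realVar 3 = s.realVar 3 := by simp [h₄, h₃, h₂, h₁]
    refine DTriple.mono (DTriple.ite (τ := 10) (fun hb => DTriple.mono (dtriple_setReal ?_) ?_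
      fun _ h => h) fun hb => DTriple.mono (dtriple_skip ?_) ?_ fun _ h => h) ?_ fun _ h => h
    · simp only [Test.holds, RExp.eval, NExp.eval, e6, e3, Nat.cast_one] at hb
      rw [if_pos hb]
      simp [RExp.eval, NExp.eval, e6]
    · simp [RExp.cost, NExp.cost]
    · simp only [Test.holds, RExp.eval, NExp.eval, e6, e3, Nat.cast_one] at hb
      rw [if_neg hb, ← e3]
      simp [Memory.setReal]
    · omega
    · simp [Test.cost, RExp.cost, NExp.cost]
  · set ν' := if 1 < s.realVar 3 * s.realVar 3 *
        (s.realVar 6 + (v * v - s.realArr 4 j * s.realArr 4 j)) then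
        1 / √(s.realVar 6 + (v * v - s.realArr 4 j * s.realArr 4 j)) else s.realVar 3 with hν'
    have hν'pos : 0 < ν' := by
      rw [hν']
      split_ifs with hb
      · refine one_div_pos.2 (Real.sqrt_pos.2 ?_)
        by_contra hneg
        nlinarith [mul_pos hν hν]
      · exact hν
    subst h₅ h₄ h₃ h₂ h₁
    refine ⟨⟨?_, ?_, ?_, ?_⟩, ?_, ?_, ?_, ?_, ?_, ?_, ?_, ?_, ?_⟩
    · simpa [RExp.eval, NExp.eval] using hν'pos
    · intro l
      simp [RExp.eval, NExp.eval, hj, hη, ← hv, ← hu, hp]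
    · intro l
      rw [hp, h.total]
      simp [RExp.eval, NExp.eval, hj, hη, ← hv, ← hu]
      by_cases hl : l = j
      · subst hl
        rw [hu, Function.update_self, Function.update_self]
        ring
      · have hl' : (l : ℕ) ≠ j := fun h => hl (Fin.ext h)
        rw [hu, Function.update_of_ne hl', Function.update_of_ne hl']
        ring
    · simp [RExp.eval, NExp.eval, hj, hη, ← hv, ← hu, hN]
    · simp
    · intro l hl
      simp [NExp.eval, hj, hl]
    all_goals simp
  · simp [RExp.cost, NExp.cost]

/-- Under the Frobenius scheme the leaves do not depend on x. Otherwise leaf j is a column quantity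
times u_j², and only the path above it has to be recomputed. -/
theorem dtriple_moveCol {u : ℕ → ℝ} {s : Memory} (hp : RepParams m n k η R t s) (j : Fin n)
    (hj : s.natVar 7 = j) (htree : SumTree n 1 ∅ (s.realArr 3))
    (hleaf : ∀ l : Fin n, s.realArr 3 (n + l) = colWeight A k (fun l => u l) l)
    (hu : ∀ l, l ≠ (j : ℕ) → s.realArr 4 l = u l) :
    DTriple A moveCol s (21 * levels n + 50) fun s' =>
      (∀ x, x ≠ 4 → s'.natVar x = s.natVar x) ∧ (∀ x, x ≠ 9 → s'.realVar x = s.realVar x) ∧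
      (∀ b, b ≠ 3 → s'.realArr b = s.realArr b) ∧ SumTree n 1 ∅ (s'.realArr 3) ∧
      ∀ l : Fin n, s'.realArr 3 (n + l) = colWeight A k (fun l => s.realArr 4 l) l := by
  have hcode := hp.code
  by_cases hk : k = .frobenius
  · subst hk
    refine DTriple.mono (DTriple.ite (τ := 1) (fun hb => ?_) fun _ => dtriple_skip ?_) ?_
      fun _ h => h
    · simp [Test.holds, NExp.eval, hcode, Scheme.code] at hb
    · exact ⟨fun _ _ => rfl, fun _ _ => rfl, fun _ _ => rfl, htree, hleaf⟩
    · simp [Test.cost, NExp.cost]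
  · obtain ⟨c, hc, hc'⟩ : ∃ c : ℝ, (∀ x : Fin n → ℝ, colWeight A k x j = c * x j ^ 2) ∧
        DTriple A (.ite (.natLt (.var 2) (.lit 2)) (.setReal 9 (.ofNat (.colNnz (.var 7))))
          (.setReal 9 (.colNorm .one (.var 7)))) s 10 fun s' => s' = s.setReal 9 c := by
      cases k
      · exact absurd rfl hk
      · refine ⟨colNnz A j, fun x => rfl, DTriple.mono (DTriple.ite (τ := 5) (fun _ =>
          DTriple.mono (dtriple_setReal ?_) ?_ fun _ h => h) fun hb => ?_) ?_ fun _ h => h⟩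
        · simp [RExp.eval, NExp.eval, hj]
        · simp [RExp.cost, NExp.cost]
        · simp [Test.holds, NExp.eval, hcode, Scheme.code] at hb
        · simp [Test.cost, NExp.cost]
      · refine ⟨colL1 A j, fun x => rfl, DTriple.mono (DTriple.ite (τ := 5) (fun hb => ?_) fun _ =>
          DTriple.mono (dtriple_setReal ?_) ?_ fun _ h => h) ?_ fun _ h => h⟩
        · simp [Test.holds, NExp.eval, hcode, Scheme.code] at hb
        · simp [RExp.eval, NExp.eval, hj, colNorm]
        · simp [RExp.cost, NExp.cost]
        · simp [Test.cost, NExp.cost]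
    have hw : ∀ l : Fin n, l ≠ j → colWeight A k (fun l => s.realArr 4 l) l =
        colWeight A k (fun l => u l) l := by
      intro l hl
      have := hu l fun h => hl (Fin.ext h)
      cases k <;> simp [colWeight, this]
    refine DTriple.mono (DTriple.ite (τ := 21 * levels n + 43) (fun _ => DTriple.mono
      (DTriple.seq hc' fun s₁ h₁ => DTriple.seq (dtriple_storeReal_eq _) fun s₂ h₂ =>
        DTriple.seq (dtriple_setNat_eq _) fun s₃ h₃ => DTriple.mono
          (dtriple_repair (M := n) ?_ ?_) le_rfl fun s₄ h₄ => ?_) ?_ fun _ h => h) fun hb => ?_) ?_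
      fun _ h => h
    · subst h₃ h₂ h₁
      simp [NExp.eval, hp.cols, hj]
      omega
    · subst h₃ h₂ h₁
      intro l hl hln hne
      simp [NExp.eval, hp.cols, hj] at hne ⊢
      rw [Function.update_of_ne (by omega), Function.update_of_ne (by omega),
        Function.update_of_ne (by omega)]
      exact htree l hl hln (by simp)
    · obtain ⟨⟨f1, f2, f3, f4⟩, f5⟩ := h₄
      refine ⟨fun x hx => ?_, fun x hx => ?_, fun b hb => ?_, f5, fun l => ?_⟩
      · rw [f2 x hx]
        subst h₃ h₂ h₁
        simp [hx]
      · rw [f1]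
        subst h₃ h₂ h₁
        simp [hx]
      · rw [f3 b hb]
        subst h₃ h₂ h₁
        simp [hb]
      · rw [f4 _ (by omega)]
        subst h₃ h₂ h₁
        simp only [Memory.setNat_realArr, Memory.storeReal_realArr, if_true, NExp.eval, RExp.eval,
          Memory.setReal_realArr, Memory.setReal_natVar, Memory.setReal_realVar, hp.cols, hj]
        by_cases hl : l = j
        · subst hl
          rw [Function.update_self, hc, sq]
        · rw [Function.update_of_ne, hleaf, hw l hl]
          exact fun h => hl (Fin.ext (Nat.add_left_cancel h))
    · simp [RExp.cost, NExp.cost]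
      omega
    · have : k.code ≠ 0 := by cases k <;> simp_all [Scheme.code]
      simp [Test.holds, NExp.eval, hcode] at hb
      omega
    · simp [Test.cost, NExp.cost]
      omega

/-- Unsampled coordinates are multiplied by exp 0 = 1, so a single leaf changes. The new
normalization W appears at the root after the repair, and adding the new iterate to the sum amounts
to adding 1/W to its scalar. -/
theorem dtriple_moveY {y S g : Fin m → ℝ} {s : Memory} (hp : RepParams m n k η R t s)
    (h : RepY y S s) (i : Fin m) (hi : s.natVar 8 = i) (hg : g = Pi.single i (s.realVar 8)) :
    DTriple A moveY s (21 * levels m + 100) fun s' =>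
      RepY (mwu y fun i => trunc (η * g i)) (fun l => S l + mwu y (fun i => trunc (η * g i)) l) s' ∧
      (∀ x, x ≠ 4 → s'.natVar x = s.natVar x) ∧
      (∀ x, x ≠ 5 → x ≠ 9 → s'.realVar x = s.realVar x) ∧
      ∀ b, b ≠ 2 → b ≠ 6 → s'.realArr b = s.realArr b := by
  set c := trunc (η * s.realVar 8) with hc
  set w := s.realArr 2 (m + i) * Real.exp (-c) with hw
  have hrows := hp.rows
  have heta := hp.eta
  refine DTriple.mono (DTriple.seq (dtriple_setReal_eq _) fun s₁ h₁ =>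
    DTriple.seq (τ₁ := 30) (R₁ := fun s' => s' = s₁.setReal 9 c) ?_ fun s₂ h₂ =>
    DTriple.seq (dtriple_setReal_eq _) fun s₃ h₃ => DTriple.seq (dtriple_storeReal_eq _) fun s₄ h₄ =>
    DTriple.seq (dtriple_storeReal_eq _) fun s₅ h₅ => DTriple.seq (dtriple_setNat_eq _) fun s₆ h₆ =>
    DTriple.seq (dtriple_repair (M := m) ?_ ?_) fun s₇ h₇ => dtriple_setReal ?_) ?_ fun _ h => h
  · have e9 : s₁.realVar 9 = η * s.realVar 8 := by simp [h₁, RExp.eval, heta]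
    refine DTriple.mono (DTriple.ite (τ := 20) (fun hb => DTriple.mono (dtriple_setReal ?_) ?_
      fun _ h => h) fun hb => DTriple.mono (DTriple.ite (τ := 10) (fun hb' => DTriple.mono
      (dtriple_setReal ?_) ?_ fun _ h => h) fun hb' => DTriple.mono (dtriple_skip ?_) ?_
      fun _ h => h) ?_ fun _ h => h) ?_ fun _ h => h
    all_goals try simp only [Test.holds, RExp.eval, NExp.eval, e9, Nat.cast_one] at hb
    all_goals try simp only [Test.holds, RExp.eval, NExp.eval, e9, Nat.cast_one, Nat.cast_zero,
      zero_sub] at hb'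
    all_goals try simp only [RExp.eval, NExp.eval, Nat.cast_one, Nat.cast_zero, zero_sub]
    · rcases trunc_cases (η * s.realVar 8) with ⟨h, e⟩ | ⟨h, e⟩ | ⟨h, h', e⟩
      · rw [hc, e]
      · linarith
      · linarith
    · simp [RExp.cost, NExp.cost]
    · rcases trunc_cases (η * s.realVar 8) with ⟨h, e⟩ | ⟨h, e⟩ | ⟨h, h', e⟩
      · linarith
      · rw [hc, e]
      · linarith
    · simp [RExp.cost, NExp.cost]
    · rcases trunc_cases (η * s.realVar 8) with ⟨h, e⟩ | ⟨h, e⟩ | ⟨h, h', e⟩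
      · exact absurd h hb
      · exact absurd h hb'
      · rw [hc, e, ← e9]
        simp [Memory.setReal]
    · omega
    · simp [Test.cost, RExp.cost, NExp.cost]
    · simp [Test.cost, RExp.cost, NExp.cost]
  · subst h₆ h₅ h₄ h₃ h₂ h₁
    simp [NExp.eval, hrows, hi]
    omega
  · subst h₆ h₅ h₄ h₃ h₂ h₁
    intro l hl hln hne
    simp [NExp.eval, hrows, hi] at hne ⊢
    rw [Function.update_of_ne (by omega), Function.update_of_ne (by omega),
      Function.update_of_ne (by omega)]
    exact h.tree l hl hln (by simp)
  · obtain ⟨⟨f1, f2, f3, f4⟩, f5⟩ := h₇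
    have r9 : s₃.realVar 9 = w := by
      subst h₃ h₂ h₁
      simp [RExp.eval, NExp.eval, hrows, hi, hw]
    have a2 : s₆.realArr 2 = Function.update (s.realArr 2) (m + i) w := by
      rw [h₆, h₅, h₄]
      simp only [Memory.setNat_realArr, Memory.storeReal_realArr, if_true, RExp.eval, NExp.eval,
        Memory.storeReal_natVar, Memory.storeReal_realVar, r9]
      subst h₃ h₂ h₁
      simp [hrows, hi]
    have a6 : s₆.realArr 6 = Function.update (s.realArr 6) i
        (s.realArr 6 i - s.realVar 5 * (w - s.realArr 2 (m + i))) := by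
      rw [h₆, h₅, h₄]
      simp only [Memory.setNat_realArr, Memory.storeReal_realArr, if_true, RExp.eval, NExp.eval,
        r9]
      subst h₃ h₂ h₁
      simp [hrows, hi]
    have hwt : ∀ l : Fin m, s₇.realArr 2 (m + l) =
        s.realArr 2 (m + l) * Real.exp (-trunc (η * g l)) := by
      intro l
      rw [f4 _ (by omega), a2]
      by_cases hl : l = i
      · subst hl
        rw [Function.update_self, hw, hg, Pi.single_eq_same]
      · rw [Function.update_of_ne (fun h => hl (Fin.ext (Nat.add_left_cancel h))), hg,
          Pi.single_eq_of_ne hl]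
        simp [trunc]
    have hroot : s₇.realArr 2 1 = ∑ l : Fin m, s.realArr 2 (m + l) *
        Real.exp (-trunc (η * g l)) := by
      rw [f5.root_eq (Nat.pos_of_ne_zero (NeZero.ne m))]
      exact Finset.sum_congr rfl fun l _ => hwt l
    have hmw : ∀ l, mwu y (fun i => trunc (η * g i)) l =
        s₇.realArr 2 (m + l) / s₇.realArr 2 1 := fun l => by
      rw [mwu_div h.root_pos.ne' h.iterate, hroot, hwt]
    have r5 : s₆.realVar 5 = s.realVar 5 := by
      subst h₆ h₅ h₄ h₃ h₂ h₁
      simp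
    refine ⟨⟨fun l => ?_, fun l => ?_, fun l => ?_, ?_⟩, fun x hx => ?_, fun x hx hx' => ?_,
      fun b hb hb' => ?_⟩
    · rw [Memory.setReal_realArr, hwt]
      exact mul_pos (h.weight_pos l) (Real.exp_pos _)
    · rw [Memory.setReal_realArr, hmw]
    · simp only [RExp.eval, NExp.eval, Memory.setReal_realVar, Memory.setReal_realArr, if_true,
        hmw, h.total, f1, r5, Nat.cast_one]
      rw [f3 6 (by norm_num), a6, add_mul, one_div_mul_eq_div, f4 _ (by omega), a2]
      by_cases hl : l = i
      · subst hl
        rw [Function.update_self, Function.update_self]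
        ring
      · rw [Function.update_of_ne (fun h => hl (Fin.ext (Nat.add_left_cancel h))),
          Function.update_of_ne (fun h => hl (Fin.ext h))]
        ring
    · exact f5
    · rw [Memory.setReal_natVar, f2 x hx]
      subst h₆ h₅ h₄ h₃ h₂ h₁
      simp [hx]
    · rw [Memory.setReal_realVar, if_neg hx, f1]
      subst h₆ h₅ h₄ h₃ h₂ h₁
      simp [hx']
    · rw [Memory.setReal_realArr, f3 b hb]
      subst h₆ h₅ h₄ h₃ h₂ h₁
      simp [hb, hb']
  · simp [RExp.cost, NExp.cost]
    omega

end Updates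

/-! ### The main loop -/

/-- One iteration. -/
def iteration : Prog :=
  .seq sampleGrad (.seq moveX (.seq moveCol (.seq moveY (.setNat 3 (.add (.var 3) (.lit 1))))))

/-- The main loop. -/
def mainLoop : Prog := .loop (.realLt (.ofNat (.var 3)) (.var 2)) iteration

section MainLoop

variable {m n : ℕ} [NeZero m] [NeZero n] {A : Matrix (Fin m) (Fin n) ℝ} {k : Scheme} {η R : ℝ}

/-- The transition kernel of `iterateLaw`. -/
def iterKernel (A : Matrix (Fin m) (Fin n) ℝ) (k : Scheme) (η : ℝ) (p : Point n m × Point n m) :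
    PMF (Point n m × Point n m) :=
  (estimatorLaw A k p.1).map fun g => (proxStep η p.1 g, p.2 + proxStep η p.1 g)

/-- The law after `d` transitions from `p`. -/
def iterFrom (A : Matrix (Fin m) (Fin n) ℝ) (k : Scheme) (η : ℝ) :
    ℕ → Point n m × Point n m → PMF (Point n m × Point n m)
  | 0, p => PMF.pure p
  | d + 1, p => (iterKernel A k η p).bind (iterFrom A k η d)

/-- Regroups the chain so that the first transition is peeled off, as in the execution of a loop. -/
theorem iterateLaw_bind_iterFrom (d t : ℕ) :
    (iterateLaw A k η t).bind (iterFrom A k η d) = iterateLaw A k η (t + d) := by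
  induction d generalizing t with
  | zero => exact PMF.bind_pure _
  | succ d ih =>
    rw [show t + (d + 1) = t + 1 + d by ring, ← ih (t + 1), iterateLaw, PMF.bind_bind]
    rfl

theorem iterFrom_start (T : ℕ) :
    iterFrom A k η T (startPoint n m, startPoint n m) = iterateLaw A k η T := by
  rw [← Nat.zero_add T, ← iterateLaw_bind_iterFrom, iterateLaw, PMF.pure_bind, Nat.zero_add]

/-- Each of the two trees is descended once and repaired at most once, at 21 units per level; hence
the factor 42. -/
theorem triple_iteration (hrow : ∀ i, ∃ j, A i j ≠ 0) (hcol : ∀ j, ∃ i, A i j ≠ 0) {t : ℕ}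
    {p : Point n m × Point n m} {s : Memory} (h : Rep A k η R t p s) :
    Triple A iteration s (42 * (levels m + levels n) + 420) (iterKernel A k η p)
      (Rep A k η R (t + 1)) := by
  have hpos : ∀ i, 0 < p.1.2 i := fun i => by
    rw [h.repY.iterate]
    exact div_pos (h.repY.weight_pos i) h.repY.root_pos
  refine Triple.mono (Triple.map _ (Triple.seq_dtriple (τ₂ := 21 * levels m + 21 * levels n + 265)
    (R₂ := fun g s' => Rep A k η R (t + 1) (proxStep η p.1 g, p.2 + proxStep η p.1 g) s')
    (triple_sampleGrad hrow hcol h) fun g _ s₁ h₁ => ?_) fun _ _ _ h => h) ?_ fun _ _ _ h => h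
  · obtain ⟨hR, j, i, hj, hi, hg⟩ := h₁
    refine DTriple.mono (DTriple.seq (dtriple_moveX hR.repX j hj (congrArg Prod.fst hg)
      hR.params.eta) fun s₂ h₂ => DTriple.seq (dtriple_moveCol (k := k) (η := η) (R := R) (t := t)
      (u := s₁.realArr 4) ?_ j ?_ ?_ ?_ ?_) fun s₃ h₃ => DTriple.seq
      (dtriple_moveY (k := k) (η := η) (R := R) (t := t) (n := n) (g := g.2) ?_ (hR.repY.congr ?_ ?_ ?_)
        i ?_ ?_) fun s₄ h₄ => dtriple_setNat ?_) ?_ fun _ h => h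
    all_goals try obtain ⟨b1, b2, b3, c1, c2, c3, c4, c5, c6, c7⟩ := h₂
    · exact hR.params.congr (fun x hx => c1 x (by omega)) c2 c3
    · rw [c1 7 (by norm_num), hj]
    · rw [b2]; exact hR.repX.tree
    · rw [b2]; exact hR.repX.leaf
    · exact b3
    all_goals try obtain ⟨d1, d2, d3, d4, d5⟩ := h₃
    · exact (hR.params.congr (fun x hx => c1 x (by omega)) c2 c3).congr
        (fun x hx => d1 x (by omega)) (d2 1 (by norm_num)) (d2 2 (by norm_num))
    · rw [d2 5 (by norm_num), c4]
    · rw [d3 2 (by norm_num), c6]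
    · rw [d3 6 (by norm_num), c7]
    · rw [d1 8 (by norm_num), c1 8 (by norm_num), hi]
    · rw [d2 8 (by norm_num), c5]
      exact congrArg Prod.snd hg
    · obtain ⟨e1, e2, e3, e4⟩ := h₄
      have fn : ∀ x, x ≠ 4 → s₄.natVar x = s₁.natVar x := fun x hx => by
        rw [e2 x hx, d1 x hx, c1 x hx]
      rw [proxStep_eq η p.1 g hpos]
      refine ⟨⟨?_, ?_, ?_, ?_, ?_, ?_⟩, ⟨?_, fun l => ?_, fun l => ?_, ?_, ?_, fun l => ?_⟩,
        e1.congr rfl rfl rfl⟩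
      · simp [fn, hR.params.rows]
      · simp [fn, hR.params.cols]
      · simp [fn, hR.params.code]
      · simp [NExp.eval, fn, hR.params.count]
      · simp [e3, d2, c2, hR.params.eta]
      · simp [e3, d2, c3, hR.params.bound]
      · simpa [e3, d2] using b1.1
      · simp [e3, e4, d2, d3, ← b1.2.1 l]
      · have := b1.2.2.1 l
        simp only [Prod.fst_add, Pi.add_apply, this]
        simp [e3, e4, d2, d3]
      · simp [e3, e4, d2, d3, b1.2.2.2]
      · simpa [e4] using d4
      · simp [e4, d3, d5]
    · simp [NExp.cost]
      omega
  · omega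

/-- The counter is compared with the real bound itself, so the loop makes ⌈R⌉ rounds although the
machine has no rounding operation. -/
theorem triple_mainLoop (hrow : ∀ i, ∃ j, A i j ≠ 0) (hcol : ∀ j, ∃ i, A i j ≠ 0)
    {s : Memory} (h : Rep A k η R 0 (startPoint n m, startPoint n m) s) :
    Triple A mainLoop s (⌈R⌉₊ * (42 * (levels m + levels n) + 430) + 10)
      (iterateLaw A k η ⌈R⌉₊) (Rep A k η R ⌈R⌉₊) := by
  rw [← iterFrom_start]
  refine Triple.mono (Triple.loop (κ := iterFrom A k η)
    (I := fun d p s => ∃ t, t + d = ⌈R⌉₊ ∧ Rep A k η R t p s)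
    (τ := 42 * (levels m + levels n) + 420) ?_ ?_ ⌈R⌉₊ _ s ⟨0, by omega, h⟩) ?_ fun _ _ _ h => h
  · rintro d p s ⟨t, ht, hR⟩ hb
    simp only [Test.holds, RExp.eval, NExp.eval, hR.params.count, hR.params.bound] at hb
    have : ⌈R⌉₊ ≤ t := Nat.ceil_le.2 (not_lt.1 hb)
    obtain rfl : d = 0 := by omega
    obtain rfl : t = ⌈R⌉₊ := by omega
    exact ⟨p, rfl, hR⟩
  · rintro d p s ⟨t, ht, hR⟩ hb
    simp only [Test.holds, RExp.eval, NExp.eval, hR.params.count, hR.params.bound] at hb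
    have := Nat.lt_ceil.2 hb
    refine ⟨d - 1, by omega, iterKernel A k η p, (triple_iteration hrow hcol hR).mono le_rfl
      fun _ _ _ h => ⟨t + 1, by omega, h⟩, ?_⟩
    obtain ⟨d', rfl⟩ : ∃ d', d = d' + 1 := ⟨d - 1, by omega⟩
    rfl
  · simp only [Test.cost, RExp.cost, NExp.cost]
    nlinarith

end MainLoop

/-! ### Initialization and output -/

/-- For each value of variable `4` below variable `v`, store `e` in the cell `ix` of the
array `a`. -/
def fill (a v : ℕ) (ix : NExp) (e : RExp) : Prog :=
  .seq (.setNat 4 (.lit 0)) (.loop (.natLt (.var 4) (.var v))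
    (.seq (.storeReal a ix e) (.setNat 4 (.add (.var 4) (.lit 1)))))

/-- The memories agree, except for the scratch variable `4` and the array `a`. -/
def SameButArr (a : ℕ) (s s' : Memory) : Prop :=
  s'.realVar = s.realVar ∧ (∀ x, x ≠ 4 → s'.natVar x = s.natVar x) ∧
    ∀ b, b ≠ a → s'.realArr b = s.realArr b

theorem SameButArr.refl (a : ℕ) (s : Memory) : SameButArr a s s :=
  ⟨rfl, fun _ _ => rfl, fun _ _ => rfl⟩

theorem SameButArr.trans {a : ℕ} {s s' s'' : Memory} (h : SameButArr a s s')
    (h' : SameButArr a s' s'') : SameButArr a s s'' :=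
  ⟨h'.1.trans h.1, fun x hx => (h'.2.1 x hx).trans (h.2.1 x hx),
    fun b hb => (h'.2.2 b hb).trans (h.2.2 b hb)⟩

theorem SameButTree.sameButArr {a M : ℕ} {s s' : Memory} (h : SameButTree a M s s') :
    SameButArr a s s' :=
  ⟨h.1, h.2.1, h.2.2.1⟩

/-- `‖A‖_F²` -/
def constFrob : RExp := .mul .frob .frob

/-- `rcs · max_i ‖A_{i:}‖₂²` -/
def constSupport : RExp := .mul (.ofNat .rcs) (.mul (.maxRowNorm .two) (.maxRowNorm .two))

/-- `max_i ‖A_{i:}‖₁ · max_j ‖A_{:j}‖₁` -/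
def constColumnAbs : RExp := .mul (.maxRowNorm .one) (.maxColNorm .one)

/-- Choose the scheme. -/
def chooseScheme : Prog :=
  .ite (.realLt constSupport constFrob)
    (.ite (.realLt constColumnAbs constSupport)
      (.seq (.setNat 2 (.lit 2)) (.setReal 9 constColumnAbs))
      (.seq (.setNat 2 (.lit 1)) (.setReal 9 constSupport)))
    (.ite (.realLt constColumnAbs constFrob)
      (.seq (.setNat 2 (.lit 2)) (.setReal 9 constColumnAbs))
      (.seq (.setNat 2 (.lit 0)) (.setReal 9 constFrob)))

/-- Set the step size, the bound for the number of iterations, and the scalars representing the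
start point. -/
def initScalars : Prog :=
  .seq (.setReal 1 (.div (.var 0) (.mul (.ofNat (.lit 9))
    (.add (.mul (.maxRowNorm .one) (.maxRowNorm .one)) (.var 9)))))
  (.seq (.setReal 2 (.div (.mul (.ofNat (.lit 6))
    (.add (.div (.ofNat (.lit 1)) (.ofNat (.lit 2))) (.log (.ofNat (.var 0)))))
    (.mul (.var 1) (.var 0))))
  (.seq (.setReal 3 (.ofNat (.lit 1))) (.seq (.setReal 4 (.ofNat (.lit 1)))
    (.setReal 5 (.div (.ofNat (.lit 1)) (.ofNat (.var 0)))))))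

/-- Set up the row tree. -/
def initRows : Prog := .seq (fill 2 0 (.add (.var 0) (.var 4)) (.ofNat (.lit 1))) (build 2 0)

/-- Set up the column tree. -/
def initCols : Prog :=
  .seq (.ite (.natLt (.var 2) (.lit 1)) (fill 3 1 (.add (.var 1) (.var 4))
    (.mul (.colNorm .two (.var 4)) (.colNorm .two (.var 4)))) .skip) (build 3 1)

/-- The initialization. -/
def initialization : Prog := .seq chooseScheme (.seq initScalars (.seq initRows initCols))

/-- Write the output. -/
def writeOutput : Prog :=
  .seq (fill 0 1 (.var 4) (.div (.add (.mul (.var 4) (.arr 4 (.var 4))) (.arr 5 (.var 4)))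
    (.add (.ofNat (.var 3)) (.ofNat (.lit 1)))))
  (fill 1 0 (.var 4) (.div (.add (.mul (.var 5) (.arr 2 (.add (.var 0) (.var 4))))
    (.arr 6 (.var 4))) (.add (.ofNat (.var 3)) (.ofNat (.lit 1)))))

/-- Stochastic coordinate mirror descent. -/
def mirrorProg : Prog := .seq initialization (.seq mainLoop writeOutput)

section InitOutput

variable {m n : ℕ} [NeZero m] [NeZero n] {A : Matrix (Fin m) (Fin n) ℝ}

theorem dtriple_fill {a v M : ℕ} {ix : NExp} {e : RExp} {s : Memory} {f : ℕ → ℕ} {val : ℕ → ℝ}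
    (hf : Function.Injective f) (hv : v ≠ 4) (hM : s.natVar v = M)
    (hix : ∀ s', SameButArr a s s' → ix.eval A s' = f (s'.natVar 4))
    (he : ∀ s', SameButArr a s s' → s'.natVar 4 < M → e.eval A s' = val (s'.natVar 4)) :
    DTriple A (fill a v ix e) s (M * (ix.cost + e.cost + 10) + 10) fun s' =>
      SameButArr a s s' ∧ ∀ i < M, s'.realArr a (f i) = val i := by
  refine DTriple.mono (τ := 1 + 2 + (M * (3 + 1 + (1 + (ix.cost + e.cost + 1) + 4)) + (3 + 1)))
    ?_ (by nlinarith) (fun _ h => h)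
  refine DTriple.seq (dtriple_setNat (R := fun s' => SameButArr a s s' ∧ s'.natVar 4 = 0) ?_)
    fun s' hs' => ?_
  · refine ⟨⟨rfl, fun x hx => ?_, fun _ _ => rfl⟩, ?_⟩
    · simp [hx]
    · simp [NExp.eval]
  refine DTriple.loop (I := fun d s' => SameButArr a s s' ∧ s'.natVar 4 + d = M ∧
    ∀ i < s'.natVar 4, s'.realArr a (f i) = val i) ?_ ?_ M s' ⟨hs'.1, by omega, by simp [hs'.2]⟩
  · rintro d s' ⟨h1, h2, h3⟩ hb
    simp only [Test.holds, NExp.eval, h1.2.1 v hv, hM] at hb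
    exact ⟨h1, fun i hi => h3 i (by omega)⟩
  · rintro d s' ⟨h1, h2, h3⟩ hb
    simp only [Test.holds, NExp.eval, h1.2.1 v hv, hM] at hb
    refine ⟨d - 1, by omega, DTriple.seq (dtriple_storeReal_eq _) fun s'' hs'' => dtriple_setNat ?_⟩
    subst hs''
    refine ⟨⟨h1.1, fun x hx => ?_, fun b hb => ?_⟩, ?_, fun i hi => ?_⟩
    · simp [hx, h1.2.1 x hx]
    · simp [hb, h1.2.2 b hb]
    · simp [NExp.eval]
      omega
    · simp only [NExp.eval, Memory.setNat_natVar, if_true, Memory.storeReal_natVar] at hi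
      simp only [Memory.setNat_realArr, Memory.storeReal_realArr, if_true, hix s' h1, he s' h1 hb]
      by_cases hi' : i = s'.natVar 4
      · rw [hi', Function.update_self]
      · rw [Function.update_of_ne (fun h => hi' (hf h))]
        exact h3 i (by omega)

/-- The oracles return maximal norms, whereas V₂ and L are defined by maximal squared norms. -/
theorem iSup_sq {l : ℕ} [NeZero l] {f : Fin l → ℝ} (h0 : ∀ i, 0 ≤ f i) :
    ⨆ i, f i ^ 2 = (⨆ i, f i) * ⨆ i, f i := by
  rw [← sq]
  refine le_antisymm (ciSup_le fun i => pow_le_pow_left₀ (h0 i) (le_iSup_fin f i) 2) ?_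
  obtain ⟨i, hi⟩ := exists_eq_ciSup_of_finite (f := f)
  rw [← hi]
  exact le_iSup_fin (fun i => f i ^ 2) i

/-- The scheme chosen by the program. -/
def bestScheme {m n : ℕ} (A : Matrix (Fin m) (Fin n) ℝ) : Scheme :=
  open Classical in
  if schemeConst A .support < schemeConst A .frobenius then
    if schemeConst A .columnAbs < schemeConst A .support then .columnAbs else .support
  else if schemeConst A .columnAbs < schemeConst A .frobenius then .columnAbs else .frobenius

omit [NeZero m] [NeZero n] in
theorem isBest_bestScheme : IsBest A (bestScheme A) := by
  intro k
  unfold bestScheme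
  split_ifs <;> cases k <;> linarith

omit [NeZero m] [NeZero n] in
theorem eval_constFrob (s : Memory) : constFrob.eval A s = schemeConst A .frobenius := by
  simp [constFrob, RExp.eval, schemeConst, sq]

omit [NeZero n] in
theorem eval_constSupport (s : Memory) : constSupport.eval A s = schemeConst A .support := by
  simp [constSupport, RExp.eval, NExp.eval, schemeConst, iSup_sq (rowL2_nonneg A), rowNorm]

omit [NeZero m] [NeZero n] in
theorem eval_constColumnAbs (s : Memory) : constColumnAbs.eval A s = schemeConst A .columnAbs := by
  simp [constColumnAbs, RExp.eval, schemeConst, rowNorm, colNorm]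

theorem dtriple_chooseScheme (s : Memory) : DTriple A chooseScheme s 60 fun s' =>
    s' = (s.setNat 2 (bestScheme A).code).setReal 9 (schemeConst A (bestScheme A)) := by
  have leaf : ∀ (c : ℕ) (e : RExp) (k : Scheme), e.cost ≤ 8 → k.code = c →
      (∀ s, e.eval A s = schemeConst A k) → k = bestScheme A →
      DTriple A (.seq (.setNat 2 (.lit c)) (.setReal 9 e)) s 20 fun s' =>
        s' = (s.setNat 2 (bestScheme A).code).setReal 9 (schemeConst A (bestScheme A)) := by
    rintro c e k hc rfl he rfl
    refine DTriple.mono (DTriple.seq (dtriple_setNat_eq _) fun s' hs' => dtriple_setReal ?_) ?_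
      fun _ h => h
    · rw [he, hs']
      rfl
    · simp [NExp.cost]
      omega
  refine DTriple.mono (DTriple.ite (τ := 40)
    (fun h => DTriple.mono (DTriple.ite (τ := 20) (fun h' => leaf 2 _ .columnAbs ?_ rfl
      eval_constColumnAbs ?_) fun h' => leaf 1 _ .support ?_ rfl eval_constSupport ?_) ?_
      fun _ h => h)
    (fun h => DTriple.mono (DTriple.ite (τ := 20) (fun h' => leaf 2 _ .columnAbs ?_ rfl
      eval_constColumnAbs ?_) fun h' => leaf 0 _ .frobenius ?_ rfl eval_constFrob ?_) ?_
      fun _ h => h)) ?_ fun _ h => h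
  all_goals try simp [RExp.cost, NExp.cost, Test.cost, constFrob, constSupport, constColumnAbs]
  all_goals
    simp only [Test.holds, eval_constFrob, eval_constSupport, eval_constColumnAbs] at h h'
    simp only [bestScheme, h, h', if_true, if_false]

theorem dtriple_initScalars {ε : ℝ} {s : Memory}
    (h : s = ((mirrorProg.start m n ε).mem.setNat 2 (bestScheme A).code).setReal 9
      (schemeConst A (bestScheme A))) :
    DTriple A initScalars s 60 fun s' => RepParams m n (bestScheme A) (stepSize A ε)
      (6 * setupRange m / (stepSize A ε * ε)) 0 s' ∧ s'.realVar 3 = 1 ∧ s'.realVar 4 = 1 ∧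
      s'.realVar 5 = 1 / m ∧ s'.realVar 6 = 0 ∧ s'.realArr = fun _ _ => 0 := by
  refine DTriple.mono (DTriple.seq (dtriple_setReal_eq _) fun s₁ h₁ => DTriple.seq
    (dtriple_setReal_eq _) fun s₂ h₂ => DTriple.seq (dtriple_setReal_eq _) fun s₃ h₃ =>
    DTriple.seq (dtriple_setReal_eq _) fun s₄ h₄ => dtriple_setReal ?_) ?_ fun _ h => h
  · have hη : ε / (9 * ((⨆ i, rowL1 A i) * (⨆ i, rowL1 A i) + schemeConst A (bestScheme A))) =
        stepSize A ε := by
      rw [stepSize, Lco_sq A isBest_bestScheme, iSup_sq (rowL1_nonneg A)]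
    subst h₄ h₃ h₂ h₁ h
    refine ⟨⟨?_, ?_, ?_, ?_, ?_, ?_⟩, ?_, ?_, ?_, ?_, ?_⟩ <;>
      simp [RExp.eval, NExp.eval, Prog.start, rowNorm, hη, setupRange]
  · simp [RExp.cost, NExp.cost]

/-- The start point is u = 0 with ν = 1, and w = 1 with W = m. Memory is initially zero, so u and
both correction arrays are already right, and so are the column leaves of the schemes depending on
x; only the Frobenius leaves are filled in. -/
theorem dtriple_initialization {ε : ℝ} :
    DTriple A initialization (mirrorProg.start m n ε).mem (100 * m + 100 * n + 200)
      (Rep A (bestScheme A) (stepSize A ε) (6 * setupRange m / (stepSize A ε * ε)) 0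
        (startPoint n m, startPoint n m)) := by
  have hm : (0 : ℝ) < m := by exact_mod_cast Nat.pos_of_ne_zero (NeZero.ne m)
  set k := bestScheme A with hk
  refine DTriple.mono (DTriple.seq (dtriple_chooseScheme _) fun s₁ h₁ => DTriple.seq
    (dtriple_initScalars h₁) fun s₂ h₂ => DTriple.seq (R₁ := fun s' => SameButArr 2 s₂ s' ∧
      SumTree m 1 ∅ (s'.realArr 2) ∧ ∀ i : Fin m, s'.realArr 2 (m + i) = 1)
      (τ₁ := 40 * m + 30) ?_ fun s₃ h₃ => DTriple.seq (τ₁ := 20 * n + 20)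
      (R₁ := fun s' => SameButArr 3 s₃ s' ∧
        ∀ j : Fin n, s'.realArr 3 (n + j) = colWeight A k (fun _ => 0) j)
      ?_ fun s₄ h₄ => DTriple.mono
      (dtriple_build (M := n) ?_) le_rfl fun s₅ h₅ => ?_) ?_ fun _ h => h
  · refine DTriple.mono (DTriple.seq (dtriple_fill (f := fun i => m + i) (val := fun _ => 1)
      (M := m) (fun i j h => Nat.add_left_cancel h) (by norm_num) h₂.1.rows (fun s' hs' => ?_)
      fun s' hs' _ => ?_) fun s₃ h₃ => DTriple.mono (dtriple_build (M := m) ?_) le_rfl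
      fun s₄ h₄ => ?_) ?_ fun _ h => h
    · simp [NExp.eval, hs'.2.1 0, h₂.1.rows]
    · simp [RExp.eval, NExp.eval]
    · rw [h₃.1.2.1 0 (by norm_num), h₂.1.rows]
    · refine ⟨h₃.1.trans h₄.1.sameButArr, h₄.2, fun i => ?_⟩
      rw [h₄.1.2.2.2 _ (by omega)]
      exact h₃.2 i i.2
    · simp [NExp.cost, RExp.cost]
      omega
  · have hn : s₃.natVar 1 = n := by rw [h₃.1.2.1 1 (by norm_num), h₂.1.cols]
    have hcode : s₃.natVar 2 = k.code := by rw [h₃.1.2.1 2 (by norm_num), h₂.1.code]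
    refine DTriple.mono (DTriple.ite (τ := 20 * n + 10) (fun hb => DTriple.mono
      (dtriple_fill (f := fun i => n + i) (M := n) (val := fun i => if h : i < n then
        colL2 A ⟨i, h⟩ * colL2 A ⟨i, h⟩ else 0) (fun i j h => Nat.add_left_cancel h)
        (by norm_num) hn (fun s' hs' => ?_) fun s' hs' hlt => ?_) ?_ fun s' hs' => ?_)
      fun hb => DTriple.mono (dtriple_skip ?_) ?_ fun _ h => h) ?_ fun _ h => h
    · simp [NExp.eval, hs'.2.1 1, hn]
    · simp [RExp.eval, NExp.eval, hlt, colNorm]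
    · simp [RExp.cost, NExp.cost]
      omega
    · have hk0 : k = .frobenius := by
        simp only [Test.holds, NExp.eval, hcode] at hb
        revert hb
        cases k <;> simp [Scheme.code]
      refine ⟨hs'.1, fun j => ?_⟩
      rw [hs'.2 j j.2, hk0]
      simp [colWeight, sq]
    · refine ⟨SameButArr.refl _ _, fun j => ?_⟩
      have hk0 : k ≠ .frobenius := by
        rintro h0
        simp [Test.holds, NExp.eval, hcode, h0, Scheme.code] at hb
      rw [h₃.1.2.2 3 (by norm_num), h₂.2.2.2.2.2]
      revert hk0
      cases k <;> simp [colWeight]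
    · omega
    · simp [Test.cost, NExp.cost]
      omega
  · rw [h₄.1.2.1 1 (by norm_num), h₃.1.2.1 1 (by norm_num), h₂.1.cols]
  · obtain ⟨hp, r3, r4, r5, r6, harr⟩ := h₂
    obtain ⟨f3, t3, l3⟩ := h₃
    obtain ⟨f4, l4⟩ := h₄
    obtain ⟨f5, t5⟩ := h₅
    have hvar : s₅.realVar = s₂.realVar := by rw [f5.1, f4.1, f3.1]
    have harr2 : s₅.realArr 2 = s₃.realArr 2 := by
      rw [f5.2.2.1 2 (by norm_num), f4.2.2 2 (by norm_num)]
    have harr0 : ∀ b, b ≠ 2 → b ≠ 3 → s₅.realArr b = fun _ => 0 := fun b h2 h3 => by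
      rw [f5.2.2.1 b h3, f4.2.2 b h3, f3.2.2 b h2, harr]
    have hroot : s₅.realArr 2 1 = m := by
      rw [harr2, t3.root_eq (Nat.pos_of_ne_zero (NeZero.ne m))]
      simp [l3]
    refine ⟨hp.congr (fun x hx => ?_) (by rw [hvar]) (by rw [hvar]), ⟨?_, fun j => ?_, fun j => ?_,
      ?_, t5, fun j => ?_⟩, ⟨fun i => ?_, fun i => ?_, fun i => ?_, harr2 ▸ t3⟩⟩
    · rw [f5.2.1 x (by omega), f4.2.1 x (by omega), f3.2.1 x (by omega)]
    · rw [hvar, r3]; exact one_pos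
    · simp [harr0, startPoint_eq]
    · simp [harr0, startPoint_eq]
    · simp [harr0, hvar, r6]
    · rw [f5.2.2.2 _ (by omega), l4]
      simp [harr0]
    · rw [harr2, l3]; exact one_pos
    · rw [hroot, harr2, l3, startPoint_eq]
      simp
    · rw [harr2, l3, startPoint_eq]
      simp [harr0, hvar, r5]
  · omega

theorem dtriple_writeOutput {k : Scheme} {η R : ℝ} {t : ℕ} {p : Point n m × Point n m}
    {s : Memory} (h : Rep A k η R t p s) :
    DTriple A writeOutput s (40 * m + 40 * n + 40) fun s' =>
      ((t : ℝ) + 1)⁻¹ • p.2 = Config.output n m ⟨[], s', 0⟩ := by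
  refine DTriple.mono (DTriple.seq (dtriple_fill (f := id) (M := n)
    (val := fun j => (s.realVar 4 * s.realArr 4 j + s.realArr 5 j) / (t + 1))
    Function.injective_id (by norm_num) h.params.cols (fun s' hs' => rfl) fun s' hs' _ => ?_)
    fun s₁ h₁ => DTriple.mono (dtriple_fill (f := id) (M := m)
    (val := fun i => (s.realVar 5 * s.realArr 2 (m + i) + s.realArr 6 i) / (t + 1))
    Function.injective_id (by norm_num) ?_ (fun s' hs' => rfl) fun s' hs' _ => ?_) le_rfl
    fun s₂ h₂ => ?_) ?_ fun _ h => h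
  · simp [RExp.eval, NExp.eval, hs'.1, hs'.2.2, hs'.2.1, h.params.count]
  · rw [h₁.1.2.1 0 (by norm_num), h.params.rows]
  · simp [RExp.eval, NExp.eval, hs'.1, hs'.2.2, hs'.2.1, h₁.1.1, h₁.1.2.1, h₁.1.2.2,
      h.params.count, h.params.rows]
  · refine Prod.ext (funext fun j => ?_) (funext fun i => ?_)
    · have := h₁.2 j j.2
      simp only [id] at this
      simp only [Config.output, Prod.smul_fst, Pi.smul_apply, smul_eq_mul]
      rw [h₂.1.2.2 0 (by norm_num), this, h.repX.total, div_eq_inv_mul]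
    · have := h₂.2 i i.2
      simp only [id] at this
      simp only [Config.output, Prod.smul_snd, Pi.smul_apply, smul_eq_mul]
      rw [this, h.repY.total, div_eq_inv_mul]
  · simp [RExp.cost, NExp.cost]
    omega

/-- A bound for the running time of the program. -/
def timeBound (m n T : ℕ) : ℕ := T * (42 * (levels m + levels n) + 430) + 140 * (m + n) + 300

theorem implements_mirrorProg (hrow : ∀ i, ∃ j, A i j ≠ 0) (hcol : ∀ j, ∃ i, A i j ≠ 0) (ε : ℝ) :
    mirrorProg.Implements A ε (timeBound m n (numIters A ε))
      (mirrorDescent A (bestScheme A) (stepSize A ε) (numIters A ε)) := by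
  refine implements_of_triple (Triple.mono (dtriple_initialization.seq_triple fun s₁ h₁ =>
    Triple.map _ (Triple.seq_dtriple (triple_mainLoop hrow hcol h₁) fun p _ s₂ h₂ =>
      dtriple_writeOutput h₂) fun _ _ _ h => h) ?_ fun _ _ _ h => h)
  rw [timeBound, numIters]
  omega

end InitOutput

/-! ### The running time -/

theorem half_lt_log_two : (1 / 2 : ℝ) < Real.log 2 := by
  have := Real.log_two_gt_d9
  linarith

/-- The factor 2 comes from log 2 > 1/2. -/
theorem levels_le {M : ℕ} [NeZero M] : (levels M : ℝ) ≤ 2 * Real.log M + 1 := by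
  have h : ((2 ^ Nat.log 2 M : ℕ) : ℝ) ≤ M := by exact_mod_cast Nat.pow_log_le_self 2 (NeZero.ne M)
  have h' := Real.log_le_log (by positivity) h
  push_cast at h'
  rw [Real.log_pow] at h'
  rw [levels]
  push_cast
  nlinarith [half_lt_log_two, (Nat.cast_nonneg (Nat.log 2 M) : (0 : ℝ) ≤ _)]

/-- X and Y stand for the two logarithmic factors, so both running-time bounds are instances. Their
lower bound log 2 absorbs additive constants, and the cost of rounding T up is absorbed by m + n. -/
theorem timeBound_le {m n : ℕ} [NeZero m] [NeZero n] {A : Matrix (Fin m) (Fin n) ℝ}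
    {ε X Y : ℝ} (hX : Real.log 2 ≤ X) (hY : Real.log 2 ≤ Y)
    (hmX : Real.log m ≤ X) (hmnY : Real.log m + Real.log n ≤ Y) (hYle : Y ≤ 2 * m + n) :
    (timeBound m n (numIters A ε) : ℝ) ≤ 300000 * (Lco A ^ 2 * X * Y / ε ^ 2 + m + n) := by
  have hl := half_lt_log_two
  have hm : (1 : ℝ) ≤ m := by exact_mod_cast Nat.pos_of_ne_zero (NeZero.ne m)
  have hn : (1 : ℝ) ≤ n := by exact_mod_cast Nat.pos_of_ne_zero (NeZero.ne n)
  have hlm := Real.log_nonneg hm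
  -- The real bound equals 54 Θ L² / ε², and Θ ≤ 2X.
  have hT : (numIters A ε : ℝ) ≤ 108 * X * (Lco A ^ 2 / ε ^ 2) + 1 := by
    have e : 6 * setupRange m / (stepSize A ε * ε) = 54 * setupRange m * (Lco A ^ 2 / ε ^ 2) := by
      rw [stepSize, div_mul_eq_mul_div, div_div_eq_mul_div, ← sq]
      ring
    have h0 : 0 ≤ Lco A ^ 2 / ε ^ 2 := by positivity
    have hΘ : 0 ≤ setupRange m := by
      rw [setupRange]
      linarith
    have hΘ' : setupRange m ≤ 2 * X := by
      rw [setupRange]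
      linarith
    rw [numIters, e]
    refine (Nat.ceil_lt_add_one (mul_nonneg (by linarith) h0)).le.trans ?_
    have := mul_le_mul_of_nonneg_right hΘ' h0
    linarith
  -- The left side is at most 84 (log m + log n) + 514, and 1 ≤ 2Y gives 84 + 1028 = 1112.
  have hlev : 42 * ((levels m : ℝ) + levels n) + 430 ≤ 1112 * Y := by
    have h1 := levels_le (M := m)
    have h2 := levels_le (M := n)
    linarith
  have hprod := mul_le_mul hT hlev (by positivity)
    (add_nonneg (mul_nonneg (by linarith) (by positivity)) zero_le_one)
  have e : (108 * X * (Lco A ^ 2 / ε ^ 2) + 1) * (1112 * Y) =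
      120096 * (Lco A ^ 2 * X * Y / ε ^ 2) + 1112 * Y := by ring
  have hW : 0 ≤ Lco A ^ 2 * X * Y / ε ^ 2 :=
    div_nonneg (mul_nonneg (mul_nonneg (sq_nonneg _) (by linarith)) (by linarith)) (sq_nonneg _)
  rw [timeBound]
  push_cast
  linarith

end L2L1

end

/-! ### Assembly of the theorem -/

open L2L1 in
theorem mainTheorem5 :
    ∃ (P : Prog) (C : ℝ), ∀ (m n : ℕ) [NeZero m] [NeZero n] (A : Matrix (Fin m) (Fin n) ℝ),
      (∀ i, ∃ j, A i j ≠ 0) → (∀ j, ∃ i, A i j ≠ 0) →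
      ∃ k : Scheme, IsBest A k ∧ ∀ ε : ℝ, 0 < ε →
        (∃ τ : ℕ,
          P.Implements A ε τ (mirrorDescent A k (stepSize A ε) (numIters A ε)) ∧
          (τ : ℝ) ≤ C * (Lco A ^ 2 * Real.log (2 * m) * Real.log (2 * m * n) / ε ^ 2 + m + n) ∧
          (2 ≤ m →
            (τ : ℝ) ≤ C * (Lco A ^ 2 * Real.log m * Real.log (m * n) / ε ^ 2 + m + n))) ∧
        (∀ z ∈ (mirrorDescent A k (stepSize A ε) (numIters A ε)).support, z ∈ domain n m) ∧
        ExpectedGapLE A (mirrorDescent A k (stepSize A ε) (numIters A ε)) ε := by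
  refine ⟨mirrorProg, 300000, fun m n _ _ A hrow hcol => ⟨bestScheme A, isBest_bestScheme,
    fun ε hε => ⟨⟨_, implements_mirrorProg hrow hcol ε, ?_, fun hm2 => ?_⟩,
      mirrorDescent_support A _ _ _, expectedGapLE_mirrorDescent hrow hcol isBest_bestScheme hε⟩⟩⟩
  all_goals
    have hm : (1 : ℝ) ≤ m := by exact_mod_cast Nat.pos_of_ne_zero (NeZero.ne m)
    have hn : (1 : ℝ) ≤ n := by exact_mod_cast Nat.pos_of_ne_zero (NeZero.ne n)
    have hl := half_lt_log_two
    have hlm := Real.log_nonneg hm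
    have hln := Real.log_nonneg hn
    have hm' : (m : ℝ) ≠ 0 := by positivity
    have hn' : (n : ℝ) ≠ 0 := by positivity
    have hlm' := Real.log_le_sub_one_of_pos (show (0 : ℝ) < m by linarith)
    have hln' := Real.log_le_sub_one_of_pos (show (0 : ℝ) < n by linarith)
    have hl' := Real.log_le_sub_one_of_pos (show (0 : ℝ) < 2 by norm_num)
  -- The factors 2 keep both logarithms at least log 2, even when m = 1.
  · rw [Real.log_mul (by positivity) hn', Real.log_mul two_ne_zero hm']
    exact timeBound_le (by linarith) (by linarith) (by linarith) (by linarith) (by linarith)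
  -- For m ≥ 2 the logarithm of m plays this role itself.
  · have h2 : Real.log 2 ≤ Real.log m := Real.log_le_log (by norm_num) (by exact_mod_cast hm2)
    rw [Real.log_mul hm' hn']
    exact timeBound_le h2 (by linarith) le_rfl le_rfl (by linarith)
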